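/- Let $H_\alpha:[0,\infty)\to[0,1]$, $\alpha>0$, be an ordered family: for any $\alpha,\alpha'>0$ either $H_\alpha\le H_{\alpha'}$ on $[0,\infty)$ or $H_{\alpha'}\le H_\alpha$ on $[0,\infty)$. For each $n$ let $X=X_n$ be a real $n\times p$ matrix, $p=p_n\le n$, with $X^\top X$ invertible, let $\lambda_k$ and $\mathbf e_k$, $k=1,\dots,p$, be the eigenvalues and an orthonormal system of eigenvectors of $X^\top X$, and let $\mathcal A=[\alpha_{\min},\alpha_{\max}]$ with $0<\alpha_{\min}\le\alpha_{\max}$ (both may depend on $n$). One observes $Y=X\beta+\sigma\xi$ with $\xi\sim\mathcal N(0,I_n)$, $\sigma>0$, $\beta\in\mathbb R^p$. Put $H_\alpha(X^\top X)=\sum_k H_\alpha(\lambda_k)\mathbf e_k\mathbf e_k^\top$, $G_\alpha=2H_\alpha-H_\alpha^2$, $D(\alpha)=\sum_{k=1}^p G_\alpha^2(\lambda_k)$, $1+q_\alpha=\bigl[1-\tfrac1n\sum_{k=1}^pG_\alpha(\lambda_k)\bigr]^{-1}$, \[ \widehat\beta_\alpha(Y)=H_\alpha(X^\top X)(X^\top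 X)^{-1}X^\top Y,\qquad \widehat\sigma^2_\alpha(Y)=\frac{\|Y-X\widehat\beta_\alpha(Y)\|^2}{n}\Bigl[1-\frac{2\,\mathrm{tr}\,H_\alpha(X^\top X)-\mathrm{tr}\,H_\alpha(X^\top X)^2}{n}\Bigr]^{-1}, \] and, for $\epsilon\in(0,1]$ and $Q=4/(\sqrt2-1)^2$, \[ V_\epsilon(\alpha)=(1+\epsilon)\sqrt{2D(\alpha)}\Bigl\{\log\tfrac{D(\alpha)}{D(\alpha_{\max})}+2(1+\epsilon)\log\Bigl[\tfrac{Q}{\epsilon^2}\log\tfrac{D(\alpha)}{D(\alpha_{\max})}\Bigr]\Bigr\}_+^{1/2} \] (so $V_\epsilon(\alpha)=0$ when $D(\alpha)=D(\alpha_{\max})$). Let \[ R_\epsilon(\alpha,\beta)=\Bigl[1+\frac{V_\epsilon(\alpha)}n\Bigr]\Bigl\{[1+q_\alpha]\sum_{k=1}^p[1-H_\alpha(\lambda_k)]^2\lambda_k\langle\beta,\mathbf e_k\rangle^2+\sigma^2V_\epsilon(\alpha)\Bigr\},\quad r=\inf_{\alpha\in\mathcal A}R_\epsilon(\alpha,\beta),\quad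 \rho=\frac{\sigma^2\sqrt{D(\alpha_{\max})}}{r}, \] and let $\widehat\alpha=\widehat\alpha(Y)$ be any minimizer of $\widehat\sigma^2_\alpha(Y)[1+V_\epsilon(\alpha)/n]$ over $\alpha\in\mathcal A$. There is a universal constant $C>0$ such that the following holds. Assume that $D(\alpha_{\max})\le D(\alpha)\le D(\alpha_{\min})$ for all $\alpha\in\mathcal A$ (as is the case when $H_\alpha$ decreases in $\alpha$), that $\sum_kG_\alpha(\lambda_k)\le K\sum_kG^2_\alpha(\lambda_k)$ for all $\alpha>0$ with a constant $K$ independent of $n$, that $D(\alpha_{\min})/n\to0$ as $n\to\infty$, and that $D(\alpha_{\max})\ge5$ for all large $n$. Then for all $\epsilon\in(0,1]$ and $\gamma\in(0,\epsilon/(1+\epsilon))$ there is $n_\gamma$ such that for all $n\ge n_\gamma$, all $\beta\in\mathbb R^p$ and all $\sigma>0$ \[ n\,\mathbf E\Bigl|\widehat\sigma^2_{\widehat\alpha}(Y)-\frac{\|\sigma\xi\|^2}n\Bigr|\le\frac r\gamma\Bigl\{1+D(\alpha_{\max})^{-1/4}\log^{-1/8}(1/\rho)+\Bigl[\frac{C\rho}{\epsilon-\gamma-\gamma\epsilon}\Bigr]^{1/2}\Bigr\}^2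 , \] where the logarithmic term is omitted if $\rho\ge1$, and where for $r=0$ the right-hand side is read as its limit $C\sigma^2\sqrt{D(\alpha_{\max})}/[\gamma(\epsilon-\gamma-\gamma\epsilon)]$ as $r\to0$. -/

import Mathlib

open MeasureTheory ProbabilityTheory Filter Topology Set Matrix

noncomputable section

namespace NoiseLevel

/-- Squared Euclidean norm of a vector. -/
def sqNorm {m : ℕ} (v : Fin m → ℝ) : ℝ := ∑ i, v i ^ 2

section Spectral

variable {n p : ℕ} (X : Matrix (Fin n) (Fin p) ℝ)

theorem gram_isHermitian : (Xᵀ * X).IsHermitian := by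
  simpa using Matrix.isHermitian_conjTranspose_mul_self X

/-- The eigenvalues `λ_k` of `Xᵀ X`, with multiplicity. -/
def eigVal : Fin p → ℝ := (gram_isHermitian X).eigenvalues

/-- An orthonormal basis of eigenvectors `e_k` of `Xᵀ X`. -/
def eigVec (k : Fin p) : Fin p → ℝ := ((gram_isHermitian X).eigenvectorBasis k).ofLp

/-- The coefficient `⟨β, e_k⟩`. -/
def coeff (β : Fin p → ℝ) (k : Fin p) : ℝ := β ⬝ᵥ eigVec X k

/-- The matrix `h(Xᵀ X) = ∑ h(λ_k) e_k e_kᵀ`. -/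
def specFun (h : ℝ → ℝ) : Matrix (Fin p) (Fin p) ℝ :=
  ∑ k, h (eigVal X k) • vecMulVec (eigVec X k) (eigVec X k)

/-- The maximum likelihood estimator `(Xᵀ X)⁻¹ Xᵀ Y`. -/
def mle (Y : Fin n → ℝ) : Fin p → ℝ := (Xᵀ * X)⁻¹ *ᵥ (Xᵀ *ᵥ Y)

end Spectral

/-- `G_α(λ) = 2 H_α(λ) - H_α(λ)²`. -/
def G (H : ℝ → ℝ → ℝ) (α l : ℝ) : ℝ := 2 * H α l - H α l ^ 2

/-- `H_α(λ) ∈ [0,1]` for `α > 0`, `λ ≥ 0`, and any two members of the family are comparable on the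
whole half-line. -/
structure IsOrderedRegularization (H : ℝ → ℝ → ℝ) : Prop where
  nonneg : ∀ α > 0, ∀ l ≥ 0, 0 ≤ H α l
  le_one : ∀ α > 0, ∀ l ≥ 0, H α l ≤ 1
  ordered : ∀ α > 0, ∀ α' > 0, (∀ l ≥ 0, H α l ≤ H α' l) ∨ (∀ l ≥ 0, H α' l ≤ H α l)

section Estimators

variable (H : ℝ → ℝ → ℝ) {n p : ℕ} (X : Matrix (Fin n) (Fin p) ℝ)

/-- `D(α) = ∑_k G_α(λ_k)²`. -/
def D (α : ℝ) : ℝ := ∑ k, G H α (eigVal X k) ^ 2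

/-- `q_α(n) = [1 - n⁻¹ ∑_k G_α(λ_k)]⁻¹ - 1`. -/
def q (α : ℝ) : ℝ := (1 - (∑ k, G H α (eigVal X k)) / n)⁻¹ - 1

/-- The spectral regularization `H_α(Xᵀ X) (Xᵀ X)⁻¹ Xᵀ Y`. -/
def betaHat (α : ℝ) (Y : Fin n → ℝ) : Fin p → ℝ := specFun X (H α) *ᵥ mle X Y

/-- The estimator of `σ²` with regularization parameter `α`. -/
def sigmaSqHat (α : ℝ) (Y : Fin n → ℝ) : ℝ :=
  sqNorm (Y - X *ᵥ betaHat H X α Y) / n *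
    (1 - (2 * (specFun X (H α)).trace - (specFun X (H α) ^ 2).trace) / n)⁻¹

/-- `Q = 4 / (√2 - 1)²`. -/
def Q : ℝ := 4 / (√2 - 1) ^ 2

/-- The envelope `V_ε(α)`, for the right end point `aMax`. The expression in braces is replaced by
its positive part: `Real.sqrt` is `0` on negative numbers, and when `D(α) = D(aMax)`, where that
expression is `-∞`, the value of `V` is `0` too, because `Real.log 0 = 0`. -/
def V (aMax ε α : ℝ) : ℝ :=
  (1 + ε) * √(2 * D H X α) *
    √(Real.log (D H X α / D H X aMax) +
      2 * (1 + ε) * Real.log (Q / ε ^ 2 * Real.log (D H X α / D H X aMax)))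

/-- `αHat Y` is, for every data vector `Y`, a minimizer of `σ̂²_α(Y) [1 + V_ε(α)/n]` over
`[aMin, aMax]`. -/
def IsSelector (aMin aMax ε : ℝ) (αHat : (Fin n → ℝ) → ℝ) : Prop :=
  ∀ Y, αHat Y ∈ Icc aMin aMax ∧
    IsMinOn (fun α => sigmaSqHat H X α Y * (1 + V H X aMax ε α / n)) (Icc aMin aMax) (αHat Y)

/-- `R_ε(α, β)`. -/
def risk (aMax ε σ : ℝ) (β : Fin p → ℝ) (α : ℝ) : ℝ :=
  (1 + V H X aMax ε α / n) *
    ((1 + q H X α) * ∑ k, (1 - H α (eigVal X k)) ^ 2 * eigVal X k * coeff X β k ^ 2 +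
      σ ^ 2 * V H X aMax ε α)

/-- The oracle risk `r`, the infimum of `R_ε(α, β)` over `α ∈ [aMin, aMax]`. -/
def oracleRisk (aMin aMax ε σ : ℝ) (β : Fin p → ℝ) : ℝ :=
  sInf (risk H X aMax ε σ β '' Icc aMin aMax)

/-- `ρ = σ² √D(aMax) / r`. -/
def rho (aMin aMax ε σ : ℝ) (β : Fin p → ℝ) : ℝ :=
  σ ^ 2 * √(D H X aMax) / oracleRisk H X aMin aMax ε σ β

/-- The law of standard white Gaussian noise `ξ` in `ℝⁿ`. -/
def whiteNoise (n : ℕ) : Measure (Fin n → ℝ) := Measure.pi fun _ => gaussianReal 0 1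

/-- The expectation of `n |σ̂²_{α̂(Y)}(Y) - ‖σξ‖²/n|` for `Y = Xβ + σξ`. -/
def expectedDeviation (αHat : (Fin n → ℝ) → ℝ) (σ : ℝ) (β : Fin p → ℝ) : ENNReal :=
  ∫⁻ ξ, ENNReal.ofReal
    (n * |sigmaSqHat H X (αHat (X *ᵥ β + σ • ξ)) (X *ᵥ β + σ • ξ) - sqNorm (σ • ξ) / n|)
    ∂(whiteNoise n)

end Estimators

/-- `log^{-1/8}(1/ρ)`; the term is omitted where it makes no sense, that is, for `ρ ≥ 1`. -/
def logTerm (ρ : ℝ) : ℝ := if ρ < 1 then Real.log (1 / ρ) ^ (-(1 / 8) : ℝ) else 0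

end NoiseLevel

end

open NoiseLevel

open NoiseLevel

/-! Rotate to the left singular vectors of `X` and divide by `σ²`. Then `n σ̂²_α - ‖σξ‖²` becomes `Δ
= (1 + q)(B + 2⟨(1 - g)θ, z⟩ - χ_g) + q χ_1`, where `g` lists the `G_α(λ_k)`, `B = ∑ (1 - g)θ²` is
the bias, `χ_g = ∑ g (z² - 1)` and `z` is white noise. With `v = V_ε`, minimality of `α̂` against a
fixed `α` bounds `Δ(1 + v/n) + v‖z‖²/n` at `α̂` by its value `Z` at `α`, whose mean is at most the
risk. If `Δ ≥ 0`, this already bounds `Δ`. If `Δ < 0`, then `|Δ|` is at most about `v (1 + κ)/(1 +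
ε)` plus noise, while minimality says that `v` is at most about `Z + |Δ|`; the gap between the two
factors leaves `γ|Δ| ≤ Z + noise` (`abs_deviation_le`).

It remains to show that the excesses of the random terms over their envelopes, uniformly in `α`,
have mean `O(√D₀/κ)` with `D₀ = D(α_max)`. The main one is `χ_g` (`exists_chi_envelope`). For an
ordered family `‖g - g'‖² ≤ |‖g‖² - ‖g'‖²|`, so the process has a one-dimensional index, and
chaining by bisection (`lintegral_sup_exp_le`) costs only a constant factor on a short range of
`‖g‖²`. To keep the sharp constant in the exponent, the chaining is done under the law tilted by the
largest member (`lintegral_sup_chi_sub_le`); summing over slices of `log(‖g‖²/D₀)` produces the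
iterated logarithm in the envelope. The cross term is absorbed by `B` (`exists_cross_envelope`), and
`q χ_1` involves a single random variable (`exists_total_noise_envelope`).

The selector may be any map, so the uniform bounds are stated through measurable majorants. Finally,
`∑ G ≤ K ∑ G²` and `D(α_min)/n → 0` make `q` and `v/n` uniformly small. -/

/-! ### Measurable majorants and chaining. -/

theorem measurable_finset_sup_ennreal {ι Ω : Type*} [MeasurableSpace Ω] (S : Finset ι)
    {φ : ι → Ω → ENNReal} (h : ∀ i ∈ S, Measurable (φ i)) :
    Measurable fun ω => S.sup fun i => φ i ω := by
  simp_rw [Finset.sup_eq_iSup]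
  exact Measurable.biSup _ S.countable_toSet fun i hi => h i hi

/-- Continuity in the index reduces the supremum to a countable dense subset of `T`; monotone
convergence over the finite subsets of it then transfers the bound. No measurability of a supremum
over `T` is needed. -/
theorem exists_measurable_majorant {ι Ω : Type*} [TopologicalSpace ι] [SecondCountableTopology ι]
    [MeasurableSpace Ω] (μ : Measure Ω) (T : Set ι) (φ : ι → Ω → ENNReal)
    (hm : ∀ i, Measurable (φ i)) (hc : ∀ ω, Continuous fun i => φ i ω) (c : ENNReal)
    (h : ∀ S : Finset ι, ↑S ⊆ T → ∫⁻ ω, S.sup (fun i => φ i ω) ∂μ ≤ c) :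
    ∃ Y : Ω → ENNReal, Measurable Y ∧ (∀ ω, ∀ i ∈ T, φ i ω ≤ Y ω) ∧ ∫⁻ ω, Y ω ∂μ ≤ c := by
  classical
  obtain ⟨D, hDc, hDd⟩ := TopologicalSpace.exists_countable_dense T
  have : Countable D := hDc
  refine ⟨fun ω => ⨆ S : Finset D, S.sup (fun i => φ i.1.1 ω), ?_, ?_, ?_⟩
  · refine Measurable.iSup fun S => ?_
    exact measurable_finset_sup_ennreal _ fun i _ => hm _
  · intro ω i hi
    have hcl : IsClosed {i : T | φ i.1 ω ≤ ⨆ S : Finset D, S.sup (fun i => φ i.1.1 ω)} :=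
      isClosed_le ((hc ω).comp continuous_subtype_val) continuous_const
    have hsub : D ⊆ {i : T | φ i.1 ω ≤ ⨆ S : Finset D, S.sup (fun i => φ i.1.1 ω)} := by
      intro j hj
      refine le_trans ?_ (le_iSup (fun S : Finset D => S.sup (fun i => φ i.1.1 ω)) {⟨j, hj⟩})
      simp
    have : (⟨i, hi⟩ : T) ∈ closure D := hDd _
    exact hcl.closure_subset_iff.2 hsub this
  · rw [lintegral_iSup_directed]
    · refine iSup_le fun S => ?_
      have := h (S.image fun i => i.1.1) (by
        intro x hx
        obtain ⟨y, _, rfl⟩ := Finset.mem_image.1 (Finset.mem_coe.1 hx)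
        exact y.1.2)
      simpa [Finset.sup_image, Function.comp_def] using this
    · intro S
      exact (measurable_finset_sup_ennreal _ fun i _ => hm _).aemeasurable
    · intro S S'
      exact ⟨S ∪ S', fun ω => Finset.sup_mono Finset.subset_union_left,
        fun ω => Finset.sup_mono Finset.subset_union_right⟩

/-- Hölder with exponents `4` and `4/3`: since `81 = 3⁴` and `256 = 4⁴`, the bound is `3 · 4³ =
192`. -/
theorem lintegral_exp_mul_le {Ω : Type*} [MeasurableSpace Ω] (μ : Measure Ω)
    (U A : Ω → ENNReal) (hU : Measurable U) (hA : Measurable A)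
    (hU4 : ∫⁻ ω, U ω ^ (4 : ℝ) ∂μ ≤ 81) (hA4 : ∫⁻ ω, A ω ∂μ ≤ 256) :
    ∫⁻ ω, U ω * A ω ^ (3 / 4 : ℝ) ∂μ ≤ 192 := by
  have hpq : (4 : ℝ).HolderConjugate (4 / 3) := by
    rw [Real.holderConjugate_iff]; norm_num
  refine (ENNReal.lintegral_mul_le_Lp_mul_Lq μ hpq hU.aemeasurable
    (hA.pow_const _).aemeasurable).trans ?_
  have h1 : (∫⁻ ω, U ω ^ (4 : ℝ) ∂μ) ^ (1 / 4 : ℝ) ≤ 3 := by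
    refine (ENNReal.rpow_le_rpow hU4 (by norm_num)).trans ?_
    rw [show (81 : ENNReal) = 3 ^ (4 : ℝ) by norm_num [show (4 : ℝ) = ((4 : ℕ) : ℝ) by norm_num, ENNReal.rpow_natCast, -Nat.cast_ofNat],
      ← ENNReal.rpow_mul]
    norm_num
  have h2 : (∫⁻ ω, (A ω ^ (3 / 4 : ℝ)) ^ (4 / 3 : ℝ) ∂μ) ^ (1 / (4 / 3) : ℝ) ≤ 64 := by
    simp_rw [← ENNReal.rpow_mul]
    norm_num
    refine (ENNReal.rpow_le_rpow hA4 (by norm_num)).trans ?_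
    rw [show (256 : ENNReal) = 4 ^ (4 : ℝ) by norm_num [show (4 : ℝ) = ((4 : ℕ) : ℝ) by norm_num, ENNReal.rpow_natCast, -Nat.cast_ofNat],
      ← ENNReal.rpow_mul]
    norm_num [show (3 : ℝ) = ((3 : ℕ) : ℝ) by norm_num, ENNReal.rpow_natCast, -Nat.cast_ofNat]
  calc _ ≤ (3 : ENNReal) * 64 := mul_le_mul' h1 h2
    _ = 192 := by norm_num

/-- Bisection of the range of `F`, by induction on the number of points. Halving `v` allows `s` to
grow by the factor `4/3`, because `(4/3)²/2 < 1`. The lower half costs `256^{3/4} = 64` by Jensen;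
the upper half first jumps from `a` to its own lowest point and costs `192` by Hölder. As `64 + 192
= 256`, the constant reproduces itself. -/
theorem lintegral_sup_exp_le {ι Ω : Type*} [MeasurableSpace Ω] (μ : Measure Ω)
    [IsProbabilityMeasure μ] (F : ι → ℝ) (Z : ι → Ω → ℝ) (hZ : ∀ i, Measurable (Z i))
    (T : Set ι) (hF : ∀ i ∈ T, ∀ j ∈ T, F i = F j → Z i = Z j)
    (hinc : ∀ i ∈ T, ∀ j ∈ T, ∀ s : ℝ, 0 ≤ s → s ^ 2 * |F i - F j| ≤ 1 →
      ∫⁻ ω, ENNReal.ofReal (Real.exp (s * |Z i ω - Z j ω|)) ∂μ ≤ 81) (k : ℕ) :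
    ∀ (S : Finset ι), S.card ≤ k → ↑S ⊆ T → ∀ a ∈ S, (∀ i ∈ S, F a ≤ F i) → ∀ s v : ℝ, 0 ≤ s →
      16 * s ^ 2 * v ≤ 1 → (∀ i ∈ S, F i ≤ F a + v) →
      ∫⁻ ω, S.sup (fun i => ENNReal.ofReal (Real.exp (s * |Z i ω - Z a ω|))) ∂μ ≤ 256 := by
  classical
  induction k with
  | zero =>
    intro S hk _ a ha
    simp at hk
    simp [hk] at ha
  | succ k ih =>
    intro S hk hST a ha hmin s v hs hsv hspread
    have hmeas : ∀ (s : ℝ) (i j : ι),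
        Measurable fun ω => ENNReal.ofReal (Real.exp (s * |Z i ω - Z j ω|)) := by
      intro s i j
      have := hZ i; have := hZ j
      fun_prop
    obtain ⟨c, hc, hcmax⟩ := S.exists_max_image F ⟨a, ha⟩
    rcases eq_or_lt_of_le (hmin c hc) with heq | hlt
    · have : ∀ i ∈ S, Z i = Z a := fun i hi =>
        hF i (hST hi) a (hST ha) (le_antisymm (heq ▸ hcmax i hi) (hmin i hi))
      calc _ ≤ ∫⁻ ω, 1 ∂μ := by
            refine lintegral_mono fun ω => Finset.sup_le fun i hi => ?_
            simp [this i hi]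
        _ ≤ 256 := by simp
    set d := F c - F a with hd
    have hdv : d ≤ v := by have := hspread c hc; linarith
    have hd0 : 0 < d := by linarith
    set L := S.filter (fun i => F i ≤ F a + d / 2) with hL
    set R := S.filter (fun i => ¬ F i ≤ F a + d / 2) with hR
    have haL : a ∈ L := by simp [hL, ha]; linarith
    have hcR : c ∈ R := by simp [hR, hc]; linarith
    have hcard : L.card + R.card = S.card := Finset.card_filter_add_card_filter_not _
    have hL1 : 0 < L.card := Finset.card_pos.2 ⟨a, haL⟩
    have hR1 : 0 < R.card := Finset.card_pos.2 ⟨c, hcR⟩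
    have hLS : L ⊆ S := Finset.filter_subset _ _
    have hRS : R ⊆ S := Finset.filter_subset _ _
    obtain ⟨b, hb, hbmin⟩ := R.exists_min_image F ⟨c, hcR⟩
    have hs2 : 16 * (4 / 3 * s) ^ 2 * (d / 2) ≤ 1 := by
      have : s ^ 2 * d ≤ s ^ 2 * v := by gcongr
      nlinarith [mul_nonneg (sq_nonneg s) hd0.le]
    have ihL := ih L (by omega) (fun i hi => hST (hLS hi)) a haL (fun i hi => hmin i (hLS hi)) (4 / 3 * s) (d / 2) (by positivity) hs2
      (fun i hi => (Finset.mem_filter.1 hi).2)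
    have ihR := ih R (by omega) (fun i hi => hST (hRS hi)) b hb hbmin (4 / 3 * s) (d / 2) (by positivity) hs2
      (fun i hi => by
        have h1 := hcmax i (hRS hi)
        have h2 := (Finset.mem_filter.1 hb).2
        linarith)
    set AL := fun ω => L.sup (fun i => ENNReal.ofReal (Real.exp (4 / 3 * s * |Z i ω - Z a ω|)))
    set AR := fun ω => R.sup (fun i => ENNReal.ofReal (Real.exp (4 / 3 * s * |Z i ω - Z b ω|)))
    have hALm : Measurable AL := measurable_finset_sup_ennreal _ fun i _ => hmeas _ _ _
    have hARm : Measurable AR := measurable_finset_sup_ennreal _ fun i _ => hmeas _ _ _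
    have hpow : ∀ x : ℝ, ENNReal.ofReal (Real.exp (s * x)) =
        ENNReal.ofReal (Real.exp (4 / 3 * s * x)) ^ (3 / 4 : ℝ) := by
      intro x
      rw [ENNReal.ofReal_rpow_of_pos (Real.exp_pos _), ← Real.exp_mul]
      congr 2; ring
    set U := fun ω => ENNReal.ofReal (Real.exp (s * |Z b ω - Z a ω|))
    have key : ∀ ω, S.sup (fun i => ENNReal.ofReal (Real.exp (s * |Z i ω - Z a ω|))) ≤
        AL ω ^ (3 / 4 : ℝ) + U ω * AR ω ^ (3 / 4 : ℝ) := by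
      intro ω
      refine Finset.sup_le fun i hi => ?_
      by_cases hiL : F i ≤ F a + d / 2
      · refine le_trans ?_ le_self_add
        rw [hpow]
        gcongr
        exact Finset.le_sup (f := fun i => ENNReal.ofReal (Real.exp (4 / 3 * s * |Z i ω - Z a ω|)))
          (Finset.mem_filter.2 ⟨hi, hiL⟩)
      · refine le_trans ?_ le_add_self
        calc ENNReal.ofReal (Real.exp (s * |Z i ω - Z a ω|))
            ≤ ENNReal.ofReal (Real.exp (s * |Z b ω - Z a ω|) * Real.exp (s * |Z i ω - Z b ω|)) := by
              rw [← Real.exp_add, ← mul_add]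
              gcongr
              have := abs_add_le (Z b ω - Z a ω) (Z i ω - Z b ω)
              simpa using this
          _ = U ω * ENNReal.ofReal (Real.exp (s * |Z i ω - Z b ω|)) :=
              ENNReal.ofReal_mul (Real.exp_pos _).le
          _ ≤ _ := by
              rw [hpow |Z i ω - Z b ω|]
              gcongr
              exact Finset.le_sup (f := fun i => ENNReal.ofReal (Real.exp (4 / 3 * s * |Z i ω - Z b ω|)))
                (Finset.mem_filter.2 ⟨hi, hiL⟩)
    -- The fourth power replaces `s` by `4s`; this is the origin of the `16` in `16 s² v ≤ 1`.
    have hU4 : ∫⁻ ω, U ω ^ (4 : ℝ) ∂μ ≤ 81 := by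
      have h1 : ∀ ω, U ω ^ (4 : ℝ) = ENNReal.ofReal (Real.exp ((4 * s) * |Z b ω - Z a ω|)) := by
        intro ω
        rw [ENNReal.ofReal_rpow_of_pos (Real.exp_pos _), ← Real.exp_mul]
        congr 2; ring
      simp_rw [h1]
      refine hinc b (hST (hRS hb)) a (hST ha) (4 * s) (by positivity) ?_
      rw [abs_of_nonneg (by linarith [hmin b (hRS hb)])]
      have : s ^ 2 * (F b - F a) ≤ s ^ 2 * v := by
        gcongr
        linarith [hspread b (hRS hb)]
      nlinarith
    have h2 := lintegral_exp_mul_le μ U AR (hmeas _ _ _) hARm hU4 ihR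
    have h3 : ∫⁻ ω, AL ω ^ (3 / 4 : ℝ) ∂μ ≤ 64 := by
      have hpq : (4 : ℝ).HolderConjugate (4 / 3) := by
        rw [Real.holderConjugate_iff]; norm_num
      have := ENNReal.lintegral_mul_le_Lp_mul_Lq μ hpq (f := fun _ => 1) aemeasurable_const
        (hALm.pow_const (3 / 4 : ℝ)).aemeasurable
      simp only [Pi.mul_apply, one_mul, ENNReal.one_rpow, lintegral_const, measure_univ, mul_one] at this
      refine this.trans ?_
      simp_rw [← ENNReal.rpow_mul]
      norm_num
      refine (ENNReal.rpow_le_rpow ihL (by norm_num)).trans ?_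
      rw [show (256 : ENNReal) = 4 ^ (4 : ℝ) by norm_num [show (4 : ℝ) = ((4 : ℕ) : ℝ) by norm_num, ENNReal.rpow_natCast, -Nat.cast_ofNat],
        ← ENNReal.rpow_mul]
      norm_num [show (3 : ℝ) = ((3 : ℕ) : ℝ) by norm_num, ENNReal.rpow_natCast, -Nat.cast_ofNat]
    calc _ ≤ ∫⁻ ω, (AL ω ^ (3 / 4 : ℝ) + U ω * AR ω ^ (3 / 4 : ℝ)) ∂μ := lintegral_mono key
      _ = ∫⁻ ω, AL ω ^ (3 / 4 : ℝ) ∂μ + ∫⁻ ω, U ω * AR ω ^ (3 / 4 : ℝ) ∂μ :=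
          lintegral_add_left (hALm.pow_const _) _
      _ ≤ 64 + 192 := add_le_add h3 h2
      _ = 256 := by norm_num

/-! ### Laplace transforms of chi-square forms and the tilted noise. -/

/-- The centered weighted chi-square form `∑ c_i (z_i² - 1)`. -/
noncomputable def chi {n : ℕ} (c z : Fin n → ℝ) : ℝ := ∑ i, c i * (z i ^ 2 - 1)

/-- The logarithmic moment generating function of `z² - 1` for a standard Gaussian `z`. -/
noncomputable def chiLogMgf (c : ℝ) : ℝ := -c - Real.log (1 - 2 * c) / 2

instance isProbabilityMeasure_whiteNoise (n : ℕ) : IsProbabilityMeasure (whiteNoise n) := by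
  unfold whiteNoise; infer_instance

theorem gaussian_exp_sq {c : ℝ} (hc : c < 1 / 2) :
    Integrable (fun x : ℝ => Real.exp (c * (x ^ 2 - 1))) (gaussianReal 0 1) ∧
      ∫ x, Real.exp (c * (x ^ 2 - 1)) ∂gaussianReal 0 1 = Real.exp (chiLogMgf c) := by
  have hpos : 0 < 1 / 2 - c := by linarith
  have hfun : ∀ x : ℝ, gaussianPDFReal 0 1 x • Real.exp (c * (x ^ 2 - 1)) =
      ((√(2 * Real.pi))⁻¹ * Real.exp (-c)) * Real.exp (-(1 / 2 - c) * x ^ 2) := by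
    intro x
    simp only [gaussianPDFReal, smul_eq_mul, NNReal.coe_one, mul_one, sub_zero]
    rw [mul_assoc, mul_assoc, ← Real.exp_add, ← Real.exp_add]
    congr 2; ring
  have hg : gaussianReal 0 1 = volume.withDensity (gaussianPDF 0 1) := gaussianReal_of_var_ne_zero 0 one_ne_zero
  constructor
  · rw [hg, integrable_withDensity_iff_integrable_smul' (measurable_gaussianPDF 0 1)
      (ae_of_all _ fun x => gaussianPDF_lt_top)]
    have h1 : (fun x : ℝ => (gaussianPDF 0 1 x).toReal • Real.exp (c * (x ^ 2 - 1))) =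
        fun x => ((√(2 * Real.pi))⁻¹ * Real.exp (-c)) * Real.exp (-(1 / 2 - c) * x ^ 2) := by
      ext x; rw [toReal_gaussianPDF, hfun]
    rw [h1]
    exact (integrable_exp_neg_mul_sq hpos).const_mul _
  · rw [integral_gaussianReal_eq_integral_smul one_ne_zero]
    simp_rw [hfun]
    rw [integral_const_mul, integral_gaussian, chiLogMgf]
    have h2 : Real.exp (-c - Real.log (1 - 2 * c) / 2) =
        Real.exp (-c) * (√(1 - 2 * c))⁻¹ := by
      rw [sub_eq_add_neg, Real.exp_add, Real.exp_neg (_ / 2), Real.sqrt_eq_rpow,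
        Real.rpow_def_of_pos (by linarith)]
      ring_nf
    rw [h2, mul_comm (√(2 * Real.pi))⁻¹, mul_assoc]
    congr 1
    rw [← Real.sqrt_inv, ← Real.sqrt_mul (by positivity), ← Real.sqrt_inv]
    congr 1
    have : 1 - 2 * c ≠ 0 := by linarith
    have : 1 / 2 - c ≠ 0 := hpos.ne'
    field_simp

theorem gaussian_exp_linear (c : ℝ) :
    Integrable (fun x : ℝ => Real.exp (c * x)) (gaussianReal 0 1) ∧
      ∫ x, Real.exp (c * x) ∂gaussianReal 0 1 = Real.exp (c ^ 2 / 2) := by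
  refine ⟨integrable_exp_mul_gaussianReal c, ?_⟩
  have := mgf_gaussianReal (p := gaussianReal 0 1) (X := id) (μ := 0) (v := 1) (by simp) c
  simpa [mgf] using this

theorem lintegral_exp_sum_whiteNoise {n : ℕ} (f : Fin n → ℝ → ℝ) (a : Fin n → ℝ)
    (h : ∀ i, Integrable (fun x => Real.exp (f i x)) (gaussianReal 0 1) ∧
      ∫ x, Real.exp (f i x) ∂gaussianReal 0 1 = Real.exp (a i)) :
    ∫⁻ z, ENNReal.ofReal (Real.exp (∑ i, f i (z i))) ∂whiteNoise n =
      ENNReal.ofReal (Real.exp (∑ i, a i)) := by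
  unfold whiteNoise
  simp_rw [Real.exp_sum]
  rw [← ofReal_integral_eq_lintegral_ofReal]
  · rw [integral_fintype_prod_eq_prod (fun i x => Real.exp (f i x))]
    simp_rw [fun i => (h i).2]
  · exact Integrable.fintype_prod fun i => (h i).1
  · exact ae_of_all _ fun z => Finset.prod_nonneg fun i _ => (Real.exp_pos _).le

theorem lintegral_exp_chi {n : ℕ} {c : Fin n → ℝ} (hc : ∀ i, c i < 1 / 2) :
    ∫⁻ z, ENNReal.ofReal (Real.exp (chi c z)) ∂whiteNoise n =
      ENNReal.ofReal (Real.exp (∑ i, chiLogMgf (c i))) :=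
  lintegral_exp_sum_whiteNoise (fun i x => c i * (x ^ 2 - 1)) _ fun i => gaussian_exp_sq (hc i)

theorem lintegral_exp_linear {n : ℕ} (c : Fin n → ℝ) :
    ∫⁻ z, ENNReal.ofReal (Real.exp (∑ i, c i * z i)) ∂whiteNoise n =
      ENNReal.ofReal (Real.exp (∑ i, c i ^ 2 / 2)) :=
  lintegral_exp_sum_whiteNoise (fun i x => c i * x) _ fun i => gaussian_exp_linear (c i)

theorem chiLogMgf_le {x : ℝ} (hx : |x| ≤ 1 / 4) : chiLogMgf x ≤ x ^ 2 + 8 * |x| ^ 3 := by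
  have h1 : |2 * x| = 2 * |x| := by rw [abs_mul]; norm_num
  have h := Real.abs_log_sub_add_sum_range_le (x := 2 * x) (by rw [h1]; linarith) 2
  simp only [Finset.sum_range_succ, Finset.sum_range_zero] at h
  norm_num at h
  have h2 : (2 * |x|) ^ 3 / (1 - 2 * |x|) ≤ 16 * |x| ^ 3 := by
    rw [div_le_iff₀ (by linarith)]
    have : 0 ≤ |x| ^ 3 := by positivity
    nlinarith
  have h3 := (abs_le.1 h).1
  unfold chiLogMgf
  nlinarith

theorem chiLogMgf_le_sq {x : ℝ} (hx : |x| ≤ 1 / 4) : chiLogMgf x ≤ 3 * x ^ 2 := by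
  have := chiLogMgf_le hx
  have h2 : |x| ^ 3 = x ^ 2 * |x| := by rw [pow_succ, sq_abs]
  nlinarith [sq_nonneg x]

/-- Tilting by `exp(x(z² - 1))` gives `z` the variance `1/(1 - 2x)`. The linear term is the
resulting mean of `y(z² - 1)`, the last term the logarithmic moment generating function of its
centered version. -/
theorem chiLogMgf_add {x y : ℝ} (hx : x < 1 / 2) (hxy : x + y < 1 / 2) :
    chiLogMgf (x + y) = chiLogMgf x + 2 * x / (1 - 2 * x) * y + chiLogMgf (y / (1 - 2 * x)) := by
  unfold chiLogMgf
  have h0 : 1 - 2 * x ≠ 0 := by linarith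
  have h1 : 1 - 2 * (x + y) = (1 - 2 * x) * (1 - 2 * (y / (1 - 2 * x))) := by field_simp; ring
  have h2 : 1 - 2 * (y / (1 - 2 * x)) ≠ 0 := by
    intro h; rw [h, mul_zero] at h1; linarith
  have h3 : 2 * x / (1 - 2 * x) * y - y / (1 - 2 * x) = -y := by field_simp; ring
  rw [h1, Real.log_mul h0 h2]
  linarith

theorem measurable_chi {n : ℕ} (c : Fin n → ℝ) : Measurable (chi c) := by
  unfold chi; fun_prop

theorem continuous_chi {n : ℕ} (z : Fin n → ℝ) : Continuous fun c : Fin n → ℝ => chi c z := by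
  unfold chi; fun_prop

/-- Coordinatewise, `(b - a)² ≤ b² - a²` for `0 ≤ a ≤ b`. This turns the order into a real index,
`‖g‖²`, for the chaining. -/
theorem sqNorm_sub_le_abs {n : ℕ} {g g' : Fin n → ℝ} (hg : 0 ≤ g) (hg' : 0 ≤ g')
    (h : g ≤ g' ∨ g' ≤ g) : sqNorm (g - g') ≤ |sqNorm g - sqNorm g'| := by
  have main : ∀ a b : Fin n → ℝ, 0 ≤ a → a ≤ b → sqNorm (a - b) ≤ sqNorm b - sqNorm a := by
    intro a b ha hab
    unfold sqNorm
    rw [← Finset.sum_sub_distrib]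
    refine Finset.sum_le_sum fun i _ => ?_
    have h1 : 0 ≤ a i := ha i
    have h2 := hab i
    simp only [Pi.sub_apply]
    nlinarith
  rcases h with h | h
  · exact (main g g' hg h).trans (by rw [abs_sub_comm]; exact le_abs_self _)
  · have : sqNorm (g - g') = sqNorm (g' - g) := by
      unfold sqNorm
      exact Finset.sum_congr rfl fun i _ => by simp only [Pi.sub_apply]; ring
    rw [this]
    exact (main g' g hg' h).trans (le_abs_self _)

theorem eq_of_sqNorm_sub_eq_zero {n : ℕ} {g g' : Fin n → ℝ} (h : sqNorm (g - g') ≤ 0) :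
    g = g' := by
  unfold sqNorm at h
  have h0 := (Finset.sum_eq_zero_iff_of_nonneg fun i _ => sq_nonneg ((g - g') i)).1
    (le_antisymm h (Finset.sum_nonneg fun i _ => sq_nonneg _))
  ext i
  have := h0 i (Finset.mem_univ i)
  simpa [sub_eq_zero] using this

theorem sqNorm_nonneg {n : ℕ} (g : Fin n → ℝ) : 0 ≤ sqNorm g :=
  Finset.sum_nonneg fun i _ => sq_nonneg (g i)

theorem sqNorm_mono {n : ℕ} {g g' : Fin n → ℝ} (hg : 0 ≤ g) (h : g ≤ g') :
    sqNorm g ≤ sqNorm g' := by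
  unfold sqNorm
  gcongr with i
  · exact hg i
  · exact h i

/-- White noise tilted by the exponential of a weighted chi-square form. -/
noncomputable def tiltedNoise {n : ℕ} (x : Fin n → ℝ) : Measure (Fin n → ℝ) :=
  (whiteNoise n).withDensity fun z => ENNReal.ofReal (Real.exp (chi x z - ∑ i, chiLogMgf (x i)))

/-- The mean of `chi g` under the noise tilted by `chi x`. -/
noncomputable def tiltedMean {n : ℕ} (x g : Fin n → ℝ) : ℝ := ∑ i, 2 * x i / (1 - 2 * x i) * g i

theorem measurable_tiltDensity {n : ℕ} (x : Fin n → ℝ) : Measurable fun z =>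
    ENNReal.ofReal (Real.exp (chi x z - ∑ i, chiLogMgf (x i))) := by
  have := measurable_chi x
  fun_prop

theorem lintegral_tiltedNoise_exp {n : ℕ} {x d : Fin n → ℝ} (hx : ∀ i, x i < 1 / 2)
    (hxd : ∀ i, x i + d i < 1 / 2) :
    ∫⁻ z, ENNReal.ofReal (Real.exp (chi d z - tiltedMean x d)) ∂tiltedNoise x =
      ENNReal.ofReal (Real.exp (∑ i, chiLogMgf (d i / (1 - 2 * x i)))) := by
  have hm : Measurable fun z => ENNReal.ofReal (Real.exp (chi d z - tiltedMean x d)) := by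
    have := measurable_chi d
    fun_prop
  rw [tiltedNoise, lintegral_withDensity_eq_lintegral_mul _ (measurable_tiltDensity x) hm]
  have h1 : ∀ z, ((fun z => ENNReal.ofReal (Real.exp (chi x z - ∑ i, chiLogMgf (x i)))) *
      fun z => ENNReal.ofReal (Real.exp (chi d z - tiltedMean x d))) z =
      ENNReal.ofReal (Real.exp (-(∑ i, chiLogMgf (x i)) - tiltedMean x d)) *
        ENNReal.ofReal (Real.exp (chi (x + d) z)) := by
    intro z
    rw [Pi.mul_apply, ← ENNReal.ofReal_mul (Real.exp_pos _).le,
      ← ENNReal.ofReal_mul (Real.exp_pos _).le, ← Real.exp_add, ← Real.exp_add]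
    congr 2
    have : chi (x + d) z = chi x z + chi d z := by
      unfold chi; rw [← Finset.sum_add_distrib]
      exact Finset.sum_congr rfl fun i _ => by simp only [Pi.add_apply]; ring
    rw [this]; ring
  simp_rw [h1]
  rw [lintegral_const_mul' _ _ ENNReal.ofReal_ne_top, lintegral_exp_chi (c := x + d) hxd,
    ← ENNReal.ofReal_mul (Real.exp_pos _).le, ← Real.exp_add]
  congr 2
  have : ∀ i, chiLogMgf ((x + d) i) = chiLogMgf (x i) + 2 * x i / (1 - 2 * x i) * d i +
      chiLogMgf (d i / (1 - 2 * x i)) := fun i => chiLogMgf_add (hx i) (hxd i)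
  simp_rw [this, Finset.sum_add_distrib, tiltedMean]
  ring

theorem isProbabilityMeasure_tiltedNoise {n : ℕ} {x : Fin n → ℝ} (hx : ∀ i, x i < 1 / 2) :
    IsProbabilityMeasure (tiltedNoise x) := by
  have h := lintegral_tiltedNoise_exp (d := 0) hx (by simpa using hx)
  constructor
  simpa [chi, tiltedMean, chiLogMgf] using h

/-- Weights `x ≤ 1/4` at most double the variances, so the centered increments are sub-exponential
with universal constants. This is the increment hypothesis of `lintegral_sup_exp_le` under the
tilted law. -/
theorem tiltedNoise_increment {n : ℕ} {x g g' : Fin n → ℝ} 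
    (hx : ∀ i, x i ≤ 1 / 4) {s : ℝ} (hs : 64 * s ^ 2 * sqNorm (g - g') ≤ 1) :
    ∫⁻ z, ENNReal.ofReal (Real.exp (s * |(chi g z - tiltedMean x g) -
      (chi g' z - tiltedMean x g')|)) ∂tiltedNoise x ≤ 81 := by
  have one : ∀ t : ℝ, t ^ 2 = s ^ 2 → ∫⁻ z, ENNReal.ofReal (Real.exp (chi (t • (g - g')) z -
      tiltedMean x (t • (g - g')))) ∂tiltedNoise x ≤ 40 := by
    intro t ht
    have hb : ∀ i, |(t • (g - g')) i| ≤ 1 / 8 := by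
      intro i
      have h1 : (g - g') i ^ 2 ≤ sqNorm (g - g') :=
        Finset.single_le_sum (f := fun i => (g - g') i ^ 2) (fun i _ => sq_nonneg _) (Finset.mem_univ i)
      refine abs_le_of_sq_le_sq ?_ (by norm_num)
      simp only [Pi.smul_apply, smul_eq_mul, mul_pow, ht]
      nlinarith [mul_le_mul_of_nonneg_left h1 (sq_nonneg s)]
    rw [lintegral_tiltedNoise_exp (fun i => by linarith [hx i])
      (fun i => by linarith [hx i, (abs_le.1 (hb i)).2])]
    have h2 : ∑ i, chiLogMgf ((t • (g - g')) i / (1 - 2 * x i)) ≤ 1 := by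
      calc _ ≤ ∑ i, 12 * s ^ 2 * (g - g') i ^ 2 := by
            refine Finset.sum_le_sum fun i _ => ?_
            have h3 : (1 / 2 : ℝ) ≤ 1 - 2 * x i := by linarith [hx i]
            have h4 : |(t • (g - g')) i / (1 - 2 * x i)| ≤ 2 * |(t • (g - g')) i| := by
              rw [abs_div, abs_of_pos (by linarith : 0 < 1 - 2 * x i), div_le_iff₀ (by linarith)]
              nlinarith [abs_nonneg ((t • (g - g')) i)]
            refine (chiLogMgf_le_sq (h4.trans (by linarith [hb i]))).trans ?_
            rw [← sq_abs]
            calc 3 * |(t • (g - g')) i / (1 - 2 * x i)| ^ 2 ≤ 3 * (2 * |(t • (g - g')) i|) ^ 2 := by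
                  gcongr
              _ = 12 * s ^ 2 * (g - g') i ^ 2 := by
                  rw [mul_pow, sq_abs, Pi.smul_apply, smul_eq_mul, mul_pow, ht]; ring
        _ = 12 * s ^ 2 * sqNorm (g - g') := by rw [sqNorm, Finset.mul_sum]
        _ ≤ 1 := by nlinarith [mul_nonneg (sq_nonneg s) (sqNorm_nonneg (g - g'))]
    calc _ ≤ ENNReal.ofReal (Real.exp 1) := by gcongr
      _ ≤ ENNReal.ofReal 40 := by gcongr; linarith [Real.exp_one_lt_d9]
      _ = 40 := by norm_num
  have hlin : ∀ t : ℝ, ∀ z, chi (t • (g - g')) z - tiltedMean x (t • (g - g')) =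
      t * ((chi g z - tiltedMean x g) - (chi g' z - tiltedMean x g')) := by
    intro t z
    unfold chi tiltedMean
    simp only [← Finset.sum_sub_distrib, Finset.mul_sum]
    exact Finset.sum_congr rfl fun i _ => by simp only [Pi.smul_apply, Pi.sub_apply, smul_eq_mul]; ring
  have hm := measurable_chi (s • (g - g'))
  calc _ ≤ ∫⁻ z, (ENNReal.ofReal (Real.exp (chi (s • (g - g')) z - tiltedMean x (s • (g - g')))) +
        ENNReal.ofReal (Real.exp (chi ((-s) • (g - g')) z - tiltedMean x ((-s) • (g - g')))))
          ∂tiltedNoise x := by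
        refine lintegral_mono fun z => ?_
        rw [hlin, hlin, ← ENNReal.ofReal_add (Real.exp_pos _).le (Real.exp_pos _).le]
        refine ENNReal.ofReal_le_ofReal ?_
        set y := (chi g z - tiltedMean x g) - (chi g' z - tiltedMean x g')
        rcases abs_choice y with h | h <;> rw [h]
        · linarith [Real.exp_pos (-s * y)]
        · rw [mul_neg, ← neg_mul]; linarith [Real.exp_pos (s * y)]
    _ = _ := lintegral_add_left (by fun_prop) _
    _ ≤ 40 + 40 := add_le_add (one s rfl) (one (-s) (by ring))
    _ ≤ 81 := by norm_num

theorem sum_chiLogMgf_le {n : ℕ} {g : Fin n → ℝ} (hg0 : 0 ≤ g) (hg1 : g ≤ 1) {t : ℝ} (ht0 : 0 ≤ t)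
    (ht : t ≤ 1 / 4) : ∑ i, chiLogMgf ((t • g) i) ≤ (t ^ 2 + 8 * t ^ 3) * sqNorm g := by
  rw [sqNorm, Finset.mul_sum]
  refine Finset.sum_le_sum fun i _ => ?_
  have h0 : 0 ≤ g i := hg0 i
  have h1 : g i ≤ 1 := hg1 i
  simp only [Pi.smul_apply, smul_eq_mul]
  have h2 : 0 ≤ t * g i := mul_nonneg ht0 h0
  have h3 := chiLogMgf_le (x := t * g i) (by rw [abs_of_nonneg h2]; nlinarith)
  rw [abs_of_nonneg h2] at h3
  refine h3.trans ?_
  have h4 : g i ^ 3 ≤ g i ^ 2 := by nlinarith [sq_nonneg (g i)]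
  have h5 : 0 ≤ t ^ 3 := by positivity
  nlinarith [mul_le_mul_of_nonneg_left h4 h5]

/-! ### Uniform bound for the chi-square forms along the ordered family. -/

/-- Chaining under the original law would spoil the constant in the exponent. Instead `exp(t χ_b)`,
with `b` the largest element, serves as a change of measure, and only the remaining factor
`exp(t|Z_g - Z_b|)` is chained, at the price of `256`. The tilted mean is monotone in `g`, so
replacing `χ_g - χ_b` by its centered version errs in the right direction. -/
theorem lintegral_sup_chi_sub_le {n : ℕ} {S : Finset (Fin n → ℝ)} (hS : S.Nonempty)
    (hch : ∀ g ∈ S, ∀ g' ∈ S, g ≤ g' ∨ g' ≤ g) (hS0 : ∀ g ∈ S, 0 ≤ g) (hS1 : ∀ g ∈ S, g ≤ 1)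
    {t m M : ℝ} (ht0 : 0 < t) (ht : t ≤ 1 / 4) (hm : ∀ g ∈ S, m ≤ sqNorm g)
    (hM : ∀ g ∈ S, sqNorm g ≤ M) (hspread : 1024 * t ^ 2 * (M - m) ≤ 1) (x : ℝ) :
    ∫⁻ z, S.sup (fun g => ENNReal.ofReal (chi g z - x)) ∂whiteNoise n ≤
      ENNReal.ofReal (256 / t * Real.exp (-(t * x) + (t ^ 2 + 8 * t ^ 3) * M)) := by
  classical
  obtain ⟨b, hb, hbmax⟩ := S.exists_max_image sqNorm hS
  have hgb : ∀ g ∈ S, g ≤ b := by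
    intro g hg
    rcases hch g hg b hb with h | h
    · exact h
    · have h1 := sqNorm_sub_le_abs (hS0 g hg) (hS0 b hb) (Or.inr h)
      have h2 : sqNorm g = sqNorm b := le_antisymm (hbmax g hg) (sqNorm_mono (hS0 b hb) h)
      rw [h2, sub_self, abs_zero] at h1
      exact (eq_of_sqNorm_sub_eq_zero h1).le
  have hb0 : ∀ i, 0 ≤ b i := hS0 b hb
  have hb1 : ∀ i, b i ≤ 1 := hS1 b hb
  have hx0 : ∀ i, 0 ≤ (t • b) i := fun i => mul_nonneg ht0.le (hb0 i)
  have hx : ∀ i, (t • b) i ≤ 1 / 4 := fun i => by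
    simp only [Pi.smul_apply, smul_eq_mul]; nlinarith [hb0 i, hb1 i]
  have := isProbabilityMeasure_tiltedNoise (x := t • b) fun i => by linarith [hx i]
  set Z : (Fin n → ℝ) → (Fin n → ℝ) → ℝ := fun g z => chi g z - tiltedMean (t • b) g with hZ
  have hZm : ∀ g, Measurable (Z g) := fun g => (measurable_chi g).sub_const _
  set A : (Fin n → ℝ) → ENNReal :=
    fun z => S.sup (fun g => ENNReal.ofReal (Real.exp (t * |Z g z - Z b z|))) with hA
  have hAm : Measurable A := measurable_finset_sup_ennreal _ fun g _ => by
    have := hZm g; have := hZm b; fun_prop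
  have hchain : ∫⁻ z, A z ∂tiltedNoise (t • b) ≤ 256 := by
    have habs : ∀ g g' : Fin n → ℝ, |-(64 * sqNorm g) - -(64 * sqNorm g')| =
        64 * |sqNorm g - sqNorm g'| := by
      intro g g'
      rw [show -(64 * sqNorm g) - -(64 * sqNorm g') = -(64 * (sqNorm g - sqNorm g')) by ring,
        abs_neg, abs_mul]
      norm_num
    -- The base point of the chaining must have the lowest index; the minus sign gives this role to
    -- `b`. The factor `64` is the one in `tiltedNoise_increment`.
    refine lintegral_sup_exp_le (tiltedNoise (t • b)) (fun g => -(64 * sqNorm g)) Z hZm S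
      ?_ ?_ S.card S le_rfl subset_rfl b hb ?_ t (64 * (M - m)) ht0.le (by linarith) ?_
    · intro g hg g' hg' h
      have h1 := sqNorm_sub_le_abs (hS0 g hg) (hS0 g' hg') (hch g hg g' hg')
      have h2 : sqNorm g - sqNorm g' = 0 := by linarith [show -(64 * sqNorm g) = -(64 * sqNorm g') from h]
      rw [h2, abs_zero] at h1
      rw [eq_of_sqNorm_sub_eq_zero h1]
    · intro g hg g' hg' s _ h
      refine tiltedNoise_increment hx ?_
      rw [habs] at h
      have h1 := sqNorm_sub_le_abs (hS0 g hg) (hS0 g' hg') (hch g hg g' hg')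
      nlinarith [mul_le_mul_of_nonneg_left h1 (sq_nonneg s)]
    · intro g hg
      have := hbmax g hg
      linarith
    · intro g hg
      have := hm g hg; have := hM b hb
      linarith
  have hpt : ∀ z, S.sup (fun g => ENNReal.ofReal (chi g z - x)) ≤
      ENNReal.ofReal (1 / t * Real.exp (-(t * x) + ∑ i, chiLogMgf ((t • b) i))) *
        (ENNReal.ofReal (Real.exp (chi (t • b) z - ∑ i, chiLogMgf ((t • b) i))) * A z) := by
    intro z
    refine Finset.sup_le fun g hg => ?_
    have hdrift : tiltedMean (t • b) g ≤ tiltedMean (t • b) b := by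
      unfold tiltedMean
      refine Finset.sum_le_sum fun i _ => ?_
      refine mul_le_mul_of_nonneg_left (hgb g hg i) (div_nonneg ?_ ?_)
      · linarith [hx0 i]
      · linarith [hx i]
    have hchi : chi (t • b) z = t * chi b z := by
      unfold chi; rw [Finset.mul_sum]
      exact Finset.sum_congr rfl fun i _ => by simp only [Pi.smul_apply, smul_eq_mul]; ring
    calc ENNReal.ofReal (chi g z - x)
        ≤ ENNReal.ofReal (1 / t * Real.exp (-(t * x) + ∑ i, chiLogMgf ((t • b) i)) *
          (Real.exp (chi (t • b) z - ∑ i, chiLogMgf ((t • b) i)) *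
            Real.exp (t * |Z g z - Z b z|))) := by
          refine ENNReal.ofReal_le_ofReal ?_
          rw [mul_assoc, ← Real.exp_add, ← Real.exp_add, hchi, div_mul_eq_mul_div, one_mul,
            le_div_iff₀ ht0]
          have h1 : chi g z - chi b z ≤ |Z g z - Z b z| := by
            refine le_trans ?_ (le_abs_self _)
            simp only [hZ]; linarith
          have h2 := mul_le_mul_of_nonneg_left h1 ht0.le
          have h3 := Real.add_one_le_exp (t * (chi g z - x))
          calc (chi g z - x) * t ≤ Real.exp (t * (chi g z - x)) := by linarith
            _ ≤ _ := Real.exp_le_exp.2 (by linarith)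
      _ = ENNReal.ofReal (1 / t * Real.exp (-(t * x) + ∑ i, chiLogMgf ((t • b) i))) *
          (ENNReal.ofReal (Real.exp (chi (t • b) z - ∑ i, chiLogMgf ((t • b) i))) *
            ENNReal.ofReal (Real.exp (t * |Z g z - Z b z|))) := by
          rw [ENNReal.ofReal_mul (by positivity), ENNReal.ofReal_mul (Real.exp_pos _).le]
      _ ≤ _ := by
          gcongr
          exact Finset.le_sup (f := fun g => ENNReal.ofReal (Real.exp (t * |Z g z - Z b z|))) hg
  have hsum := sum_chiLogMgf_le (hS0 b hb) (hS1 b hb) ht0.le ht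
  have hM' : (t ^ 2 + 8 * t ^ 3) * sqNorm b ≤ (t ^ 2 + 8 * t ^ 3) * M := by
    gcongr; exact hM b hb
  calc _ ≤ ∫⁻ z, ENNReal.ofReal (1 / t * Real.exp (-(t * x) + ∑ i, chiLogMgf ((t • b) i))) *
        (ENNReal.ofReal (Real.exp (chi (t • b) z - ∑ i, chiLogMgf ((t • b) i))) * A z)
          ∂whiteNoise n := lintegral_mono hpt
    _ = ENNReal.ofReal (1 / t * Real.exp (-(t * x) + ∑ i, chiLogMgf ((t • b) i))) *
        ∫⁻ z, A z ∂tiltedNoise (t • b) := by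
        rw [lintegral_const_mul' _ _ ENNReal.ofReal_ne_top, tiltedNoise,
          lintegral_withDensity_eq_lintegral_mul _ (measurable_tiltDensity _) hAm]
        rfl
    _ ≤ ENNReal.ofReal (1 / t * Real.exp (-(t * x) + (t ^ 2 + 8 * t ^ 3) * M)) *
        ENNReal.ofReal 256 := by
        gcongr
        · linarith
        · simpa using hchain
    _ = _ := by
        rw [← ENNReal.ofReal_mul (by positivity)]
        congr 1; ring

theorem exists_majorant_chi_sub {n : ℕ} {T : Set (Fin n → ℝ)}
    (hch : ∀ g ∈ T, ∀ g' ∈ T, g ≤ g' ∨ g' ≤ g) (hT0 : ∀ g ∈ T, 0 ≤ g) (hT1 : ∀ g ∈ T, g ≤ 1)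
    {t m M : ℝ} (ht0 : 0 < t) (ht : t ≤ 1 / 4) (hspread : 1024 * t ^ 2 * (M - m) ≤ 1) (x : ℝ) :
    ∃ Y : (Fin n → ℝ) → ENNReal, Measurable Y ∧
      (∀ z, ∀ g ∈ T, m ≤ sqNorm g → sqNorm g ≤ M → ENNReal.ofReal (chi g z - x) ≤ Y z) ∧
      ∫⁻ z, Y z ∂whiteNoise n ≤
        ENNReal.ofReal (256 / t * Real.exp (-(t * x) + (t ^ 2 + 8 * t ^ 3) * M)) := by
  obtain ⟨Y, hYm, hY, hYi⟩ := exists_measurable_majorant (whiteNoise n)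
    {g | g ∈ T ∧ m ≤ sqNorm g ∧ sqNorm g ≤ M} (fun g z => ENNReal.ofReal (chi g z - x))
    (fun g => ((measurable_chi g).sub_const x).ennreal_ofReal)
    (fun z => ENNReal.continuous_ofReal.comp ((continuous_chi z).sub continuous_const))
    (ENNReal.ofReal (256 / t * Real.exp (-(t * x) + (t ^ 2 + 8 * t ^ 3) * M))) (by
      intro S hS
      rcases S.eq_empty_or_nonempty with rfl | hne
      · simp
      · exact lintegral_sup_chi_sub_le hne (fun g hg g' hg' => hch g (hS hg).1 g' (hS hg').1)
          (fun g hg => hT0 g (hS hg).1) (fun g hg => hT1 g (hS hg).1) ht0 ht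
          (fun g hg => (hS hg).2.1) (fun g hg => (hS hg).2.2) hspread x)
  exact ⟨Y, hYm, fun z g hg h1 h2 => hY z g ⟨hg, h1, h2⟩, hYi⟩

theorem exp_quartic_le {u : ℝ} (hu : 0 ≤ u) :
    1 + u + u ^ 2 / 2 + u ^ 3 / 6 + u ^ 4 / 24 ≤ Real.exp u := by
  have := Real.sum_le_exp_of_nonneg hu 5
  simp [Finset.sum_range_succ, Nat.factorial] at this
  linarith

/-- With `L = D e^u` and `l = u + 2 log u`, the value `t = √(l/(2L))` minimizes `-t√(2Ll) + t²L`. Up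
to bounded terms the exponent is then `-(1/2 + κ) l`. Here `e^{-u/2}` cancels the prefactor `1/t ≲
√D e^{u/2}`, the factor `1/u = e^{-log u}` pays for the number of slices per unit of `u`, and
`e^{-κu}` is left to be summed. -/
theorem level_bound {D u h κ : ℝ} (hD : 5 ≤ D) (hu : 3 ≤ u) (hh : 0 < h) (huh : 3072 * (u * h) ≤ 1)
    (hκ : 0 < κ) :
    ∃ t : ℝ, 0 < t ∧ t ≤ 1 / 4 ∧
      1024 * t ^ 2 * (D * Real.exp (u + h) - D * Real.exp u) ≤ 1 ∧
      256 / t * Real.exp (-(t * ((1 + κ) * (√(2 * (D * Real.exp u)) * √(u + 2 * Real.log u)))) +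
        (t ^ 2 + 8 * t ^ 3) * (D * Real.exp (u + h))) ≤
      512 * Real.exp 23 * √D * Real.exp (-(κ * u)) / u := by
  set L := D * Real.exp u with hL
  set l := u + 2 * Real.log u with hl
  have hu0 : 0 < u := by linarith
  have hexp := exp_quartic_le hu0.le
  have hlog0 : 0 ≤ Real.log u := Real.log_nonneg (by linarith)
  have hlog1 : Real.log u ≤ u := (Real.log_le_sub_one_of_pos hu0).trans (by linarith)
  have hl1 : l ≤ 3 * u := by linarith
  have hlu : u ≤ l := by linarith
  have hl0 : 0 < l := by linarith
  have hL5 : 5 * Real.exp u ≤ L := by rw [hL]; gcongr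
  have hL0 : 0 < L := by rw [hL]; positivity
  set t := √(l / (2 * L)) with ht
  have ht0 : 0 < t := Real.sqrt_pos.2 (by positivity)
  have ht2 : t ^ 2 = l / (2 * L) := Real.sq_sqrt (by positivity)
  have ht2L : t ^ 2 * L = l / 2 := by rw [ht2]; field_simp
  have hh1 : h ≤ 1 := by nlinarith
  have heh : Real.exp (u + h) ≤ Real.exp u * (1 + 2 * h) := by
    rw [Real.exp_add]
    gcongr
    have := Real.exp_bound' hh.le hh1 (n := 1) (by norm_num)
    simp at this
    linarith
  have hM : D * Real.exp (u + h) ≤ L * (1 + 2 * h) := by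
    rw [hL, mul_assoc]; gcongr
  have hlh : 1024 * (l * h) ≤ 1 := by nlinarith
  have ht4 : t ≤ 1 / 4 := by
    refine abs_le_of_sq_le_sq' ?_ (by norm_num) |>.2
    rw [ht2, div_le_iff₀ (by positivity)]
    -- As `l ≤ 3u` and `L ≥ 5e^u`, one has `t² ≤ 3u/(10 e^u)`, so `t ≤ 1/4` follows from this
    -- inequality, which holds from `u = 3` on.
    have : 24 / 5 * u ≤ Real.exp u := by nlinarith [pow_nonneg hu0.le 3, mul_nonneg hu0.le (sub_nonneg.2 hu), mul_nonneg (sq_nonneg u) (sub_nonneg.2 hu), mul_nonneg (pow_nonneg hu0.le 3) (sub_nonneg.2 hu)]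
    linarith
  refine ⟨t, ht0, ht4, ?_, ?_⟩
  · calc 1024 * t ^ 2 * (D * Real.exp (u + h) - L) ≤ 1024 * t ^ 2 * (L * (2 * h)) := by
          gcongr; linarith
      _ = 1024 * (l * h) := by linear_combination 2048 * h * ht2L
      _ ≤ 1 := hlh
  have htx : t * ((1 + κ) * (√(2 * L) * √l)) = (1 + κ) * l := by
    have : t * √(2 * L) = √l := by
      rw [ht, ← Real.sqrt_mul (by positivity)]
      congr 1; field_simp
    calc _ = (1 + κ) * (t * √(2 * L) * √l) := by ring
      _ = _ := by rw [this, Real.mul_self_sqrt hl0.le]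
  have htl : t * l ≤ 5 := by
    refine abs_le_of_sq_le_sq' ?_ (by norm_num) |>.2
    rw [mul_pow, ht2, div_mul_eq_mul_div, div_le_iff₀ (by positivity)]
    have h3 : l * l ^ 2 ≤ (3 * u) * (3 * u) ^ 2 := by gcongr
    have : u ^ 3 ≤ 6 * Real.exp u := by nlinarith [pow_nonneg hu0.le 3, pow_nonneg hu0.le 4, pow_nonneg hu0.le 2]
    nlinarith
  have hexpo : -(t * ((1 + κ) * (√(2 * L) * √l))) + (t ^ 2 + 8 * t ^ 3) * (D * Real.exp (u + h)) ≤
      23 + -(κ * u) + -(u / 2) + -Real.log u := by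
    rw [htx]
    have h1 : t ^ 2 * (D * Real.exp (u + h)) ≤ l / 2 + 1 := by
      calc _ ≤ t ^ 2 * (L * (1 + 2 * h)) := by gcongr
        _ = l / 2 + l * h := by linear_combination (1 + 2 * h) * ht2L
        _ ≤ _ := by linarith [mul_pos hl0 hh]
    have h2 : 8 * t ^ 3 * (D * Real.exp (u + h)) ≤ 22 := by
      calc _ = 8 * t * (t ^ 2 * (D * Real.exp (u + h))) := by ring
        _ ≤ 8 * t * (l / 2 + 1) := by gcongr
        _ ≤ 22 := by nlinarith
    have h3 : κ * u ≤ κ * l := by gcongr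
    nlinarith
  calc _ ≤ 256 * (2 * (√D * Real.exp (u / 2))) *
        Real.exp (23 + -(κ * u) + -(u / 2) + -Real.log u) := by
        gcongr
        · rw [div_le_iff₀ ht0]
          have hs : √D * Real.exp (u / 2) = √L := by
            rw [hL, Real.sqrt_mul (by linarith), Real.exp_half]
          rw [hs]
          have h1 : 1 ≤ 2 * √L * t := by
            rw [ht, mul_assoc, ← Real.sqrt_mul hL0.le]
            have : L * (l / (2 * L)) = l / 2 := by field_simp
            rw [this]
            have : (1 : ℝ) ≤ √(l / 2) := Real.one_le_sqrt.2 (by linarith)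
            linarith
          linarith
    _ = _ := by
        rw [Real.exp_add, Real.exp_add, Real.exp_add, Real.exp_neg (u / 2), Real.exp_neg (Real.log u),
          Real.exp_log hu0]
        have := (Real.exp_pos (u / 2)).ne'
        field_simp
        norm_num

/-- The logarithmic envelope `√(2D) (u + 2 log u)^{1/2}` with `u = log (D / D₀)`. -/
noncomputable def logEnvelope (D₀ D : ℝ) : ℝ :=
  √(2 * D) * √(Real.log (D / D₀) + 2 * Real.log (Real.log (D / D₀)))

theorem tsum_exp_neg_mul_le {κ : ℝ} (hκ : 0 < κ) (hκ1 : κ ≤ 1) {c : ℝ} (hc : 0 ≤ c) :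
    ∑' j : ℕ, ENNReal.ofReal (c * Real.exp (-(κ * (j + 3)))) ≤ ENNReal.ofReal (2 * c / κ) := by
  have h1 : Real.exp (-κ) < 1 := by simpa using hκ
  have hterm : ∀ j : ℕ, ENNReal.ofReal (c * Real.exp (-(κ * (j + 3)))) ≤
      ENNReal.ofReal (c * Real.exp (-κ) ^ j) := by
    intro j
    gcongr
    rw [← Real.exp_nat_mul]
    gcongr
    nlinarith
  refine (ENNReal.tsum_le_tsum hterm).trans ?_
  have hsum : Summable fun j : ℕ => c * Real.exp (-κ) ^ j :=
    (summable_geometric_of_lt_one (Real.exp_pos _).le h1).mul_left c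
  rw [← ENNReal.ofReal_tsum_of_nonneg (fun j => by positivity) hsum, tsum_mul_left,
    tsum_geometric_of_lt_one (Real.exp_pos _).le h1]
  gcongr
  have h2 : Real.exp (-κ) ≤ 1 - κ / 2 := by
    rw [Real.exp_neg, inv_le_comm₀ (Real.exp_pos _) (by linarith)]
    refine le_trans ?_ (Real.add_one_le_exp κ)
    rw [inv_le_iff_one_le_mul₀ (by linarith)]
    nlinarith
  rw [← div_eq_mul_inv, div_le_div_iff₀ (by linarith) hκ]
  nlinarith

/-- Slicing in `u = log(‖g‖²/D₀)`. For `u < 3` no penalty is required: `t` of order `1/√D₀` already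
gives a mean of order `√D₀`. Beyond, each `[j + 3, j + 4)` is cut into `6144(j + 3)` equal cells,
short enough for the chaining. By `level_bound` a cell contributes at most a multiple of `√D₀
e^{-κ(j+3)}/(j + 3)`, and the geometric sum over `j` gives `1/κ`. -/
theorem exists_chi_envelope : ∃ C : ℝ, 0 < C ∧ ∀ (n : ℕ) (T : Set (Fin n → ℝ)),
    (∀ g ∈ T, ∀ g' ∈ T, g ≤ g' ∨ g' ≤ g) → (∀ g ∈ T, 0 ≤ g) → (∀ g ∈ T, g ≤ 1) →
    ∀ D₀ : ℝ, 5 ≤ D₀ → (∀ g ∈ T, D₀ ≤ sqNorm g) → ∀ κ : ℝ, 0 < κ → κ ≤ 1 →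
    ∃ Y : (Fin n → ℝ) → ENNReal, Measurable Y ∧
      (∀ z, ∀ g ∈ T, Real.log (sqNorm g / D₀) < 3 → ENNReal.ofReal (chi g z) ≤ Y z) ∧
      (∀ z, ∀ g ∈ T, 3 ≤ Real.log (sqNorm g / D₀) →
        ENNReal.ofReal (chi g z - (1 + κ) * logEnvelope D₀ (sqNorm g)) ≤ Y z) ∧
      ∫⁻ z, Y z ∂whiteNoise n ≤ ENNReal.ofReal (C * √D₀ / κ) := by
  set c₀ : ℝ := 256 * 256 * Real.exp 21 with hc₀
  set c₁ : ℝ := 6144 * (512 * Real.exp 23) with hc₁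
  refine ⟨c₀ + 2 * c₁, by positivity, ?_⟩
  intro n T hch hT0 hT1 D₀ hD₀ hTD κ hκ hκ1
  have hD₀0 : 0 < D₀ := by linarith
  have hsD : 0 < √D₀ := Real.sqrt_pos.2 hD₀0
  have hsD2 : √D₀ ^ 2 = D₀ := Real.sq_sqrt hD₀0.le
  have hsD1 : 1 ≤ √D₀ := Real.one_le_sqrt.2 (by linarith)
  obtain ⟨Y₀, hY₀m, hY₀, hY₀i⟩ : ∃ Y : (Fin n → ℝ) → ENNReal, Measurable Y ∧
      (∀ z, ∀ g ∈ T, Real.log (sqNorm g / D₀) < 3 → ENNReal.ofReal (chi g z) ≤ Y z) ∧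
      ∫⁻ z, Y z ∂whiteNoise n ≤ ENNReal.ofReal (c₀ * √D₀) := by
    have ht2 : (1 / (256 * √D₀)) ^ 2 * D₀ = 1 / 65536 := by
      rw [div_pow, mul_pow, hsD2]; field_simp; norm_num
    have ht4 : 1 / (256 * √D₀) ≤ 1 / 4 := by
      apply one_div_le_one_div_of_le <;> linarith
    -- `21 > e³`, so `[D₀, 21 D₀]` contains every `‖g‖²` with `u < 3`.
    obtain ⟨Y, hYm, hY, hYi⟩ := exists_majorant_chi_sub hch hT0 hT1 (t := 1 / (256 * √D₀))
      (m := D₀) (M := 21 * D₀) (by positivity) ht4 (by linarith) 0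
    refine ⟨Y, hYm, fun z g hg h => ?_, hYi.trans ?_⟩
    · have hg0 : 0 < sqNorm g := hD₀0.trans_le (hTD g hg)
      have := hY z g hg (hTD g hg) (by
        rw [Real.log_lt_iff_lt_exp (by positivity), div_lt_iff₀ hD₀0] at h
        refine h.le.trans ?_
        gcongr
        have : Real.exp 3 = Real.exp 1 ^ 3 := by rw [← Real.exp_nat_mul]; norm_num
        rw [this]
        calc Real.exp 1 ^ 3 ≤ 2.7182818286 ^ 3 := by gcongr; exact Real.exp_one_lt_d9.le
          _ ≤ 21 := by norm_num)
      simpa using this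
    · refine ENNReal.ofReal_le_ofReal ?_
      have hexp : -(1 / (256 * √D₀) * 0) + ((1 / (256 * √D₀)) ^ 2 + 8 * (1 / (256 * √D₀)) ^ 3) *
          (21 * D₀) ≤ 21 := by
        have h0 : (0 : ℝ) < 1 / (256 * √D₀) := by positivity
        have : (1 / (256 * √D₀)) ^ 3 * D₀ = 1 / (256 * √D₀) * (1 / 65536) := by
          rw [← ht2]; ring
        nlinarith
      calc _ ≤ 256 / (1 / (256 * √D₀)) * Real.exp 21 := by gcongr
        _ = c₀ * √D₀ := by rw [hc₀]; field_simp
  have hlev : ∀ (j : ℕ) (i : Fin (6144 * (j + 3))), ∃ Y : (Fin n → ℝ) → ENNReal, Measurable Y ∧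
      (∀ z, ∀ g ∈ T, (j + 3 : ℝ) + i / (6144 * (j + 3)) ≤ Real.log (sqNorm g / D₀) →
        Real.log (sqNorm g / D₀) ≤ (j + 3 : ℝ) + i / (6144 * (j + 3)) + 1 / (6144 * (j + 3)) →
        ENNReal.ofReal (chi g z - (1 + κ) * logEnvelope D₀ (sqNorm g)) ≤ Y z) ∧
      ∫⁻ z, Y z ∂whiteNoise n ≤
        ENNReal.ofReal (512 * Real.exp 23 * √D₀ * Real.exp (-(κ * (j + 3))) / (j + 3)) := by
    intro j i
    have hj : (0 : ℝ) < j + 3 := by positivity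
    have hi : (i : ℝ) / (6144 * (j + 3)) ≤ 1 := by
      rw [div_le_one (by positivity)]
      have := i.2.le
      exact_mod_cast this
    have hi0 : 0 ≤ (i : ℝ) / (6144 * (j + 3)) := by positivity
    set u : ℝ := (j + 3 : ℝ) + i / (6144 * (j + 3)) with hu
    have hj0 : (0 : ℝ) ≤ j := by positivity
    have hu3 : 3 ≤ u := by linarith
    obtain ⟨t, ht0, ht4, hsp, hb⟩ := level_bound (h := 1 / (6144 * (j + 3 : ℝ))) hD₀ hu3
      (by positivity) (by
        rw [mul_one_div, mul_div_assoc', div_le_one (by positivity)]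
        linarith) hκ
    obtain ⟨Y, hYm, hY, hYi⟩ := exists_majorant_chi_sub hch hT0 hT1 ht0 ht4 hsp
      ((1 + κ) * (√(2 * (D₀ * Real.exp u)) * √(u + 2 * Real.log u)))
    refine ⟨Y, hYm, fun z g hg h1 h2 => ?_, hYi.trans (ENNReal.ofReal_le_ofReal (hb.trans ?_))⟩
    · have hg0 : 0 < sqNorm g := hD₀0.trans_le (hTD g hg)
      have heq : sqNorm g = D₀ * Real.exp (Real.log (sqNorm g / D₀)) := by
        rw [Real.exp_log (by positivity)]; field_simp
      have hlo : D₀ * Real.exp u ≤ sqNorm g := by rw [heq]; gcongr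
      refine le_trans (ENNReal.ofReal_le_ofReal ?_) (hY z g hg hlo (by rw [heq]; gcongr))
      unfold logEnvelope
      gcongr
    · gcongr <;> linarith
  choose Y hYm hY hYi using hlev
  refine ⟨fun z => Y₀ z + ∑' j : ℕ, ∑ i, Y j i z, ?_, ?_, ?_, ?_⟩
  · exact hY₀m.add (Measurable.tsum fun j => Finset.measurable_fun_sum _ fun i _ => hYm j i)
  · intro z g hg h
    exact (hY₀ z g hg h).trans le_self_add
  · intro z g hg h
    refine le_trans ?_ le_add_self
    set u := Real.log (sqNorm g / D₀) with hu
    have hu0 : 0 ≤ u := by linarith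
    have hfl : 3 ≤ ⌊u⌋₊ := Nat.le_floor (by exact_mod_cast h)
    obtain ⟨j, hj⟩ : ∃ j, ⌊u⌋₊ = j + 3 := ⟨⌊u⌋₊ - 3, by omega⟩
    have h1 : (j + 3 : ℝ) ≤ u := by have := Nat.floor_le hu0; rw [hj] at this; exact_mod_cast this
    have h2 : u < (j + 3 : ℝ) + 1 := by
      have := Nat.lt_floor_add_one u; rw [hj] at this; exact_mod_cast this
    have hN : (0 : ℝ) < 6144 * (j + 3) := by positivity
    have hv0 : 0 ≤ (u - (j + 3)) * (6144 * (j + 3)) := mul_nonneg (by linarith) hN.le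
    have hi : ⌊(u - (j + 3)) * (6144 * (j + 3))⌋₊ < 6144 * (j + 3) := by
      rw [Nat.floor_lt hv0]
      push_cast
      nlinarith
    have h3 := hY j ⟨_, hi⟩ z g hg (by
        have := Nat.floor_le hv0
        have h4 : (⌊(u - (j + 3)) * (6144 * (j + 3))⌋₊ : ℝ) / (6144 * (j + 3)) ≤ u - (j + 3) := by
          rwa [div_le_iff₀ hN]
        simp only; linarith) (by
        have := Nat.lt_floor_add_one ((u - (j + 3)) * (6144 * (j + 3)))
        have h4 : u - (j + 3) ≤ ((⌊(u - (j + 3)) * (6144 * (j + 3))⌋₊ : ℝ) + 1) / (6144 * (j + 3)) := by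
          rw [le_div_iff₀ hN]; exact this.le
        rw [add_div] at h4
        simp only; linarith)
    refine h3.trans (le_trans ?_ (ENNReal.le_tsum j))
    exact Finset.single_le_sum (f := fun i => Y j i z) (fun _ _ => zero_le) (Finset.mem_univ _)
  · rw [lintegral_add_left hY₀m, lintegral_tsum fun j =>
      (Finset.measurable_fun_sum _ fun i _ => hYm j i).aemeasurable]
    have hj : ∀ j : ℕ, ∫⁻ z, ∑ i, Y j i z ∂whiteNoise n ≤
        ENNReal.ofReal (c₁ * √D₀ * Real.exp (-(κ * (j + 3)))) := by
      intro j
      rw [lintegral_finsetSum _ fun i _ => hYm j i]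
      refine (Finset.sum_le_sum fun i _ => hYi j i).trans ?_
      rw [Finset.sum_const, Finset.card_univ, Fintype.card_fin, nsmul_eq_mul,
        ← ENNReal.ofReal_natCast, ← ENNReal.ofReal_mul (by positivity)]
      refine ENNReal.ofReal_le_ofReal (le_of_eq ?_)
      rw [hc₁]
      push_cast
      have : (j + 3 : ℝ) ≠ 0 := by positivity
      field_simp
    calc _ ≤ ENNReal.ofReal (c₀ * √D₀) + ENNReal.ofReal (2 * (c₁ * √D₀) / κ) := by
          refine add_le_add hY₀i ((ENNReal.tsum_le_tsum hj).trans ?_)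
          exact tsum_exp_neg_mul_le hκ hκ1 (by positivity)
      _ ≤ _ := by
          rw [← ENNReal.ofReal_add (by positivity) (by positivity)]
          refine ENNReal.ofReal_le_ofReal ?_
          have : c₀ * √D₀ ≤ c₀ * √D₀ / κ := by
            rw [le_div_iff₀ hκ]
            have : 0 ≤ c₀ * √D₀ := by positivity
            nlinarith
          calc _ ≤ c₀ * √D₀ / κ + 2 * (c₁ * √D₀) / κ := by gcongr
            _ = _ := by ring

/-! ### Uniform bound for the cross term between signal and noise. -/

theorem measurable_dotProduct_right {n : ℕ} (f : Fin n → ℝ) : Measurable fun z => f ⬝ᵥ z := by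
  unfold dotProduct; fun_prop

theorem continuous_dotProduct_left {n : ℕ} (z : Fin n → ℝ) : Continuous fun f => f ⬝ᵥ z := by
  unfold dotProduct; fun_prop

theorem linear_increment {n : ℕ} {f f' : Fin n → ℝ} {s : ℝ} (hs : s ^ 2 * sqNorm (f - f') ≤ 1) :
    ∫⁻ z, ENNReal.ofReal (Real.exp (s * |f ⬝ᵥ z - f' ⬝ᵥ z|)) ∂whiteNoise n ≤ 81 := by
  have one : ∀ t : ℝ, t ^ 2 = s ^ 2 →
      ∫⁻ z, ENNReal.ofReal (Real.exp ((t • (f - f')) ⬝ᵥ z)) ∂whiteNoise n ≤ 40 := by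
    intro t ht
    have h := lintegral_exp_linear (t • (f - f'))
    have h2 : ∑ i, (t • (f - f')) i ^ 2 / 2 ≤ 1 := by
      have : ∑ i, (t • (f - f')) i ^ 2 / 2 = s ^ 2 * sqNorm (f - f') / 2 := by
        rw [sqNorm, Finset.mul_sum, Finset.sum_div]
        exact Finset.sum_congr rfl fun i _ => by
          rw [Pi.smul_apply, smul_eq_mul, mul_pow, ht]
      linarith
    unfold dotProduct
    rw [h]
    calc _ ≤ ENNReal.ofReal (Real.exp 1) := by gcongr
      _ ≤ ENNReal.ofReal 40 := by gcongr; linarith [Real.exp_one_lt_d9]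
      _ = 40 := by norm_num
  have hlin : ∀ t : ℝ, ∀ z, (t • (f - f')) ⬝ᵥ z = t * (f ⬝ᵥ z - f' ⬝ᵥ z) := by
    intro t z
    rw [smul_dotProduct, sub_dotProduct, smul_eq_mul]
  have hm := measurable_dotProduct_right (s • (f - f'))
  calc _ ≤ ∫⁻ z, (ENNReal.ofReal (Real.exp ((s • (f - f')) ⬝ᵥ z)) +
        ENNReal.ofReal (Real.exp (((-s) • (f - f')) ⬝ᵥ z))) ∂whiteNoise n := by
        refine lintegral_mono fun z => ?_
        rw [hlin, hlin, ← ENNReal.ofReal_add (Real.exp_pos _).le (Real.exp_pos _).le]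
        refine ENNReal.ofReal_le_ofReal ?_
        set y := f ⬝ᵥ z - f' ⬝ᵥ z
        rcases abs_choice y with h | h <;> rw [h]
        · linarith [Real.exp_pos (-s * y)]
        · rw [mul_neg, ← neg_mul]; linarith [Real.exp_pos (s * y)]
    _ = _ := lintegral_add_left (by fun_prop) _
    _ ≤ 40 + 40 := add_le_add (one s rfl) (one (-s) (by ring))
    _ ≤ 81 := by norm_num

/-- Chaining based at the zero vector, which can be added to `T` without losing the increment
hypothesis. The parameter `1/(4r)` is the `s` with `16 s² r² = 1`. -/
theorem exists_majorant_exp_linear {n : ℕ} {T : Set (Fin n → ℝ)}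
    (hT : ∀ f ∈ T, ∀ f' ∈ T, sqNorm (f - f') ≤ |sqNorm f - sqNorm f'|) {r : ℝ} (hr : 0 < r) :
    ∃ Y : (Fin n → ℝ) → ENNReal, Measurable Y ∧
      (∀ z, ∀ f ∈ T, sqNorm f ≤ r ^ 2 →
        ENNReal.ofReal (Real.exp (1 / (4 * r) * |f ⬝ᵥ z|)) ≤ Y z) ∧
      ∫⁻ z, Y z ∂whiteNoise n ≤ 256 := by
  classical
  have hzero : sqNorm (0 : Fin n → ℝ) = 0 := by simp [sqNorm]
  have hT' : ∀ f ∈ insert 0 T, ∀ f' ∈ insert 0 T, sqNorm (f - f') ≤ |sqNorm f - sqNorm f'| := by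
    have hneg : ∀ f : Fin n → ℝ, sqNorm (-f) = sqNorm f := by intro f; simp [sqNorm]
    rintro f (rfl | hf) f' (rfl | hf')
    · simp [hzero]
    · rw [zero_sub, hneg, hzero, zero_sub, abs_neg]; exact le_abs_self _
    · rw [sub_zero, hzero, sub_zero]; exact le_abs_self _
    · exact hT f hf f' hf'
  have hm : ∀ s : ℝ, ∀ f f' : Fin n → ℝ,
      Measurable fun z => ENNReal.ofReal (Real.exp (s * |f ⬝ᵥ z - f' ⬝ᵥ z|)) := by
    intro s f f'
    have := measurable_dotProduct_right f; have := measurable_dotProduct_right f'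
    fun_prop
  obtain ⟨Y, hYm, hY, hYi⟩ := exists_measurable_majorant (whiteNoise n)
    {f | f ∈ T ∧ sqNorm f ≤ r ^ 2}
    (fun f z => ENNReal.ofReal (Real.exp (1 / (4 * r) * |f ⬝ᵥ z|)))
    (fun f => by simpa using hm (1 / (4 * r)) f 0)
    (fun z => ENNReal.continuous_ofReal.comp (by
      have := continuous_dotProduct_left z; fun_prop)) 256 (by
      intro S hS
      have h := lintegral_sup_exp_le (whiteNoise n) sqNorm (fun f z => f ⬝ᵥ z)
        measurable_dotProduct_right (insert 0 T) (by
          intro f hf f' hf' h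
          have := hT' f hf f' hf'
          rw [h, sub_self, abs_zero] at this
          rw [eq_of_sqNorm_sub_eq_zero this]) (by
          intro f hf f' hf' s _ h
          exact linear_increment ((mul_le_mul_of_nonneg_left (hT' f hf f' hf')
            (sq_nonneg s)).trans h)) (insert 0 S).card (insert 0 S) le_rfl (by
          rw [Finset.coe_insert]
          exact insert_subset_insert fun f hf => (hS hf).1) 0 (Finset.mem_insert_self 0 S)
          (fun f _ => by rw [hzero]; exact sqNorm_nonneg f) (1 / (4 * r)) (r ^ 2) (by positivity)
          (by field_simp; norm_num) (by
            intro f hf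
            rw [hzero, zero_add]
            rcases Finset.mem_insert.1 hf with rfl | hf
            · rw [hzero]; positivity
            · exact (hS hf).2)
      refine (lintegral_mono fun z => ?_).trans h
      refine (Finset.sup_mono (Finset.subset_insert 0 S)).trans (le_of_eq ?_)
      simp)
  exact ⟨Y, hYm, fun z f hf h => hY z f ⟨hf, h⟩, hYi⟩

/-- On the shell `r/2 ≤ ‖f‖ ≤ r` the subtracted `‖f‖²` is at least `r²/4`. It supplies the factor
`1/r`, summable over dyadic `r`, used in `exists_linear_envelope`. -/
theorem two_mul_sub_le_exp {r y : ℝ} (hr : 0 < r) :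
    2 * y - r ^ 2 / 4 ≤ 16384 / r * Real.exp (1 / (4 * r) * y) := by
  have h1 := Real.add_one_le_exp (1 / (4 * r) * (y - r ^ 2 / 8))
  have h2 : 1 / (4 * r) * (y - r ^ 2 / 8) = 1 / (4 * r) * y - r / 32 := by field_simp; ring
  have h3 : Real.exp (-(r / 32)) ≤ 2048 / r ^ 2 := by
    rw [Real.exp_neg, inv_le_comm₀ (Real.exp_pos _) (by positivity), inv_div]
    have := Real.quadratic_le_exp_of_nonneg (x := r / 32) (by positivity)
    calc r ^ 2 / 2048 ≤ 1 + r / 32 + (r / 32) ^ 2 / 2 := by linarith [show (r / 32) ^ 2 / 2 = r ^ 2 / 2048 by ring]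
      _ ≤ _ := this
  calc 2 * y - r ^ 2 / 4 = 8 * r * (1 / (4 * r) * (y - r ^ 2 / 8)) := by field_simp; ring
    _ ≤ 8 * r * Real.exp (1 / (4 * r) * (y - r ^ 2 / 8)) := by gcongr; linarith
    _ = 8 * r * (Real.exp (-(r / 32)) * Real.exp (1 / (4 * r) * y)) := by
        rw [h2, ← Real.exp_add]; ring_nf
    _ ≤ 8 * r * (2048 / r ^ 2 * Real.exp (1 / (4 * r) * y)) := by gcongr
    _ = _ := by field_simp; norm_num

theorem exists_linear_envelope {n : ℕ} {T : Set (Fin n → ℝ)}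
    (hT : ∀ f ∈ T, ∀ f' ∈ T, sqNorm (f - f') ≤ |sqNorm f - sqNorm f'|) :
    ∃ Y : (Fin n → ℝ) → ENNReal, Measurable Y ∧
      (∀ z, ∀ f ∈ T, ENNReal.ofReal (2 * |f ⬝ᵥ z| - sqNorm f) ≤ Y z) ∧
      ∫⁻ z, Y z ∂whiteNoise n ≤ ENNReal.ofReal 5000000 := by
  choose Y hYm hY hYi using fun j : ℕ => exists_majorant_exp_linear hT (r := 2 ^ j) (by positivity)
  refine ⟨fun z => ENNReal.ofReal 8 * Y 0 z +
    ∑' j : ℕ, ENNReal.ofReal (8192 * (1 / 2) ^ j) * Y (j + 1) z, ?_, ?_, ?_⟩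
  · exact ((hYm 0).const_mul _).add (Measurable.tsum fun j => (hYm (j + 1)).const_mul _)
  · intro z f hf
    rcases le_or_gt (sqNorm f) 1 with h | h
    · refine le_trans ?_ le_self_add
      calc ENNReal.ofReal (2 * |f ⬝ᵥ z| - sqNorm f)
          ≤ ENNReal.ofReal (8 * Real.exp (1 / (4 * 2 ^ 0) * |f ⬝ᵥ z|)) := by
            refine ENNReal.ofReal_le_ofReal ?_
            have := Real.add_one_le_exp (1 / (4 * 2 ^ 0) * |f ⬝ᵥ z|)
            norm_num at this ⊢
            linarith [sqNorm_nonneg f]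
        _ = ENNReal.ofReal 8 * ENNReal.ofReal (Real.exp (1 / (4 * 2 ^ 0) * |f ⬝ᵥ z|)) :=
            ENNReal.ofReal_mul (by norm_num)
        _ ≤ _ := by gcongr; exact hY 0 z f hf (by simpa using h)
    · refine le_trans ?_ le_add_self
      obtain ⟨j, hj1, hj2⟩ := exists_nat_pow_near h.le (by norm_num : (1 : ℝ) < 4)
      have h4 : ((2 : ℝ) ^ (j + 1)) ^ 2 = 4 ^ (j + 1) := by rw [← pow_mul, mul_comm, pow_mul]; norm_num
      have hr : (0 : ℝ) < 2 ^ (j + 1) := by positivity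
      refine le_trans ?_ (ENNReal.le_tsum j)
      calc ENNReal.ofReal (2 * |f ⬝ᵥ z| - sqNorm f)
          ≤ ENNReal.ofReal (8192 * (1 / 2) ^ j * Real.exp (1 / (4 * 2 ^ (j + 1)) * |f ⬝ᵥ z|)) := by
            refine ENNReal.ofReal_le_ofReal ?_
            have h5 := two_mul_sub_le_exp (y := |f ⬝ᵥ z|) hr
            have h6 : 16384 / (2 : ℝ) ^ (j + 1) = 8192 * (1 / 2) ^ j := by
              rw [pow_succ, one_div, inv_pow]; field_simp; norm_num
            rw [h6, h4, pow_succ] at h5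
            linarith
        _ = ENNReal.ofReal (8192 * (1 / 2) ^ j) *
            ENNReal.ofReal (Real.exp (1 / (4 * 2 ^ (j + 1)) * |f ⬝ᵥ z|)) :=
            ENNReal.ofReal_mul (by positivity)
        _ ≤ _ := by gcongr; exact hY (j + 1) z f hf (by rw [h4]; exact hj2.le)
  · rw [lintegral_add_left ((hYm 0).const_mul _), lintegral_const_mul _ (hYm 0),
      lintegral_tsum fun j => ((hYm (j + 1)).const_mul _).aemeasurable]
    have hsum : Summable fun j : ℕ => 8192 * (1 / 2 : ℝ) ^ j := summable_geometric_two.mul_left _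
    calc _ ≤ ENNReal.ofReal 8 * 256 + ∑' j : ℕ, ENNReal.ofReal (8192 * (1 / 2) ^ j) * 256 := by
          gcongr with j
          · exact hYi 0
          · rw [lintegral_const_mul _ (hYm (j + 1))]
            gcongr
            exact hYi (j + 1)
      _ = ENNReal.ofReal (8 * 256 + 8192 * 2 * 256) := by
          rw [ENNReal.tsum_mul_right, ← ENNReal.ofReal_tsum_of_nonneg (fun j => by positivity) hsum,
            tsum_mul_left, tsum_geometric_two, show (256 : ENNReal) = ENNReal.ofReal 256 by norm_num,
            ← ENNReal.ofReal_mul (by norm_num), ← ENNReal.ofReal_mul (by norm_num),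
            ← ENNReal.ofReal_add (by norm_num) (by norm_num)]
      _ ≤ _ := by gcongr; norm_num

/-- Since `(1 - g)² ≤ 1 - g`, the bias dominates `‖(1 - g)θ‖²`, and this compensates the linear term
up to a majorant whose mean does not depend on `θ`. -/
theorem exists_cross_envelope {n : ℕ} {T : Set (Fin n → ℝ)}
    (hch : ∀ g ∈ T, ∀ g' ∈ T, g ≤ g' ∨ g' ≤ g) (hT0 : ∀ g ∈ T, 0 ≤ g) (hT1 : ∀ g ∈ T, g ≤ 1)
    (θ : Fin n → ℝ) :
    ∃ Y : (Fin n → ℝ) → ENNReal, Measurable Y ∧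
      (∀ z, ∀ g ∈ T, ENNReal.ofReal (-(2 * ((1 - g) * θ) ⬝ᵥ z) - ∑ i, (1 - g i) * θ i ^ 2) ≤ Y z) ∧
      ∫⁻ z, Y z ∂whiteNoise n ≤ ENNReal.ofReal 5000000 := by
  have mono : ∀ g ∈ T, ∀ g' ∈ T, g ≤ g' →
      sqNorm ((1 - g) * θ - (1 - g') * θ) ≤ sqNorm ((1 - g) * θ) - sqNorm ((1 - g') * θ) := by
    intro g hg g' hg' h
    unfold sqNorm
    rw [← Finset.sum_sub_distrib]
    refine Finset.sum_le_sum fun i _ => ?_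
    have h1 : g' i ≤ 1 := hT1 g' hg' i
    have h2 := h i
    simp only [Pi.sub_apply, Pi.mul_apply, Pi.one_apply]
    have h3 : 0 ≤ (g' i - g i) * (1 - g' i) * θ i ^ 2 :=
      mul_nonneg (mul_nonneg (by linarith) (by linarith)) (sq_nonneg _)
    nlinarith
  obtain ⟨Y, hYm, hY, hYi⟩ := exists_linear_envelope (T := (fun g => (1 - g) * θ) '' T) (by
    rintro _ ⟨g, hg, rfl⟩ _ ⟨g', hg', rfl⟩
    simp only
    rcases hch g hg g' hg' with h | h
    · exact (mono g hg g' hg' h).trans (le_abs_self _)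
    · have hs : sqNorm ((1 - g) * θ - (1 - g') * θ) = sqNorm ((1 - g') * θ - (1 - g) * θ) := by
        unfold sqNorm
        exact Finset.sum_congr rfl fun i _ => by simp only [Pi.sub_apply]; ring
      rw [hs, abs_sub_comm]
      exact (mono g' hg' g hg h).trans (le_abs_self _))
  refine ⟨Y, hYm, fun z g hg => ?_, hYi⟩
  refine le_trans (ENNReal.ofReal_le_ofReal ?_) (hY z _ ⟨g, hg, rfl⟩)
  have h1 : sqNorm ((1 - g) * θ) ≤ ∑ i, (1 - g i) * θ i ^ 2 := by
    unfold sqNorm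
    refine Finset.sum_le_sum fun i _ => ?_
    have h0 : 0 ≤ g i := hT0 g hg i
    have h2 : g i ≤ 1 := hT1 g hg i
    simp only [Pi.sub_apply, Pi.mul_apply, Pi.one_apply]
    have : 0 ≤ g i * (1 - g i) * θ i ^ 2 := by
      exact mul_nonneg (mul_nonneg h0 (by linarith)) (sq_nonneg _)
    nlinarith
  have := neg_abs_le (((1 - g) * θ) ⬝ᵥ z)
  simp only at *
  linarith

/-! ### Fluctuations of the total noise energy. -/

theorem chi_one {n : ℕ} (z : Fin n → ℝ) : chi 1 z = sqNorm z - n := by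
  simp [chi, sqNorm]

theorem lintegral_exp_abs_chi_one_le (n : ℕ) {t : ℝ} (ht0 : 0 ≤ t) (ht : t ≤ 1 / 4) :
    ∫⁻ z, ENNReal.ofReal (Real.exp (t * |chi 1 z|)) ∂whiteNoise n ≤
      ENNReal.ofReal (2 * Real.exp (3 * t ^ 2 * n)) := by
  have one : ∀ s : ℝ, |s| = t → ∫⁻ z, ENNReal.ofReal (Real.exp (chi (fun _ => s) z)) ∂whiteNoise n ≤
      ENNReal.ofReal (Real.exp (3 * t ^ 2 * n)) := by
    intro s hs
    rw [lintegral_exp_chi fun _ => by linarith [le_abs_self s]]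
    gcongr
    simp only [Finset.sum_const, Finset.card_univ, Fintype.card_fin, nsmul_eq_mul]
    have := chiLogMgf_le_sq (x := s) (by linarith)
    have h2 : s ^ 2 = t ^ 2 := by rw [← hs, sq_abs]
    rw [h2] at this
    rw [mul_comm]
    gcongr
  have hlin : ∀ s : ℝ, ∀ z : Fin n → ℝ, chi (fun _ => s) z = s * chi 1 z := by
    intro s z
    unfold chi; rw [Finset.mul_sum]; simp
  have hm := measurable_chi (fun _ : Fin n => t)
  calc _ ≤ ∫⁻ z, (ENNReal.ofReal (Real.exp (chi (fun _ => t) z)) +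
        ENNReal.ofReal (Real.exp (chi (fun _ => -t) z))) ∂whiteNoise n := by
        refine lintegral_mono fun z => ?_
        rw [hlin, hlin, ← ENNReal.ofReal_add (Real.exp_pos _).le (Real.exp_pos _).le]
        refine ENNReal.ofReal_le_ofReal ?_
        rcases abs_choice (chi 1 z) with h | h <;> rw [h]
        · linarith [Real.exp_pos (-t * chi 1 z)]
        · rw [mul_neg, ← neg_mul]; linarith [Real.exp_pos (t * chi 1 z)]
    _ = _ := lintegral_add_left (by fun_prop) _
    _ ≤ _ := add_le_add (one t (abs_of_nonneg ht0)) (one (-t) (by rw [abs_neg, abs_of_nonneg ht0]))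
    _ = _ := by rw [← ENNReal.ofReal_add (Real.exp_pos _).le (Real.exp_pos _).le, two_mul]

theorem lintegral_chi_one_pow_four_le {n : ℕ} (hn : 0 < n) :
    ∫⁻ z, ENNReal.ofReal (chi 1 z ^ 4) ∂whiteNoise n ≤ ENNReal.ofReal (24576 * n ^ 2) := by
  have hn1 : (1 : ℝ) ≤ n := by exact_mod_cast hn
  have hs : 1 ≤ √(n : ℝ) := Real.one_le_sqrt.2 hn1
  have hs2 : √(n : ℝ) ^ 2 = n := Real.sq_sqrt (by linarith)
  set t : ℝ := 1 / (4 * √n) with ht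
  have ht0 : 0 < t := by positivity
  have ht4 : t ≤ 1 / 4 := by apply one_div_le_one_div_of_le <;> linarith
  have ht2 : t ^ 2 * n = 1 / 16 := by
    rw [ht, div_pow, mul_pow, hs2]; field_simp; norm_num
  have hpt : ∀ z : Fin n → ℝ, ENNReal.ofReal (chi 1 z ^ 4) ≤
      ENNReal.ofReal (6144 * n ^ 2) * ENNReal.ofReal (Real.exp (t * |chi 1 z|)) := by
    intro z
    rw [← ENNReal.ofReal_mul (by positivity)]
    refine ENNReal.ofReal_le_ofReal ?_
    have h0 : 0 ≤ t * |chi 1 z| := by positivity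
    have h1 := exp_quartic_le h0
    have h2 : (t * |chi 1 z|) ^ 4 ≤ 24 * Real.exp (t * |chi 1 z|) := by
      nlinarith [pow_nonneg h0 2, pow_nonneg h0 3]
    have h3 : chi 1 z ^ 4 = 256 * n ^ 2 * (t * |chi 1 z|) ^ 4 := by
      have : |chi 1 z| ^ 4 = chi 1 z ^ 4 := by
        rw [show (4 : ℕ) = 2 * 2 by norm_num, pow_mul, pow_mul, sq_abs]
      rw [mul_pow, this, show t ^ 4 = (t ^ 2) ^ 2 by ring]
      have h5 : (t ^ 2) ^ 2 * (n : ℝ) ^ 2 = 1 / 256 := by rw [← mul_pow, ht2]; norm_num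
      linear_combination (-256) * chi 1 z ^ 4 * h5
    rw [h3]
    have : (0 : ℝ) ≤ 256 * n ^ 2 := by positivity
    nlinarith
  calc _ ≤ ∫⁻ z, ENNReal.ofReal (6144 * n ^ 2) * ENNReal.ofReal (Real.exp (t * |chi 1 z|))
        ∂whiteNoise n := lintegral_mono hpt
    _ = ENNReal.ofReal (6144 * n ^ 2) *
        ∫⁻ z, ENNReal.ofReal (Real.exp (t * |chi 1 z|)) ∂whiteNoise n :=
        lintegral_const_mul' _ _ ENNReal.ofReal_ne_top
    _ ≤ ENNReal.ofReal (6144 * n ^ 2) * ENNReal.ofReal (2 * 2) := by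
        gcongr
        refine (lintegral_exp_abs_chi_one_le n ht0.le ht4).trans (ENNReal.ofReal_le_ofReal ?_)
        gcongr
        rw [mul_assoc, ht2]
        have := Real.exp_bound' (x := 3 * (1 / 16)) (by norm_num) (by norm_num) (n := 1) (by norm_num)
        norm_num at this ⊢
        linarith
    _ = _ := by rw [← ENNReal.ofReal_mul (by positivity)]; congr 1; ring

/-- In the range `|χ_1| ≤ n` the variable `χ_1/√n` has sub-Gaussian tails; without the restriction
the exponential of the square is not integrable. The integer part `j` of `|χ_1|/√n` is treated with
the Chernoff parameter `j/(8√n)`, and the contributions are summed. -/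
theorem exists_majorant_exp_sq {n : ℕ} (hn : 0 < n) :
    ∃ Y : (Fin n → ℝ) → ENNReal, Measurable Y ∧
      (∀ z, |chi 1 z| ≤ n → ENNReal.ofReal (Real.exp (chi 1 z ^ 2 / (64 * n))) ≤ Y z) ∧
      ∫⁻ z, Y z ∂whiteNoise n ≤ ENNReal.ofReal 200 := by
  have hn0 : (0 : ℝ) < n := by exact_mod_cast hn
  have hs : 0 < √(n : ℝ) := Real.sqrt_pos.2 hn0
  have hs2 : √(n : ℝ) ^ 2 = n := Real.sq_sqrt hn0.le
  have hcm := measurable_chi (1 : Fin n → ℝ)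
  set Y : ℕ → (Fin n → ℝ) → ENNReal := fun j z => if (j : ℝ) ≤ √n then
    ENNReal.ofReal (Real.exp ((j + 1) ^ 2 / 64 - j ^ 2 / 8)) *
      ENNReal.ofReal (Real.exp (j / (8 * √n) * |chi 1 z|)) else 0 with hY
  have hYm : ∀ j, Measurable (Y j) := by
    intro j
    simp only [hY]
    split_ifs <;> fun_prop
  refine ⟨fun z => ∑' j, Y j z, Measurable.tsum hYm, ?_, ?_⟩
  · intro z hz
    set w := |chi 1 z| / √n with hw
    have hw0 : 0 ≤ w := by positivity
    have hws : w ≤ √n := by rw [hw, div_le_iff₀ hs, ← sq, hs2]; exact hz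
    have hj := Nat.floor_le hw0
    have hj1 := Nat.lt_floor_add_one w
    refine le_trans ?_ (ENNReal.le_tsum ⌊w⌋₊)
    simp only [hY]
    rw [if_pos (hj.trans hws), ← ENNReal.ofReal_mul (Real.exp_pos _).le, ← Real.exp_add]
    gcongr
    have h1 : chi 1 z ^ 2 / (64 * n) = w ^ 2 / 64 := by
      rw [hw, div_pow, hs2, sq_abs]; field_simp
    have h2 : (⌊w⌋₊ : ℝ) / (8 * √n) * |chi 1 z| = ⌊w⌋₊ * w / 8 := by rw [hw]; field_simp
    rw [h1, h2]
    have h3 : w ^ 2 ≤ ((⌊w⌋₊ : ℝ) + 1) ^ 2 := by gcongr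
    have h4 : (⌊w⌋₊ : ℝ) ^ 2 ≤ ⌊w⌋₊ * w := by rw [sq]; gcongr
    linarith
  · rw [lintegral_tsum fun j => (hYm j).aemeasurable]
    have hj : ∀ j : ℕ, ∫⁻ z, Y j z ∂whiteNoise n ≤
        ENNReal.ofReal (2 * Real.exp (11 / 64) * Real.exp (-(3 / 64 * (j + 3)))) := by
      intro j
      simp only [hY]
      split_ifs with h
      · rw [lintegral_const_mul' _ _ ENNReal.ofReal_ne_top]
        have h8 : (j : ℝ) / (8 * √n) ≤ 1 / 4 := by
          rw [div_le_div_iff₀ (by positivity) (by norm_num)]; linarith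
        calc _ ≤ ENNReal.ofReal (Real.exp ((j + 1) ^ 2 / 64 - j ^ 2 / 8)) *
              ENNReal.ofReal (2 * Real.exp (3 * (j / (8 * √n)) ^ 2 * n)) := by
              gcongr
              exact lintegral_exp_abs_chi_one_le n (by positivity) h8
          _ ≤ _ := by
              rw [← ENNReal.ofReal_mul (Real.exp_pos _).le]
              refine ENNReal.ofReal_le_ofReal ?_
              rw [mul_left_comm, ← Real.exp_add, mul_assoc 2 (Real.exp (11 / 64)), ← Real.exp_add]
              refine mul_le_mul_of_nonneg_left (Real.exp_le_exp.2 ?_) (by norm_num)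
              have h5 : 3 * ((j : ℝ) / (8 * √n)) ^ 2 * n = 3 / 64 * j ^ 2 := by
                rw [div_pow, mul_pow, hs2]; field_simp; norm_num
              rw [h5]
              -- The comparison of exponents amounts to `(4j - 1)(j - 1) ≥ 0`, which uses that `j`
              -- is an integer.
              have h6 : (j : ℝ) ≤ j ^ 2 := by exact_mod_cast Nat.le_self_pow (by norm_num) j
              nlinarith [sq_nonneg ((j : ℝ) - 1)]
      · simp
    refine (ENNReal.tsum_le_tsum hj).trans ((tsum_exp_neg_mul_le (by norm_num) (by norm_num)
      (by positivity)).trans (ENNReal.ofReal_le_ofReal ?_))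
    have := Real.exp_bound' (x := 11 / 64) (by norm_num) (by norm_num) (n := 1) (by norm_num)
    norm_num at this ⊢
    linarith

/-- One random variable serves all `D`, so no chaining is needed. With `y = k√(D/n)|χ_1|/√n` the
term is `√D y`, and it exceeds `√(2Du)`, `u = log(D/D₀)`, only if `u < y²/2`. Then `√D ≤ √D₀
e^{y²/4}`, and the excess is at most `√D₀ e^{5y²/4}`, whose mean is controlled because `128 k² d ≤
1`. -/
theorem exists_total_noise_envelope {n : ℕ} (hn : 0 < n) {k d D₀ : ℝ} (hk : 0 < k)
    (hd1 : d ≤ 1) (hkd : 128 * (k ^ 2 * d) ≤ 1) (hkn : 24576 * k ≤ n) (hD₀ : 5 ≤ D₀) :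
    ∃ Y : (Fin n → ℝ) → ENNReal, Measurable Y ∧
      (∀ z, ∀ D, D₀ ≤ D → D ≤ d * n → Real.log (D / D₀) < 1 →
        ENNReal.ofReal (k * (D / n) * |chi 1 z|) ≤ Y z) ∧
      (∀ z, ∀ D, D₀ ≤ D → D ≤ d * n → 1 ≤ Real.log (D / D₀) →
        ENNReal.ofReal (k * (D / n) * |chi 1 z| - √(2 * D) * √(Real.log (D / D₀))) ≤ Y z) ∧
      ∫⁻ z, Y z ∂whiteNoise n ≤ ENNReal.ofReal (30000 * √D₀) := by
  have hn0 : (0 : ℝ) < n := by exact_mod_cast hn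
  have hs : 0 < √(n : ℝ) := Real.sqrt_pos.2 hn0
  have hs2 : √(n : ℝ) ^ 2 = n := Real.sq_sqrt hn0.le
  have hD₀0 : 0 < D₀ := by linarith
  have hsD0 : 0 < √D₀ := Real.sqrt_pos.2 hD₀0
  have hsD1 : 1 ≤ √D₀ := Real.one_le_sqrt.2 (by linarith)
  have hcm := measurable_chi (1 : Fin n → ℝ)
  obtain ⟨Y, hYm, hY, hYi⟩ := exists_majorant_exp_sq hn
  have hrw : ∀ (z : Fin n → ℝ) (D : ℝ), 0 ≤ D → k * (D / n) * |chi 1 z| =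
      √D * (k * √(D / n) * (|chi 1 z| / √n)) := by
    intro z D hD
    rw [Real.sqrt_div hD]
    have : √D * √D = D := Real.mul_self_sqrt hD
    have h2 : √(n : ℝ) * √n = n := Real.mul_self_sqrt hn0.le
    field_simp
    rw [hs2, Real.sq_sqrt hD]
    ring
  have hbd : ∀ D, D ≤ d * n → (k * √(D / n)) ^ 2 ≤ 1 / 128 := by
    intro D hD
    rcases le_or_gt 0 D with h0 | h0
    · rw [mul_pow, Real.sq_sqrt (by positivity)]
      have : D / n ≤ d := by rwa [div_le_iff₀ hn0]
      nlinarith [mul_le_mul_of_nonneg_left this (sq_nonneg k)]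
    · rw [Real.sqrt_eq_zero_of_nonpos (by apply div_nonpos_of_nonpos_of_nonneg h0.le hn0.le)]; norm_num
  -- The first summand covers `u < 1`; the second covers `u ≥ 1` with `|χ_1| > n`; the third covers
  -- `u ≥ 1` with `|χ_1| ≤ n`.
  refine ⟨fun z => ENNReal.ofReal (√D₀ * (1 + chi 1 z ^ 4 / n ^ 2)) +
    (ENNReal.ofReal (k / n ^ 3 * chi 1 z ^ 4) + ENNReal.ofReal √D₀ * Y z), ?_, ?_, ?_, ?_⟩
  · fun_prop
  · intro z D hD hDn hlog
    refine le_trans (ENNReal.ofReal_le_ofReal ?_) le_self_add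
    have hD0 : 0 < D := by linarith
    have hD3 : D ≤ D₀ * 3 := by
      rw [Real.log_lt_iff_lt_exp (by positivity), div_lt_iff₀ hD₀0] at hlog
      nlinarith [Real.exp_one_lt_d9]
    have hsD : √D ≤ √D₀ * 2 := by
      rw [Real.sqrt_le_left (by positivity), mul_pow, Real.sq_sqrt hD₀0.le]; linarith
    rw [hrw z D hD0.le]
    set w := |chi 1 z| / √n with hw
    have hw0 : 0 ≤ w := by positivity
    have hw4 : chi 1 z ^ 4 / n ^ 2 = w ^ 4 := by
      have : |chi 1 z| ^ 4 = chi 1 z ^ 4 := by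
        rw [show (4 : ℕ) = 2 * 2 by norm_num, pow_mul, pow_mul, sq_abs]
      rw [hw, div_pow, this, show √(n : ℝ) ^ 4 = (√(n : ℝ) ^ 2) ^ 2 by ring, hs2]
    rw [hw4]
    have h1 : k * √(D / n) ≤ 1 / 2 := by
      refine abs_le_of_sq_le_sq' ?_ (by norm_num) |>.2
      exact (hbd D hDn).trans (by norm_num)
    have h2 : w ≤ 1 + w ^ 4 := by nlinarith [sq_nonneg (w ^ 2 - 1/2), sq_nonneg (w - 1/2)]
    calc √D * (k * √(D / n) * w) ≤ √D₀ * 2 * (1 / 2 * w) := by gcongr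
      _ = √D₀ * w := by ring
      _ ≤ _ := by gcongr
  · intro z D hD hDn hlog
    refine le_trans ?_ le_add_self
    have hD0 : 0 < D := by linarith
    rcases le_or_gt |chi 1 z| n with hWn | hWn
    · refine le_trans ?_ le_add_self
      refine le_trans ?_ (mul_le_mul' le_rfl (hY z hWn))
      rw [← ENNReal.ofReal_mul hsD0.le]
      refine ENNReal.ofReal_le_ofReal ?_
      rw [hrw z D hD0.le]
      set u := Real.log (D / D₀) with hu
      set w := |chi 1 z| / √n with hw
      have hw0 : 0 ≤ w := by positivity
      set y := k * √(D / n) * w with hy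
      have hy0 : 0 ≤ y := by positivity
      have hw2 : chi 1 z ^ 2 / (64 * n) = w ^ 2 / 64 := by
        rw [hw, div_pow, hs2, sq_abs]; field_simp
      have hy2 : y ^ 2 ≤ w ^ 2 / 128 := by
        rw [hy, mul_pow]
        nlinarith [hbd D hDn, sq_nonneg w]
      have hDe : √D = √D₀ * Real.exp (u / 2) := by
        rw [Real.exp_half, ← Real.sqrt_mul hD₀0.le, hu, Real.exp_log (by positivity)]
        congr 1; field_simp
      have h2D : √(2 * D) * √u = √D * √(2 * u) := by
        rw [← Real.sqrt_mul (by positivity), ← Real.sqrt_mul hD0.le]; congr 1; ring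
      rw [h2D, hw2]
      rcases le_or_gt y (√(2 * u)) with h | h
      · have : √D * y ≤ √D * √(2 * u) := by gcongr
        have h3 : 0 ≤ √D₀ * Real.exp (w ^ 2 / 64) := by positivity
        linarith
      · have h4 : 2 * u ≤ y ^ 2 := by
          rw [← Real.sq_sqrt (show 0 ≤ 2 * u by linarith)]
          gcongr
        have h5 : y ≤ Real.exp (y ^ 2) := by
          have := Real.add_one_le_exp (y ^ 2)
          nlinarith [sq_nonneg (y - 1 / 2)]
        calc √D * y - √D * √(2 * u) ≤ √D * y := by
              have : 0 ≤ √D * √(2 * u) := by positivity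
              linarith
          _ ≤ √D₀ * Real.exp (y ^ 2 / 4) * Real.exp (y ^ 2) := by
              have h6 : Real.exp (u / 2) ≤ Real.exp (y ^ 2 / 4) :=
                Real.exp_le_exp.2 (by linarith)
              rw [hDe]; gcongr
          _ = √D₀ * Real.exp (5 / 4 * y ^ 2) := by
              rw [mul_assoc, ← Real.exp_add]; ring_nf
          _ ≤ _ := by gcongr; nlinarith
    · refine le_trans (ENNReal.ofReal_le_ofReal ?_) le_self_add
      have hDn' : D / n ≤ 1 := by rw [div_le_one hn0]; nlinarith
      have h0 : 0 ≤ √(2 * D) * √(Real.log (D / D₀)) := by positivity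
      have h1 : k * (D / n) * |chi 1 z| ≤ k * |chi 1 z| := by
        have : 0 ≤ k * |chi 1 z| := by positivity
        nlinarith
      have h2 : k * |chi 1 z| ≤ k / n ^ 3 * chi 1 z ^ 4 := by
        have h3 : |chi 1 z| ^ 4 = chi 1 z ^ 4 := by
          rw [show (4 : ℕ) = 2 * 2 by norm_num, pow_mul, pow_mul, sq_abs]
        rw [← h3, div_mul_eq_mul_div, le_div_iff₀ (by positivity)]
        have h4 : (n : ℝ) ^ 3 ≤ |chi 1 z| ^ 3 := by gcongr
        have : 0 ≤ k * |chi 1 z| := by positivity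
        nlinarith
      linarith
  · have hW := lintegral_chi_one_pow_four_le hn
    have hrw1 : ∀ (c : ℝ), 0 ≤ c → ∫⁻ z, ENNReal.ofReal (c * chi 1 z ^ 4) ∂whiteNoise n ≤
        ENNReal.ofReal (c * (24576 * n ^ 2)) := by
      intro c hc
      simp_rw [ENNReal.ofReal_mul hc]
      rw [lintegral_const_mul' _ _ ENNReal.ofReal_ne_top]
      gcongr
    rw [lintegral_add_left (by fun_prop), lintegral_add_left (by fun_prop),
      lintegral_const_mul _ hYm]
    have h1 : ∫⁻ z, ENNReal.ofReal (√D₀ * (1 + chi 1 z ^ 4 / n ^ 2)) ∂whiteNoise n ≤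
        ENNReal.ofReal (√D₀ + √D₀ * 24576) := by
      have : ∀ z : Fin n → ℝ, ENNReal.ofReal (√D₀ * (1 + chi 1 z ^ 4 / n ^ 2)) =
          ENNReal.ofReal √D₀ + ENNReal.ofReal (√D₀ / n ^ 2 * chi 1 z ^ 4) := by
        intro z
        rw [← ENNReal.ofReal_add hsD0.le (by positivity)]
        congr 1; ring
      simp_rw [this]
      rw [lintegral_add_left measurable_const, lintegral_const, measure_univ, mul_one,
        ENNReal.ofReal_add hsD0.le (by positivity)]
      gcongr
      refine (hrw1 _ (by positivity)).trans (le_of_eq ?_)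
      congr 1; field_simp
    calc _ ≤ ENNReal.ofReal (√D₀ + √D₀ * 24576) + (ENNReal.ofReal 1 +
          ENNReal.ofReal √D₀ * ENNReal.ofReal 200) := by
          gcongr
          refine (hrw1 _ (by positivity)).trans (ENNReal.ofReal_le_ofReal ?_)
          rw [div_mul_eq_mul_div, div_le_one (by positivity)]
          nlinarith [sq_nonneg (n : ℝ), mul_le_mul_of_nonneg_right hkn (sq_nonneg (n : ℝ))]
      _ ≤ _ := by
          rw [← ENNReal.ofReal_mul hsD0.le, ← ENNReal.ofReal_add (by norm_num) (by positivity),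
            ← ENNReal.ofReal_add (by positivity) (by positivity)]
          refine ENNReal.ofReal_le_ofReal ?_
          linarith

/-! ### The oracle inequality in the sequence space model. -/

theorem integrable_coord_whiteNoise {n : ℕ} {f : ℝ → ℝ} (hf : Integrable f (gaussianReal 0 1))
    (i : Fin n) : Integrable (fun z => f (z i)) (whiteNoise n) ∧
      ∫ z, f (z i) ∂whiteNoise n = ∫ x, f x ∂gaussianReal 0 1 := by
  have hmp : MeasurePreserving (Function.eval i) (whiteNoise n) (gaussianReal 0 1) :=
    measurePreserving_eval (fun _ : Fin n => gaussianReal 0 1) i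
  refine ⟨hmp.integrable_comp_of_integrable hf, ?_⟩
  rw [← hmp.map_eq, integral_map hmp.measurable.aemeasurable (by rw [hmp.map_eq]; exact hf.1)]

theorem integral_chi {n : ℕ} (c : Fin n → ℝ) :
    Integrable (chi c) (whiteNoise n) ∧ ∫ z, chi c z ∂whiteNoise n = 0 := by
  have hsq : Integrable (fun x : ℝ => x ^ 2) (gaussianReal 0 1) :=
    (memLp_id_gaussianReal 2).integrable_sq
  have hvar : ∫ x : ℝ, x ^ 2 ∂gaussianReal 0 1 = 1 := by
    have h := variance_id_gaussianReal (μ := 0) (v := 1)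
    rw [variance_of_integral_eq_zero aemeasurable_id (by simp)] at h
    simpa using h
  have h1 : ∀ i : Fin n, Integrable (fun z : Fin n → ℝ => c i * (z i ^ 2 - 1)) (whiteNoise n) ∧
      ∫ z : Fin n → ℝ, c i * (z i ^ 2 - 1) ∂whiteNoise n = 0 := by
    intro i
    have h := integrable_coord_whiteNoise (f := fun x => c i * (x ^ 2 - 1))
      ((hsq.sub (integrable_const 1)).const_mul _) i
    refine ⟨h.1, h.2.trans ?_⟩
    rw [integral_const_mul, integral_sub hsq (integrable_const 1), hvar]
    simp
  unfold chi
  refine ⟨integrable_finsetSum _ fun i _ => (h1 i).1, ?_⟩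
  rw [integral_finsetSum _ fun i _ => (h1 i).1]
  exact Finset.sum_eq_zero fun i _ => (h1 i).2

theorem integral_dotProduct_whiteNoise {n : ℕ} (c : Fin n → ℝ) :
    Integrable (fun z => c ⬝ᵥ z) (whiteNoise n) ∧ ∫ z, c ⬝ᵥ z ∂whiteNoise n = 0 := by
  have hid : Integrable (fun x : ℝ => x) (gaussianReal 0 1) :=
    (memLp_id_gaussianReal 1).integrable le_rfl
  have h1 : ∀ i : Fin n, Integrable (fun z : Fin n → ℝ => c i * z i) (whiteNoise n) ∧
      ∫ z : Fin n → ℝ, c i * z i ∂whiteNoise n = 0 := by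
    intro i
    have h := integrable_coord_whiteNoise (f := fun x => c i * x) (hid.const_mul _) i
    refine ⟨h.1, h.2.trans ?_⟩
    rw [integral_const_mul]
    simp
  unfold dotProduct
  refine ⟨integrable_finsetSum _ fun i _ => (h1 i).1, ?_⟩
  rw [integral_finsetSum _ fun i _ => (h1 i).1]
  exact Finset.sum_eq_zero fun i _ => (h1 i).2

/-- `n σ̂² - ‖z‖²` in the sequence space model with unit noise level, filter `g`, signal `θ`, and
correction factor `1 + q`. -/
noncomputable def seqDeviation {n : ℕ} (θ g : Fin n → ℝ) (q : ℝ) (z : Fin n → ℝ) : ℝ :=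
  (1 + q) * (∑ i, (1 - g i) * θ i ^ 2 + 2 * ((1 - g) * θ) ⬝ᵥ z - chi g z) + q * chi 1 z

/-- This is the comparison value `Z` in the selection inequality. Its random terms are centered, so
its mean is the risk without the nonnegative term `v²/n`. -/
theorem integral_penalized_seqDeviation {n : ℕ} (θ g : Fin n → ℝ) (q v : ℝ) :
    Integrable (fun z => seqDeviation θ g q z * (1 + v / n) + v * (1 + chi 1 z / n))
        (whiteNoise n) ∧
      ∫ z, (seqDeviation θ g q z * (1 + v / n) + v * (1 + chi 1 z / n)) ∂whiteNoise n =
        (1 + q) * (∑ i, (1 - g i) * θ i ^ 2) * (1 + v / n) + v := by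
  have h1 := integral_chi g
  have h2 := integral_chi (1 : Fin n → ℝ)
  have h3 := integral_dotProduct_whiteNoise ((1 - g) * θ)
  set B := ∑ i, (1 - g i) * θ i ^ 2
  have hrw : (fun z => seqDeviation θ g q z * (1 + v / n) + v * (1 + chi 1 z / n)) = fun z =>
      (((1 + q) * B * (1 + v / n) + v) + ((1 + q) * 2 * (1 + v / n)) * (((1 - g) * θ) ⬝ᵥ z)) +
        ((-((1 + q) * (1 + v / n))) * chi g z + (q * (1 + v / n) + v / n) * chi 1 z) := by
    ext z; unfold seqDeviation; ring
  have i1 := h1.1.const_mul (-((1 + q) * (1 + v / n)))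
  have i2 := h2.1.const_mul (q * (1 + v / n) + v / n)
  have i3 := h3.1.const_mul ((1 + q) * 2 * (1 + v / n))
  have i0 := integrable_const (μ := whiteNoise n) ((1 + q) * B * (1 + v / n) + v)
  rw [hrw]
  refine ⟨(i0.add i3).add (i1.add i2), ?_⟩
  have e1 := integral_add (i0.add i3) (i1.add i2)
  have e2 := integral_add i0 i3
  have e3 := integral_add i1 i2
  simp only [Pi.add_apply] at e1
  rw [e1, e2, e3, integral_const_mul, integral_const_mul, integral_const_mul, h1.2, h2.2, h3.2]
  simp

/-- The deterministic core. For a positive deviation, `hsel` suffices. For a deviation `-N < 0`, the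
envelopes give `(1 + δ + γ)N ≤ (1 - δ)v + noise` through `haδ`, and `hsel` gives `(1 - δ)v ≤ Z + (1
+ δ)N + E₄`. Adding the two leaves `γN` on the left. -/
theorem abs_deviation_le {n B x η W q v Z δ γ a E₁ E₂ E₃ E₄ : ℝ} (hn : 0 < n)
    (hq0 : 0 ≤ q) (hqδ : q ≤ δ) (hv0 : 0 ≤ v) (hvδ : v ≤ δ * n) (hW : 0 ≤ W + n)
    (hδ : δ ≤ 1) (hγ0 : 0 < γ) (hγ1 : γ ≤ 1) (ha : 0 ≤ a)
    (haδ : ((1 + δ) * a + δ) * (1 + δ + γ) ≤ 1 - δ)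
    (hE₁ : 0 ≤ E₁) (hE₂ : 0 ≤ E₂) (hE₃ : 0 ≤ E₃) (hE₄ : 0 ≤ E₄)
    (h₁ : η ≤ a * v + E₁) (h₂ : -(2 * x) - B ≤ E₂) (h₃ : q * |W| ≤ δ * v + E₃)
    (h₄ : -(v * (W / n)) ≤ δ * v + E₄)
    (hsel : ((1 + q) * (B + 2 * x - η) + q * W) * (1 + v / n) + v * (1 + W / n) ≤ Z) :
    γ * |(1 + q) * (B + 2 * x - η) + q * W| ≤ Z + (E₄ + 6 * (E₁ + E₂) + 3 * E₃) := by
  set Δ := (1 + q) * (B + 2 * x - η) + q * W with hΔ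
  have hvn0 : 0 ≤ v / n := by positivity
  have hvn : v / n ≤ δ := by rwa [div_le_iff₀ hn]
  rcases le_or_gt 0 Δ with h | h
  · rw [abs_of_nonneg h]
    have h5 : 0 ≤ v * (1 + W / n) := by
      refine mul_nonneg hv0 ?_
      rw [show 1 + W / n = (W + n) / n by field_simp; ring]
      positivity
    nlinarith [mul_nonneg h hvn0]
  · rw [abs_of_neg h]
    set N := -Δ with hN
    have hN0 : 0 < N := by linarith
    have h5 : (1 + q) * (η - B - 2 * x) ≤ (1 + δ) * (a * v + E₁ + E₂) := by
      have h6 : η - B - 2 * x ≤ a * v + E₁ + E₂ := by linarith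
      have h7 : 0 ≤ a * v + E₁ + E₂ := by positivity
      nlinarith
    have h6 : -(q * W) ≤ q * |W| := by
      have := neg_abs_le W
      nlinarith
    have h7 : N ≤ ((1 + δ) * a + δ) * v + ((1 + δ) * (E₁ + E₂) + E₃) := by
      have : N = (1 + q) * (η - B - 2 * x) - q * W := by rw [hN, hΔ]; ring
      nlinarith
    have hδ0 : 0 ≤ δ := hq0.trans hqδ
    have h8 : (1 + δ + γ) * N ≤ (1 - δ) * v + 3 * ((1 + δ) * (E₁ + E₂) + E₃) := by
      have h9 : 0 ≤ (1 + δ) * (E₁ + E₂) + E₃ := by positivity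
      calc (1 + δ + γ) * N ≤ (1 + δ + γ) *
            (((1 + δ) * a + δ) * v + ((1 + δ) * (E₁ + E₂) + E₃)) := by gcongr
        _ = ((1 + δ) * a + δ) * (1 + δ + γ) * v +
            (1 + δ + γ) * ((1 + δ) * (E₁ + E₂) + E₃) := by ring
        _ ≤ _ := by gcongr; linarith
    have h9 : N * (1 + v / n) ≤ N * (1 + δ) := by gcongr
    have h10 : (1 - δ) * v ≤ Z + N * (1 + δ) + E₄ := by
      have h11 : -(N * (1 + v / n)) + v * (1 + W / n) ≤ Z := by
        have : Δ = -N := by rw [hN]; ring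
        rw [this] at hsel; linarith
      linarith
    have h11 : (1 + δ) * (E₁ + E₂) ≤ 2 * (E₁ + E₂) := by gcongr; linarith
    linarith

/-- The integral of a possibly nonmeasurable `f` is additive only against measurable summands. The
hypothesis therefore carries the negative part of `Z` on the left; having a finite integral, it can
be cancelled at the end. -/
theorem lintegral_le_of_le_add {Ω : Type*} [MeasurableSpace Ω] {μ : Measure Ω} {f E : Ω → ENNReal}
    {Z : Ω → ℝ} (hE : Measurable E) (hZm : Measurable Z) (hZ : Integrable Z μ) (hZ0 : 0 ≤ ∫ ω, Z ω ∂μ)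
    (h : ∀ ω, f ω + ENNReal.ofReal (-Z ω) ≤ ENNReal.ofReal (Z ω) + E ω) :
    ∫⁻ ω, f ω ∂μ ≤ ENNReal.ofReal (∫ ω, Z ω ∂μ) + ∫⁻ ω, E ω ∂μ := by
  have hfin : ∫⁻ ω, ENNReal.ofReal (-Z ω) ∂μ ≠ ⊤ := hZ.neg.lintegral_lt_top.ne
  have hfin' : ∫⁻ ω, ENNReal.ofReal (Z ω) ∂μ ≠ ⊤ := hZ.lintegral_lt_top.ne
  have h1 : ∫⁻ ω, ENNReal.ofReal (Z ω) ∂μ =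
      ENNReal.ofReal (∫ ω, Z ω ∂μ) + ∫⁻ ω, ENNReal.ofReal (-Z ω) ∂μ := by
    rw [← ENNReal.ofReal_toReal hfin, ← ENNReal.ofReal_add hZ0 ENNReal.toReal_nonneg,
      integral_eq_lintegral_pos_part_sub_lintegral_neg_part hZ, sub_add_cancel,
      ENNReal.ofReal_toReal hfin']
  have h2 := lintegral_mono (μ := μ) h
  rw [lintegral_add_right _ (by fun_prop), lintegral_add_right _ hE, h1, add_right_comm] at h2
  exact (ENNReal.add_le_add_iff_right hfin).1 h2

theorem lintegral_noise_combination_le {Ω : Type*} [MeasurableSpace Ω] {μ : Measure Ω}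
    {Y₁ Y₂ Y₃ Y₄ : Ω → ENNReal} {s κ C : ℝ} (hκ : 0 < κ) (hκ1 : κ ≤ 1) (hs : 1 ≤ s) (hC : 0 < C)
    (hm₁ : Measurable Y₁) (hm₂ : Measurable Y₂) (hm₃ : Measurable Y₃) (hm₄ : Measurable Y₄)
    (h₁ : ∫⁻ ω, Y₁ ω ∂μ ≤ ENNReal.ofReal (C * s / κ))
    (h₂ : ∫⁻ ω, Y₂ ω ∂μ ≤ ENNReal.ofReal 5000000)
    (h₃ : ∫⁻ ω, Y₃ ω ∂μ ≤ ENNReal.ofReal (30000 * s)) (h₄ : ∫⁻ ω, Y₄ ω ∂μ ≤ ENNReal.ofReal 1) :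
    ∫⁻ ω, (Y₄ ω + 6 * (Y₁ ω + Y₂ ω) + 3 * Y₃ ω) ∂μ ≤
      ENNReal.ofReal ((1 + 6 * (C + 5000000) + 3 * 30000) * s / κ) := by
  have hsk : s ≤ s / κ := by rw [le_div_iff₀ hκ]; nlinarith
  rw [lintegral_add_left (by fun_prop), lintegral_add_left hm₄,
    lintegral_const_mul _ (by fun_prop), lintegral_add_left hm₁, lintegral_const_mul _ hm₃]
  calc _ ≤ ENNReal.ofReal 1 + ENNReal.ofReal 6 * (ENNReal.ofReal (C * s / κ) +
        ENNReal.ofReal 5000000) + ENNReal.ofReal 3 * ENNReal.ofReal (30000 * s) := by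
        gcongr <;> norm_num
    _ ≤ _ := by
        rw [← ENNReal.ofReal_add (by positivity) (by positivity),
          ← ENNReal.ofReal_mul (by norm_num), ← ENNReal.ofReal_mul (by norm_num),
          ← ENNReal.ofReal_add (by positivity) (by positivity),
          ← ENNReal.ofReal_add (by positivity) (by positivity)]
        refine ENNReal.ofReal_le_ofReal ?_
        have : (1 + 6 * (C + 5000000) + 3 * 30000) * s / κ =
          (s / κ) + 6 * (C * s / κ + 5000000 * (s / κ)) + 3 * (30000 * (s / κ)) := by ring
        rw [this]
        linarith

theorem ofReal_add_ofReal_neg_le {x Z : ℝ} {Y₁ Y₂ Y₃ Y₄ : ENNReal} (hx : 0 ≤ x)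
    (h : Y₁ ≠ ⊤ → Y₂ ≠ ⊤ → Y₃ ≠ ⊤ → Y₄ ≠ ⊤ →
      x ≤ Z + (Y₄.toReal + 6 * (Y₁.toReal + Y₂.toReal) + 3 * Y₃.toReal)) :
    ENNReal.ofReal x + ENNReal.ofReal (-Z) ≤
      ENNReal.ofReal Z + (Y₄ + 6 * (Y₁ + Y₂) + 3 * Y₃) := by
  by_cases hE : Y₄ + 6 * (Y₁ + Y₂) + 3 * Y₃ = ⊤
  · rw [hE, add_top]; exact le_top
  have t1 : Y₁ ≠ ⊤ := fun h => by simp [h] at hE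
  have t2 : Y₂ ≠ ⊤ := fun h => by simp [h] at hE
  have t3 : Y₃ ≠ ⊤ := fun h => by simp [h] at hE
  have t4 : Y₄ ≠ ⊤ := fun h => by simp [h] at hE
  have hx' := h t1 t2 t3 t4
  have hsum : (Y₄ + 6 * (Y₁ + Y₂) + 3 * Y₃).toReal =
      Y₄.toReal + 6 * (Y₁.toReal + Y₂.toReal) + 3 * Y₃.toReal := by
    rw [ENNReal.toReal_add (by finiteness) (by finiteness),
      ENNReal.toReal_add (by finiteness) (by finiteness), ENNReal.toReal_mul,
      ENNReal.toReal_mul, ENNReal.toReal_add t1 t2]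
    norm_num
  rw [← hsum] at hx'
  rw [← ENNReal.ofReal_toReal hE]
  rcases le_total 0 Z with h | h
  · rw [ENNReal.ofReal_of_nonpos (by linarith : -Z ≤ 0), add_zero,
      ← ENNReal.ofReal_add h ENNReal.toReal_nonneg]
    exact ENNReal.ofReal_le_ofReal hx'
  · rw [ENNReal.ofReal_of_nonpos h, zero_add, ← ENNReal.ofReal_add hx (by linarith)]
    exact ENNReal.ofReal_le_ofReal (by linarith)

/-- The random factor of the penalty is harmless while `|W| ≤ δn`; the rare complement is paid for
by a fourth moment. -/
theorem neg_mul_div_le_add_pow_four {v W n δ c : ℝ} (hn : 0 < n) (hδ : 0 < δ) (hc : 0 < c)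
    (hv0 : 0 ≤ v) (hv : v ≤ c * n) : -(v * (W / n)) ≤ δ * v + c / (δ * n) ^ 3 * W ^ 4 := by
  have hW4 : |W| ^ 4 = W ^ 4 := by
    rw [show (4 : ℕ) = 2 * 2 by norm_num, pow_mul, pow_mul, sq_abs]
  rcases le_or_gt |W| (δ * n) with h | h
  · have h1 : -(W / n) ≤ δ := by
      rw [← neg_div, div_le_iff₀ hn]
      linarith [neg_abs_le W]
    have h2 : 0 ≤ c / (δ * n) ^ 3 * W ^ 4 := by positivity
    nlinarith
  · have h2 : v / n ≤ c := by rwa [div_le_iff₀ hn]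
    have h3 : c * |W| ≤ c / (δ * n) ^ 3 * W ^ 4 := by
      rw [← hW4, div_mul_eq_mul_div, le_div_iff₀ (by positivity)]
      have h5 : (δ * n) ^ 3 ≤ |W| ^ 3 := by gcongr
      have h6 : 0 ≤ c * |W| := by positivity
      calc c * |W| * (δ * n) ^ 3 ≤ c * |W| * |W| ^ 3 := by gcongr
        _ = c * |W| ^ 4 := by ring
    have h4 : -(v * (W / n)) ≤ c * |W| := by
      calc -(v * (W / n)) = v / n * -W := by ring
        _ ≤ v / n * |W| := by gcongr; exact neg_le_abs _
        _ ≤ _ := by gcongr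
    have : 0 ≤ δ * v := by positivity
    linarith

/-- `d` bounds `D/n`, `k` compares `q/δ` with `D/n`, `c` compares `v` with `D`, `δ` bounds `q` and
`v/n`, and `κ` is the slack given to the chi-square envelope. The majorants `Y₁, …, Y₄` in the proof
control `χ_g`, the cross term, `q χ_1` and `v χ_1/n`, and feed `abs_deviation_le` at the selected
parameter. -/
theorem seq_oracle_inequality : ∃ C : ℝ, 0 < C ∧
    ∀ (n : ℕ) (A : Set ℝ) (g : ℝ → Fin n → ℝ) (θ : Fin n → ℝ) (q v : ℝ → ℝ)
      (αh : (Fin n → ℝ) → ℝ) (D₀ d δ γ ε κ k c : ℝ),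
      0 < n → (∀ α ∈ A, ∀ α' ∈ A, g α ≤ g α' ∨ g α' ≤ g α) →
      (∀ α ∈ A, 0 ≤ g α) → (∀ α ∈ A, g α ≤ 1) → 5 ≤ D₀ → (∀ α ∈ A, D₀ ≤ sqNorm (g α)) →
      (∀ α ∈ A, sqNorm (g α) ≤ d * n) → d ≤ 1 → 0 < k → 128 * (k ^ 2 * d) ≤ 1 →
      24576 * k ≤ n → 24576 * c ≤ δ ^ 3 * n → 0 < c → 0 < δ → δ ≤ 1 → 0 < γ → γ ≤ 1 → 0 < ε →
      0 < κ → κ ≤ 1 → ((1 + δ) * ((1 + κ) / (1 + ε)) + δ) * (1 + δ + γ) ≤ 1 - δ →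
      (∀ α ∈ A, 0 ≤ q α) → (∀ α ∈ A, q α ≤ δ) → (∀ α ∈ A, q α ≤ k * (sqNorm (g α) / n) * δ) →
      (∀ α ∈ A, 0 ≤ v α) → (∀ α ∈ A, v α ≤ δ * n) → (∀ α ∈ A, v α ≤ c * sqNorm (g α)) →
      (∀ α ∈ A, 1 ≤ Real.log (sqNorm (g α) / D₀) →
        √(2 * sqNorm (g α)) * √(Real.log (sqNorm (g α) / D₀)) ≤ v α) →
      (∀ α ∈ A, 3 ≤ Real.log (sqNorm (g α) / D₀) →
        (1 + ε) * logEnvelope D₀ (sqNorm (g α)) ≤ v α) →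
      (∀ z, αh z ∈ A) →
      (∀ z, ∀ α ∈ A, (seqDeviation θ (g (αh z)) (q (αh z)) z + sqNorm z) * (1 + v (αh z) / n) ≤
        (seqDeviation θ (g α) (q α) z + sqNorm z) * (1 + v α / n)) →
      ∀ α ∈ A, ∫⁻ z, ENNReal.ofReal (γ * |seqDeviation θ (g (αh z)) (q (αh z)) z|) ∂whiteNoise n ≤
        ENNReal.ofReal ((1 + v α / n) * ((1 + q α) * (∑ i, (1 - g α i) * θ i ^ 2) + v α) +
          C * √D₀ / κ) := by
  obtain ⟨C₁, hC₁, hchi⟩ := exists_chi_envelope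
  refine ⟨1 + 6 * (C₁ + 5000000) + 3 * 30000, by positivity, ?_⟩
  intro n A g θ q v αh D₀ d δ γ ε κ k c hn hch hg0 hg1 hD₀ hgD hgd hd1 hk hkd hkn hcn hc hδ hδ1 hγ hγ1
    hε hκ hκ1 hbal hq0 hqδ hqk hv0 hvδ hvc hV1 hV3 hαh hsel α hα
  have hn0 : (0 : ℝ) < n := by exact_mod_cast hn
  have hchT : ∀ x ∈ g '' A, ∀ y ∈ g '' A, x ≤ y ∨ y ≤ x := by
    rintro _ ⟨a, ha, rfl⟩ _ ⟨b, hb, rfl⟩; exact hch a ha b hb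
  have hT0 : ∀ x ∈ g '' A, 0 ≤ x := by rintro _ ⟨a, ha, rfl⟩; exact hg0 a ha
  have hT1 : ∀ x ∈ g '' A, x ≤ 1 := by rintro _ ⟨a, ha, rfl⟩; exact hg1 a ha
  obtain ⟨Y₁, hY₁m, hY₁a, hY₁b, hY₁i⟩ := hchi n (g '' A) hchT hT0 hT1 D₀ hD₀
    (by rintro _ ⟨a, ha, rfl⟩; exact hgD a ha) κ hκ hκ1
  obtain ⟨Y₂, hY₂m, hY₂, hY₂i⟩ := exists_cross_envelope hchT hT0 hT1 θ
  obtain ⟨Y₃, hY₃m, hY₃a, hY₃b, hY₃i⟩ := exists_total_noise_envelope hn hk hd1 hkd hkn hD₀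
  have hW4 := lintegral_chi_one_pow_four_le hn
  have hcm := measurable_chi (1 : Fin n → ℝ)
  set Y₄ : (Fin n → ℝ) → ENNReal := fun z =>
    ENNReal.ofReal (c / (δ * n) ^ 3) * ENNReal.ofReal (chi 1 z ^ 4) with hY₄
  have hY₄m : Measurable Y₄ := by fun_prop
  have hY₄i : ∫⁻ z, Y₄ z ∂whiteNoise n ≤ ENNReal.ofReal 1 := by
    rw [hY₄, lintegral_const_mul' _ _ ENNReal.ofReal_ne_top]
    calc _ ≤ ENNReal.ofReal (c / (δ * n) ^ 3) * ENNReal.ofReal (24576 * n ^ 2) := by gcongr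
      _ ≤ _ := by
        rw [← ENNReal.ofReal_mul (by positivity)]
        refine ENNReal.ofReal_le_ofReal ?_
        rw [div_mul_eq_mul_div, div_le_one (by positivity)]
        calc c * (24576 * (n : ℝ) ^ 2) = 24576 * c * n ^ 2 := by ring
          _ ≤ δ ^ 3 * n * n ^ 2 := by gcongr
          _ = _ := by ring
  set E : (Fin n → ℝ) → ENNReal := fun z => Y₄ z + 6 * (Y₁ z + Y₂ z) + 3 * Y₃ z with hE
  have hEm : Measurable E := by fun_prop
  obtain ⟨hZi, hZe⟩ := integral_penalized_seqDeviation θ (g α) (q α) (v α)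
  set Z : (Fin n → ℝ) → ℝ := fun z =>
    seqDeviation θ (g α) (q α) z * (1 + v α / n) + v α * (1 + chi 1 z / n) with hZ
  have hZm : Measurable Z := by
    have h1 := measurable_chi (g α)
    have h2 := measurable_dotProduct_right ((1 - g α) * θ)
    simp only [hZ, seqDeviation]
    fun_prop
  have hB0 : 0 ≤ ∑ i, (1 - g α i) * θ i ^ 2 :=
    Finset.sum_nonneg fun i _ => mul_nonneg (sub_nonneg.2 (hg1 α hα i)) (sq_nonneg _)
  have hvn0 : 0 ≤ v α / n := div_nonneg (hv0 α hα) hn0.le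
  have hv0' := hv0 α hα
  have hq0' := hq0 α hα
  have hmain := lintegral_le_of_le_add (μ := whiteNoise n)
    (f := fun z => ENNReal.ofReal (γ * |seqDeviation θ (g (αh z)) (q (αh z)) z|)) hEm hZm hZi
    (by rw [hZe]; positivity) (by
      intro z
      refine ofReal_add_ofReal_neg_le (by positivity) fun t1 t2 t3 t4 => ?_
      set b := αh z with hb
      have hbA : b ∈ A := hαh z
      have hlogT := hgD b hbA
      have hvb := hv0 b hbA
      refine abs_deviation_le (n := n) (B := ∑ i, (1 - g b i) * θ i ^ 2)
        (x := ((1 - g b) * θ) ⬝ᵥ z) (η := chi (g b) z) (W := chi 1 z) (q := q b) (v := v b)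
        (Z := Z z) (δ := δ) (γ := γ) (a := (1 + κ) / (1 + ε)) (E₁ := (Y₁ z).toReal)
        (E₂ := (Y₂ z).toReal) (E₃ := (Y₃ z).toReal) (E₄ := (Y₄ z).toReal) hn0 (hq0 b hbA)
        (hqδ b hbA) hvb (hvδ b hbA) (by rw [chi_one]; linarith [sqNorm_nonneg z]) hδ1 hγ hγ1
        (by positivity) hbal ENNReal.toReal_nonneg ENNReal.toReal_nonneg ENNReal.toReal_nonneg
        ENNReal.toReal_nonneg ?_ ?_ ?_ ?_ ?_
      · rcases lt_or_ge (Real.log (sqNorm (g b) / D₀)) 3 with h | h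
        · have h1 := (ENNReal.ofReal_le_iff_le_toReal t1).1 (hY₁a z (g b) ⟨b, hbA, rfl⟩ h)
          have : 0 ≤ (1 + κ) / (1 + ε) * v b := by positivity
          linarith
        · have h1 := (ENNReal.ofReal_le_iff_le_toReal t1).1 (hY₁b z (g b) ⟨b, hbA, rfl⟩ h)
          have h2 : (1 + κ) * logEnvelope D₀ (sqNorm (g b)) ≤ (1 + κ) / (1 + ε) * v b := by
            rw [div_mul_eq_mul_div, le_div_iff₀ (by positivity)]
            have := hV3 b hbA h
            nlinarith
          linarith
      · have := (ENNReal.ofReal_le_iff_le_toReal t2).1 (hY₂ z (g b) ⟨b, hbA, rfl⟩)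
        linarith
      · have h1 : q b * |chi 1 z| ≤ δ * (k * (sqNorm (g b) / n) * |chi 1 z|) := by
          have := mul_le_mul_of_nonneg_right (hqk b hbA) (abs_nonneg (chi 1 z))
          linarith
        have h0 : 0 ≤ (Y₃ z).toReal := ENNReal.toReal_nonneg
        rcases lt_or_ge (Real.log (sqNorm (g b) / D₀)) 1 with h | h
        · have h2 := (ENNReal.ofReal_le_iff_le_toReal t3).1 (hY₃a z _ hlogT (hgd b hbA) h)
          have h3 : 0 ≤ δ * v b := by positivity
          nlinarith
        · have h2 := (ENNReal.ofReal_le_iff_le_toReal t3).1 (hY₃b z _ hlogT (hgd b hbA) h)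
          have h3 := hV1 b hbA h
          have h4 : k * (sqNorm (g b) / n) * |chi 1 z| ≤ v b + (Y₃ z).toReal := by linarith
          nlinarith [mul_le_mul_of_nonneg_left h4 hδ.le]
      · have h1 : (Y₄ z).toReal = c / (δ * n) ^ 3 * chi 1 z ^ 4 := by
          rw [hY₄]
          simp only
          rw [ENNReal.toReal_mul, ENNReal.toReal_ofReal (by positivity),
            ENNReal.toReal_ofReal (by positivity)]
        rw [h1]
        refine neg_mul_div_le_add_pow_four hn0 hδ hc hvb ((hvc b hbA).trans ?_)
        have h3 : sqNorm (g b) ≤ n := (hgd b hbA).trans (mul_le_of_le_one_left hn0.le hd1)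
        exact mul_le_mul_of_nonneg_left h3 hc.le
      · have hs := hsel z α hα
        have hsq : sqNorm z = chi 1 z + n := by rw [chi_one]; ring
        have hexp : ∀ Δ w : ℝ, (Δ + (chi 1 z + n)) * (1 + w / n) =
            Δ * (1 + w / n) + w * (1 + chi 1 z / n) + (chi 1 z + n) := by
          intro Δ w; field_simp; ring
        rw [hsq, hexp, hexp] at hs
        exact (add_le_add_iff_right _).1 hs)
  refine hmain.trans ?_
  rw [hZe]
  have hEi := lintegral_noise_combination_le hκ hκ1 (Real.one_le_sqrt.2 (by linarith : 1 ≤ D₀))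
    hC₁ hY₁m hY₂m hY₃m hY₄m hY₁i hY₂i hY₃i hY₄i
  refine (add_le_add le_rfl hEi).trans ?_
  rw [← ENNReal.ofReal_add (by positivity) (by positivity)]
  refine ENNReal.ofReal_le_ofReal ?_
  -- The stated risk exceeds the mean of `Z` by exactly this term.
  have : 0 ≤ v α / n * v α := by positivity
  linarith

/-! ### Singular vectors and rotation of the noise. -/

section Spectral

variable {n p : ℕ} (X : Matrix (Fin n) (Fin p) ℝ)

theorem eigVec_dotProduct (j k : Fin p) : eigVec X j ⬝ᵥ eigVec X k = if j = k then 1 else 0 := by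
  have h := orthonormal_iff_ite.1 (gram_isHermitian X).eigenvectorBasis.orthonormal k j
  rw [EuclideanSpace.inner_eq_star_dotProduct] at h
  simp only [star_trivial] at h
  unfold eigVec
  rw [h]
  simp only [eq_comm]

theorem gram_mulVec_eigVec (k : Fin p) : (Xᵀ * X) *ᵥ eigVec X k = eigVal X k • eigVec X k :=
  (gram_isHermitian X).mulVec_eigenvectorBasis k

theorem mulVec_dotProduct_mulVec (u w : Fin p → ℝ) :
    (X *ᵥ u) ⬝ᵥ (X *ᵥ w) = u ⬝ᵥ ((Xᵀ * X) *ᵥ w) := by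
  rw [← mulVec_mulVec, dotProduct_mulVec u, vecMul_transpose]

theorem sum_coeff_smul_eigVec (β : Fin p → ℝ) : ∑ k, coeff X β k • eigVec X k = β := by
  have h := (gram_isHermitian X).eigenvectorBasis.sum_repr' (WithLp.toLp 2 β)
  have h2 := congrArg WithLp.ofLp h
  simp only [WithLp.ofLp_sum, WithLp.ofLp_smul, EuclideanSpace.inner_eq_star_dotProduct,
    star_trivial] at h2
  exact h2

variable {X} in
theorem eigVal_pos (hX : IsUnit (Xᵀ * X)) (k : Fin p) : 0 < eigVal X k := by
  have h1 : eigVal X k = sqNorm (X *ᵥ eigVec X k) := by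
    have h2 : sqNorm (X *ᵥ eigVec X k) = (X *ᵥ eigVec X k) ⬝ᵥ (X *ᵥ eigVec X k) := by
      simp [sqNorm, dotProduct, sq]
    rw [h2, mulVec_dotProduct_mulVec, gram_mulVec_eigVec, dotProduct_smul, eigVec_dotProduct]
    simp
  refine lt_of_le_of_ne (h1 ▸ sqNorm_nonneg _) fun h0 => ?_
  have h3 := gram_mulVec_eigVec X k
  rw [← h0, zero_smul] at h3
  have h4 := Matrix.mulVec_injective_of_isUnit hX (h3.trans (mulVec_zero _).symm)
  have h5 := eigVec_dotProduct X k k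
  rw [h4] at h5
  simp at h5

/-- The left singular vector `X e_k / √λ_k`. -/
noncomputable def singVec (k : Fin p) : Fin n → ℝ := (√(eigVal X k))⁻¹ • (X *ᵥ eigVec X k)

variable {X}

theorem mulVec_eigVec (hX : IsUnit (Xᵀ * X)) (k : Fin p) :
    X *ᵥ eigVec X k = √(eigVal X k) • singVec X k := by
  have := (Real.sqrt_pos.2 (eigVal_pos hX k)).ne'
  rw [singVec, smul_smul, mul_inv_cancel₀ this, one_smul]

theorem singVec_dotProduct (hX : IsUnit (Xᵀ * X)) (j k : Fin p) :
    singVec X j ⬝ᵥ singVec X k = if j = k then 1 else 0 := by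
  unfold singVec
  rw [smul_dotProduct, dotProduct_smul, mulVec_dotProduct_mulVec, gram_mulVec_eigVec,
    dotProduct_smul, eigVec_dotProduct]
  split_ifs with h
  · subst h
    have h1 := (Real.sqrt_pos.2 (eigVal_pos hX j)).ne'
    have h2 := Real.mul_self_sqrt (eigVal_pos hX j).le
    simp only [smul_eq_mul, mul_one]
    nth_rewrite 3 [← h2]
    field_simp
  · simp

theorem mulVec_eq_sum_singVec (hX : IsUnit (Xᵀ * X)) (β : Fin p → ℝ) :
    X *ᵥ β = ∑ k, (√(eigVal X k) * coeff X β k) • singVec X k := by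
  conv_lhs => rw [← sum_coeff_smul_eigVec X β]
  rw [mulVec_sum]
  refine Finset.sum_congr rfl fun k _ => ?_
  rw [mulVec_smul, mulVec_eigVec hX, smul_smul, mul_comm]

theorem specFun_mulVec (h : ℝ → ℝ) (w : Fin p → ℝ) :
    specFun X h *ᵥ w = ∑ k, (h (eigVal X k) * coeff X w k) • eigVec X k := by
  unfold specFun coeff
  rw [sum_mulVec]
  refine Finset.sum_congr rfl fun k _ => ?_
  rw [smul_mulVec, vecMulVec_mulVec, op_smul_eq_smul, smul_smul, dotProduct_comm w]

theorem trace_specFun (h : ℝ → ℝ) : (specFun X h).trace = ∑ k, h (eigVal X k) := by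
  unfold specFun
  rw [trace_sum]
  refine Finset.sum_congr rfl fun k _ => ?_
  rw [trace_smul, trace_vecMulVec, eigVec_dotProduct]
  simp

theorem trace_specFun_sq (h : ℝ → ℝ) : (specFun X h ^ 2).trace = ∑ k, h (eigVal X k) ^ 2 := by
  have hT : (specFun X h)ᵀ = specFun X h := by
    unfold specFun
    rw [transpose_sum]
    exact Finset.sum_congr rfl fun k _ => by rw [transpose_smul, transpose_vecMulVec]
  rw [sq]
  conv_lhs => enter [1, 1]; unfold specFun
  rw [Finset.sum_mul, trace_sum]
  refine Finset.sum_congr rfl fun k _ => ?_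
  rw [smul_mul_assoc, trace_smul, vecMulVec_mul, trace_vecMulVec, ← mulVec_transpose, hT,
    specFun_mulVec, dotProduct_sum]
  simp_rw [dotProduct_smul, coeff, eigVec_dotProduct]
  simp [sq]

theorem coeff_mle (hX : IsUnit (Xᵀ * X)) (Y : Fin n → ℝ) (k : Fin p) :
    √(eigVal X k) * coeff X (mle X Y) k = singVec X k ⬝ᵥ Y := by
  have hl := eigVal_pos hX k
  have h1 : (Xᵀ * X) *ᵥ mle X Y = Xᵀ *ᵥ Y := by
    unfold mle
    rw [mulVec_mulVec, mul_nonsing_inv _ ((isUnit_iff_isUnit_det _).1 hX), one_mulVec]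
  have h2 : eigVal X k * coeff X (mle X Y) k = (X *ᵥ eigVec X k) ⬝ᵥ Y := by
    unfold coeff
    calc _ = (eigVal X k • eigVec X k) ⬝ᵥ mle X Y := by
          rw [smul_dotProduct, dotProduct_comm, smul_eq_mul]
      _ = ((Xᵀ * X) *ᵥ eigVec X k) ⬝ᵥ mle X Y := by rw [gram_mulVec_eigVec]
      _ = eigVec X k ⬝ᵥ ((Xᵀ * X) *ᵥ mle X Y) := by
          rw [dotProduct_mulVec, ← mulVec_transpose, transpose_mul, transpose_transpose]
      _ = eigVec X k ⬝ᵥ (Xᵀ *ᵥ Y) := by rw [h1]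
      _ = _ := by rw [dotProduct_mulVec, vecMul_transpose]
  rw [mulVec_eigVec hX, smul_dotProduct, smul_eq_mul] at h2
  have h3 := Real.mul_self_sqrt hl.le
  have h4 := (Real.sqrt_pos.2 hl).ne'
  exact mul_left_cancel₀ h4 (by rw [← mul_assoc, h3, h2])

theorem sqNorm_eq_dotProduct {m : ℕ} (v : Fin m → ℝ) : sqNorm v = v ⬝ᵥ v := by
  simp [sqNorm, dotProduct, sq]

/-- The fit multiplies the component of `Y` along the `k`-th left singular vector by `H`, so that
the residual keeps `(1 - H)² = 1 - G` of its energy. -/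
theorem sqNorm_residual (hX : IsUnit (Xᵀ * X)) (H : ℝ → ℝ → ℝ) (α : ℝ) (Y : Fin n → ℝ) :
    sqNorm (Y - X *ᵥ betaHat H X α Y) =
      sqNorm Y - ∑ k, G H α (eigVal X k) * (singVec X k ⬝ᵥ Y) ^ 2 := by
  have h1 : X *ᵥ betaHat H X α Y =
      ∑ k, (H α (eigVal X k) * (singVec X k ⬝ᵥ Y)) • singVec X k := by
    unfold betaHat
    rw [specFun_mulVec, mulVec_sum]
    refine Finset.sum_congr rfl fun k _ => ?_
    rw [mulVec_smul, mulVec_eigVec hX, smul_smul, ← coeff_mle hX]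
    congr 1; ring
  have h2 : ∀ a : Fin p → ℝ, ∀ j, (∑ k, a k • singVec X k) ⬝ᵥ singVec X j = a j := by
    intro a j
    rw [sum_dotProduct]
    simp_rw [smul_dotProduct, singVec_dotProduct hX]
    simp
  rw [h1, sqNorm_eq_dotProduct, sqNorm_eq_dotProduct, sub_dotProduct, dotProduct_sub,
    dotProduct_sub]
  simp_rw [dotProduct_sum, dotProduct_smul, h2, sum_dotProduct, smul_dotProduct, smul_eq_mul,
    dotProduct_comm Y, G]
  simp only [← Finset.sum_sub_distrib]
  rw [sub_sub, sub_right_inj, ← Finset.sum_add_distrib]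
  exact Finset.sum_congr rfl fun k _ => by ring

end Spectral

/-- Coordinates in an orthonormal basis extending `f`; white noise is invariant under isometries.
The same map is given twice: `U` for the change of variables, `L` for linear algebra. -/
theorem exists_rotation {n p : ℕ} (hp : p ≤ n) {f : Fin p → Fin n → ℝ}
    (hf : ∀ j k, f j ⬝ᵥ f k = if j = k then 1 else 0) :
    ∃ (U : (Fin n → ℝ) ≃ᵐ (Fin n → ℝ)) (L : (Fin n → ℝ) →ₗ[ℝ] (Fin n → ℝ)),
      MeasurePreserving U (whiteNoise n) (whiteNoise n) ∧ (∀ x, U x = L x) ∧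
      (∀ x, sqNorm (L x) = sqNorm x) ∧ (∀ x k, L x (Fin.castLE hp k) = f k ⬝ᵥ x) ∧
      ∀ k, L (f k) = Pi.single (Fin.castLE hp k) 1 := by
  classical
  set v : Fin n → EuclideanSpace ℝ (Fin n) :=
    fun i => if h : i.1 < p then WithLp.toLp 2 (f ⟨i.1, h⟩) else 0 with hv
  have hvk : ∀ k, v (Fin.castLE hp k) = WithLp.toLp 2 (f k) := by intro k; simp [hv]
  have horth : Orthonormal ℝ ((Set.range (Fin.castLE hp)).domRestrict v) := by
    rw [orthonormal_iff_ite]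
    rintro ⟨_, j, rfl⟩ ⟨_, k, rfl⟩
    simp only [Set.domRestrict_apply, hvk, EuclideanSpace.inner_eq_star_dotProduct, star_trivial]
    rw [hf]
    have : (⟨Fin.castLE hp j, Set.mem_range_self j⟩ : Set.range (Fin.castLE hp)) =
        ⟨Fin.castLE hp k, Set.mem_range_self k⟩ ↔ k = j :=
      ⟨fun h => (Fin.castLE_injective hp (congrArg Subtype.val h)).symm, fun h => by subst h; rfl⟩
    exact (if_congr this rfl rfl).symm
  obtain ⟨b, hb⟩ := horth.exists_orthonormalBasis_extension_of_card_eq (by simp)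
  have hbk : ∀ k, b (Fin.castLE hp k) = WithLp.toLp 2 (f k) :=
    fun k => (hb _ ⟨k, rfl⟩).trans (hvk k)
  set U : (Fin n → ℝ) ≃ᵐ (Fin n → ℝ) := ((MeasurableEquiv.toLp 2 (Fin n → ℝ)).trans
    b.repr.toHomeomorph.toMeasurableEquiv).trans (MeasurableEquiv.toLp 2 (Fin n → ℝ)).symm with hU
  have hUx : ∀ x, U x = (b.repr (WithLp.toLp 2 x)).ofLp := fun x => rfl
  set L : (Fin n → ℝ) →ₗ[ℝ] (Fin n → ℝ) := (WithLp.linearEquiv 2 ℝ (Fin n → ℝ)).toLinearMap ∘ₗ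
    b.repr.toLinearEquiv.toLinearMap ∘ₗ (WithLp.linearEquiv 2 ℝ (Fin n → ℝ)).symm.toLinearMap with hL
  have hLx : ∀ x, L x = (b.repr (WithLp.toLp 2 x)).ofLp := fun x => rfl
  refine ⟨U, L, ⟨U.measurable, ?_⟩, fun x => rfl, ?_, ?_, ?_⟩
  · have h1 : (whiteNoise n).map (WithLp.toLp 2) = stdGaussian (EuclideanSpace ℝ (Fin n)) :=
      map_pi_eq_stdGaussian
    have h2 : (whiteNoise n) = (stdGaussian (EuclideanSpace ℝ (Fin n))).map WithLp.ofLp := by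
      rw [← h1, Measure.map_map (WithLp.measurable_ofLp 2 _) (WithLp.measurable_toLp 2 _)]
      exact (Measure.map_id).symm
    have h3 : ⇑U = WithLp.ofLp ∘ b.repr ∘ WithLp.toLp 2 := rfl
    rw [h3, ← Measure.map_map (WithLp.measurable_ofLp 2 _)
      (b.repr.continuous.measurable.comp (WithLp.measurable_toLp 2 _)),
      ← Measure.map_map b.repr.continuous.measurable (WithLp.measurable_toLp 2 _), h1,
      stdGaussian_map, ← h2]
  · intro x
    have h := b.repr.norm_map (WithLp.toLp 2 x)
    have h2 : ∀ y : EuclideanSpace ℝ (Fin n), sqNorm y.ofLp = ‖y‖ ^ 2 := by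
      intro y; rw [EuclideanSpace.real_norm_sq_eq, sqNorm]
    rw [hLx, h2, h, ← h2]
  · intro x k
    rw [hLx, b.repr_apply_apply, hbk, EuclideanSpace.inner_eq_star_dotProduct]
    simp [dotProduct_comm]
  · intro k
    rw [hLx, ← hbk, b.repr_self]
    rfl

/-- Extension by zero of a vector indexed by `Fin p` to a vector indexed by `Fin n`. -/
noncomputable def zeroExtend {n p : ℕ} (hp : p ≤ n) (w : Fin p → ℝ) : Fin n → ℝ :=
  Function.extend (Fin.castLE hp) w 0

section ZeroExtend

variable {n p : ℕ} (hp : p ≤ n)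

theorem zeroExtend_castLE (w : Fin p → ℝ) (k : Fin p) :
    zeroExtend hp w (Fin.castLE hp k) = w k :=
  (Fin.castLE_injective hp).extend_apply _ _ _

theorem zeroExtend_of_notMem (w : Fin p → ℝ) {i : Fin n} (hi : i ∉ Set.range (Fin.castLE hp)) :
    zeroExtend hp w i = 0 :=
  Function.extend_apply' _ _ _ fun ⟨k, hk⟩ => hi ⟨k, hk⟩

theorem zeroExtend_mono {w w' : Fin p → ℝ} (h : w ≤ w') : zeroExtend hp w ≤ zeroExtend hp w' := by
  intro i
  by_cases hi : i ∈ Set.range (Fin.castLE hp)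
  · obtain ⟨k, rfl⟩ := hi
    simpa only [zeroExtend_castLE] using h k
  · rw [zeroExtend_of_notMem hp w hi, zeroExtend_of_notMem hp w' hi]

theorem zeroExtend_nonneg {w : Fin p → ℝ} (h : 0 ≤ w) : 0 ≤ zeroExtend hp w := by
  intro i
  by_cases hi : i ∈ Set.range (Fin.castLE hp)
  · obtain ⟨k, rfl⟩ := hi
    rw [zeroExtend_castLE]; exact h k
  · rw [zeroExtend_of_notMem hp w hi]; exact le_rfl

theorem zeroExtend_le_one {w : Fin p → ℝ} (h : w ≤ 1) : zeroExtend hp w ≤ 1 := by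
  intro i
  by_cases hi : i ∈ Set.range (Fin.castLE hp)
  · obtain ⟨k, rfl⟩ := hi
    rw [zeroExtend_castLE]; exact h k
  · rw [zeroExtend_of_notMem hp w hi]; exact zero_le_one

theorem sum_zeroExtend_mul (w : Fin p → ℝ) (a : Fin n → ℝ) :
    ∑ i, zeroExtend hp w i * a i = ∑ k, w k * a (Fin.castLE hp k) := by
  refine (Fintype.sum_of_injective _ (Fin.castLE_injective hp) _ _ (fun i hi => ?_)
    fun k => ?_).symm
  · rw [zeroExtend_of_notMem hp w hi, zero_mul]
  · rw [zeroExtend_castLE]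

theorem sum_mul_zeroExtend_sq (w : Fin p → ℝ) (a : Fin n → ℝ) :
    ∑ i, a i * zeroExtend hp w i ^ 2 = ∑ k, a (Fin.castLE hp k) * w k ^ 2 := by
  refine (Fintype.sum_of_injective _ (Fin.castLE_injective hp) _ _ (fun i hi => ?_)
    fun k => ?_).symm
  · rw [zeroExtend_of_notMem hp w hi]; ring
  · rw [zeroExtend_castLE]

theorem sum_zeroExtend (w : Fin p → ℝ) : ∑ i, zeroExtend hp w i = ∑ k, w k := by
  simpa using sum_zeroExtend_mul hp w 1

theorem sqNorm_zeroExtend (w : Fin p → ℝ) : sqNorm (zeroExtend hp w) = ∑ k, w k ^ 2 := by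
  simpa [sqNorm] using sum_mul_zeroExtend_sq hp w 1

theorem zeroExtend_eq_sum (w : Fin p → ℝ) :
    zeroExtend hp w = ∑ k, w k • Pi.single (Fin.castLE hp k) (1 : ℝ) := by
  ext i
  rw [Finset.sum_apply]
  simp only [Pi.smul_apply, smul_eq_mul]
  by_cases hi : i ∈ Set.range (Fin.castLE hp)
  · obtain ⟨k, rfl⟩ := hi
    rw [zeroExtend_castLE, Finset.sum_eq_single k]
    · simp
    · intro j _ hj
      rw [Pi.single_eq_of_ne fun h => hj (Fin.castLE_injective hp h).symm, mul_zero]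
    · simp
  · rw [zeroExtend_of_notMem hp w hi, Finset.sum_eq_zero]
    intro j _
    rw [Pi.single_eq_of_ne fun h => hi ⟨j, h.symm⟩, mul_zero]

end ZeroExtend

/-! ### Reduction of the regression model to the sequence model. -/

/-- The normalization means `(1 + q) ∑ g = q n`, so the constants produced by centering `z²` cancel.
-/
theorem seqDeviation_add_sqNorm {n : ℕ} (hn : 0 < n) (θ g z : Fin n → ℝ) {q : ℝ}
    (hq : (1 + q) * (1 - (∑ i, g i) / n) = 1) :
    seqDeviation θ g q z + sqNorm z = (1 + q) * ∑ i, (1 - g i) * (θ + z) i ^ 2 := by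
  have hn0 : (n : ℝ) ≠ 0 := by exact_mod_cast hn.ne'
  have h1 : ∑ i, (1 - g i) * (θ + z) i ^ 2 = ∑ i, (1 - g i) * θ i ^ 2 +
      2 * ((1 - g) * θ) ⬝ᵥ z - chi g z + sqNorm z - ∑ i, g i := by
    unfold dotProduct chi sqNorm
    rw [Finset.mul_sum, ← Finset.sum_add_distrib, ← Finset.sum_sub_distrib,
      ← Finset.sum_add_distrib, ← Finset.sum_sub_distrib]
    refine Finset.sum_congr rfl fun i _ => ?_
    simp only [Pi.add_apply, Pi.mul_apply, Pi.sub_apply, Pi.one_apply]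
    ring
  have h2 : (1 + q) * ∑ i, g i = q * n := by
    have : (1 + q) * (1 - (∑ i, g i) / n) * n = 1 * n := by rw [hq]
    field_simp at this
    linarith
  rw [h1, seqDeviation, chi_one]
  linear_combination h2

section Reduction

variable {n p : ℕ} {X : Matrix (Fin n) (Fin p) ℝ}

theorem mul_sigmaSqHat_eq (hn : 0 < n) (hp : p ≤ n) (hX : IsUnit (Xᵀ * X)) (H : ℝ → ℝ → ℝ) (α : ℝ)
    (hG : 1 - (∑ k, G H α (eigVal X k)) / n ≠ 0) {σ : ℝ} (hσ : 0 < σ) (β : Fin p → ℝ)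
    {L : (Fin n → ℝ) →ₗ[ℝ] (Fin n → ℝ)} (hL : ∀ x, sqNorm (L x) = sqNorm x)
    (hLk : ∀ x k, L x (Fin.castLE hp k) = singVec X k ⬝ᵥ x)
    (hLs : ∀ k, L (singVec X k) = Pi.single (Fin.castLE hp k) 1) (ξ : Fin n → ℝ) :
    n * sigmaSqHat H X α (X *ᵥ β + σ • ξ) =
      σ ^ 2 * (seqDeviation (zeroExtend hp fun k => √(eigVal X k) * coeff X β k / σ)
        (zeroExtend hp fun k => G H α (eigVal X k)) (q H X α) (L ξ) + sqNorm (L ξ)) := by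
  have hn0 : (n : ℝ) ≠ 0 := by exact_mod_cast hn.ne'
  set θ := zeroExtend hp fun k => √(eigVal X k) * coeff X β k / σ with hθ
  set g := zeroExtend hp fun k => G H α (eigVal X k) with hg
  have hLβ : L (X *ᵥ β) = σ • θ := by
    rw [mulVec_eq_sum_singVec hX, map_sum, hθ, zeroExtend_eq_sum, Finset.smul_sum]
    refine Finset.sum_congr rfl fun k _ => ?_
    rw [map_smul, hLs, smul_smul]
    congr 1; field_simp
  have hLY : L (X *ᵥ β + σ • ξ) = σ • (θ + L ξ) := by
    rw [map_add, hLβ, map_smul, smul_add]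
  set y := θ + L ξ with hy
  have hres : sqNorm (X *ᵥ β + σ • ξ - X *ᵥ betaHat H X α (X *ᵥ β + σ • ξ)) =
      σ ^ 2 * ∑ i, (1 - g i) * y i ^ 2 := by
    rw [sqNorm_residual hX, ← hL, hLY]
    simp_rw [← hLk, hLY]
    have h1 : ∑ k, G H α (eigVal X k) * (σ • y) (Fin.castLE hp k) ^ 2 =
        ∑ i, g i * (σ • y) i ^ 2 :=
      (sum_zeroExtend_mul hp (fun k => G H α (eigVal X k)) fun i => (σ • y) i ^ 2).symm
    rw [h1, sqNorm, ← Finset.sum_sub_distrib, Finset.mul_sum]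
    refine Finset.sum_congr rfl fun i _ => ?_
    simp only [Pi.smul_apply, smul_eq_mul]
    ring
  have hq : (1 + q H X α) = (1 - (∑ k, G H α (eigVal X k)) / n)⁻¹ := by unfold q; ring
  have hsum : ∑ i, g i = ∑ k, G H α (eigVal X k) := sum_zeroExtend hp _
  rw [seqDeviation_add_sqNorm hn θ g (L ξ) (by rw [hq, hsum, inv_mul_cancel₀ hG]), sigmaSqHat, hres,
    trace_specFun, trace_specFun_sq, hq]
  have hGs : 2 * ∑ k, H α (eigVal X k) - ∑ k, H α (eigVal X k) ^ 2 = ∑ k, G H α (eigVal X k) := by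
    rw [Finset.mul_sum, ← Finset.sum_sub_distrib]
    rfl
  rw [hGs, hy]
  field_simp

theorem G_mem_Icc {H : ℝ → ℝ → ℝ} (hH : IsOrderedRegularization H) {α l : ℝ} (hα : 0 < α)
    (hl : 0 ≤ l) : 0 ≤ G H α l ∧ G H α l ≤ 1 := by
  have h0 := hH.nonneg α hα l hl
  have h1 := hH.le_one α hα l hl
  unfold G
  constructor <;> nlinarith

theorem G_ordered {H : ℝ → ℝ → ℝ} (hH : IsOrderedRegularization H) {α α' : ℝ} (hα : 0 < α)
    (hα' : 0 < α') : (∀ l ≥ 0, G H α l ≤ G H α' l) ∨ (∀ l ≥ 0, G H α' l ≤ G H α l) := by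
  have mono : ∀ a > 0, ∀ b > 0, (∀ l ≥ 0, H a l ≤ H b l) → ∀ l ≥ 0, G H a l ≤ G H b l := by
    intro a ha b hb h l hl
    have h1 := h l hl
    have h2 := hH.le_one a ha l hl
    have h3 := hH.le_one b hb l hl
    unfold G
    nlinarith
  exact (hH.ordered α hα α' hα').imp (mono α hα α' hα') (mono α' hα' α hα)

/-- `seq_oracle_inequality` with `g` the `G_α(λ_k)` padded by zeros and `θ_k = √λ_k ⟨β, e_k⟩/σ`. As
`1 - G = (1 - H)²`, `σ²` times the sequence bias is the bias in `risk`. The rotation does not depend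
on `α`, so the selector carries over by composition with its inverse. -/
theorem expectedDeviation_le_of_bounds : ∃ C : ℝ, 0 < C ∧
    ∀ (n p : ℕ) (X : Matrix (Fin n) (Fin p) ℝ) (H : ℝ → ℝ → ℝ) (aMin aMax ε : ℝ)
      (d δ γ κ k c σ : ℝ) (β : Fin p → ℝ) (αHat : (Fin n → ℝ) → ℝ),
      0 < n → p ≤ n → IsUnit (Xᵀ * X) → IsOrderedRegularization H → 0 < aMin →
      5 ≤ D H X aMax → (∀ α ∈ Icc aMin aMax, D H X aMax ≤ D H X α) →
      (∀ α ∈ Icc aMin aMax, D H X α ≤ d * n) → d ≤ 1 → 0 < k → 128 * (k ^ 2 * d) ≤ 1 →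
      24576 * k ≤ n → 24576 * c ≤ δ ^ 3 * n → 0 < c → 0 < δ → δ ≤ 1 → 0 < γ → γ ≤ 1 → 0 < ε →
      0 < κ → κ ≤ 1 → ((1 + δ) * ((1 + κ) / (1 + ε)) + δ) * (1 + δ + γ) ≤ 1 - δ →
      (∀ α ∈ Icc aMin aMax, 1 - (∑ k, G H α (eigVal X k)) / n ≠ 0) →
      (∀ α ∈ Icc aMin aMax, 0 ≤ q H X α) → (∀ α ∈ Icc aMin aMax, q H X α ≤ δ) →
      (∀ α ∈ Icc aMin aMax, q H X α ≤ k * (D H X α / n) * δ) →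
      (∀ α ∈ Icc aMin aMax, V H X aMax ε α ≤ δ * n) →
      (∀ α ∈ Icc aMin aMax, V H X aMax ε α ≤ c * D H X α) →
      (∀ α ∈ Icc aMin aMax, 1 ≤ Real.log (D H X α / D H X aMax) →
        √(2 * D H X α) * √(Real.log (D H X α / D H X aMax)) ≤ V H X aMax ε α) →
      (∀ α ∈ Icc aMin aMax, 3 ≤ Real.log (D H X α / D H X aMax) →
        (1 + ε) * logEnvelope (D H X aMax) (D H X α) ≤ V H X aMax ε α) →
      0 < σ → IsSelector H X aMin aMax ε αHat →
      ∀ α ∈ Icc aMin aMax, expectedDeviation H X αHat σ β ≤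
        ENNReal.ofReal ((risk H X aMax ε σ β α + C * (σ ^ 2 * √(D H X aMax)) / κ) / γ) := by
  obtain ⟨C, hC, hseq⟩ := seq_oracle_inequality
  refine ⟨C, hC, ?_⟩
  intro n p X H aMin aMax ε d δ γ κ k c σ β αHat hn hp hX hH haMin hD5 hDge hDle hd1 hk hkd hkn hcn hc
    hδ hδ1 hγ hγ1 hε hκ hκ1 hbal hG hq0 hqδ hqk hVδ hVc hV1 hV3 hσ hsel α hα
  have hn0 : (0 : ℝ) < n := by exact_mod_cast hn
  obtain ⟨U, L, hUmp, hUL, hL, hLk, hLs⟩ := exists_rotation hp (singVec_dotProduct hX)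
  have hl : ∀ k, 0 ≤ eigVal X k := fun k => (eigVal_pos hX k).le
  have hpos : ∀ α ∈ Icc aMin aMax, 0 < α := fun α hα => haMin.trans_le hα.1
  set θ := zeroExtend hp fun k => √(eigVal X k) * coeff X β k / σ with hθ
  set g : ℝ → Fin n → ℝ := fun α => zeroExtend hp fun k => G H α (eigVal X k) with hg
  have hgD : ∀ α, sqNorm (g α) = D H X α := fun α => sqNorm_zeroExtend hp _
  have hsig : ∀ α ∈ Icc aMin aMax, ∀ ξ, n * sigmaSqHat H X α (X *ᵥ β + σ • ξ) =
      σ ^ 2 * (seqDeviation θ (g α) (q H X α) (L ξ) + sqNorm (L ξ)) := fun α hα ξ =>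
    mul_sigmaSqHat_eq hn hp hX H α (hG α hα) hσ β hL hLk hLs ξ
  have hLU : ∀ z, L (U.symm z) = z := fun z => by rw [← hUL, MeasurableEquiv.apply_symm_apply]
  have hV0 : ∀ α, 0 ≤ V H X aMax ε α := fun α => by unfold V; positivity
  have main := hseq n (Icc aMin aMax) g θ (q H X) (V H X aMax ε)
    (fun z => αHat (X *ᵥ β + σ • U.symm z)) (D H X aMax) d δ γ ε κ k c hn ?_ ?_ ?_ hD5 ?_ ?_ hd1 hk
    hkd hkn hcn hc hδ hδ1 hγ hγ1 hε hκ hκ1 hbal hq0 hqδ ?_ (fun α _ => hV0 α) hVδ ?_ ?_ ?_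
    (fun z => (hsel _).1) ?_ α hα
  · have hexp : expectedDeviation H X αHat σ β = ∫⁻ z, ENNReal.ofReal (σ ^ 2 / γ) *
        ENNReal.ofReal (γ * |seqDeviation θ (g (αHat (X *ᵥ β + σ • U.symm z)))
          (q H X (αHat (X *ᵥ β + σ • U.symm z))) z|) ∂whiteNoise n := by
      rw [← hUmp.lintegral_comp_emb U.measurableEmbedding]
      unfold expectedDeviation
      refine lintegral_congr fun ξ => ?_
      rw [MeasurableEquiv.symm_apply_apply, hUL, ← ENNReal.ofReal_mul (by positivity)]
      congr 1
      have h1 := hsig _ (hsel (X *ᵥ β + σ • ξ)).1 ξ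
      have h2 : sqNorm (σ • ξ) = σ ^ 2 * sqNorm (L ξ) := by
        rw [hL]; simp [sqNorm, mul_pow, Finset.mul_sum]
      rw [h2, ← abs_of_pos hn0, ← abs_mul, abs_of_pos hn0, mul_sub, h1, mul_div_cancel₀ _ hn0.ne',
        mul_add, add_sub_cancel_right, abs_mul, abs_of_pos (by positivity : 0 < σ ^ 2)]
      field_simp
    rw [hexp, lintegral_const_mul' _ _ ENNReal.ofReal_ne_top]
    refine (mul_le_mul' le_rfl main).trans ?_
    rw [← ENNReal.ofReal_mul (by positivity)]
    refine ENNReal.ofReal_le_ofReal (le_of_eq ?_)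
    have hB : σ ^ 2 * ∑ i, (1 - g α i) * θ i ^ 2 =
        ∑ k, (1 - H α (eigVal X k)) ^ 2 * eigVal X k * coeff X β k ^ 2 := by
      rw [hθ, sum_mul_zeroExtend_sq hp _ fun i => 1 - g α i, Finset.mul_sum]
      refine Finset.sum_congr rfl fun k _ => ?_
      simp only [hg, zeroExtend_castLE, G]
      rw [div_pow, mul_pow, Real.sq_sqrt (hl k)]
      field_simp
      ring
    unfold risk
    rw [← hB]
    field_simp
  · intro a ha b hb
    exact (G_ordered hH (hpos a ha) (hpos b hb)).imp
      (fun h => zeroExtend_mono hp fun k => h _ (hl k))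
      (fun h => zeroExtend_mono hp fun k => h _ (hl k))
  · exact fun a ha => zeroExtend_nonneg hp fun k => (G_mem_Icc hH (hpos a ha) (hl k)).1
  · exact fun a ha => zeroExtend_le_one hp fun k => (G_mem_Icc hH (hpos a ha) (hl k)).2
  · exact fun a ha => (hgD a).symm ▸ hDge a ha
  · exact fun a ha => (hgD a).symm ▸ hDle a ha
  · exact fun a ha => (hgD a).symm ▸ hqk a ha
  · exact fun a ha => (hgD a).symm ▸ hVc a ha
  · exact fun a ha => (hgD a).symm ▸ hV1 a ha
  · exact fun a ha => (hgD a).symm ▸ hV3 a ha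
  · intro z a ha
    have h1 := (hsel (X *ᵥ β + σ • U.symm z)).2 ha
    simp only [Set.mem_ofPred_eq] at h1
    have h2 := mul_le_mul_of_nonneg_left h1 hn0.le
    rw [← mul_assoc, ← mul_assoc, hsig _ (hsel _).1, hsig a ha, hLU, mul_assoc, mul_assoc] at h2
    exact le_of_mul_le_mul_left h2 (by positivity)

end Reduction

/-! ### Bounds for the penalty and choice of the constants. -/

theorem one_le_Q_div_sq {ε : ℝ} (hε : 0 < ε) (hε1 : ε ≤ 1) : 1 ≤ Q / ε ^ 2 := by
  have h2 : (1 : ℝ) < √2 := Real.lt_sqrt_of_sq_lt (by norm_num)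
  have h3 : √2 ≤ (2 : ℝ) := by rw [Real.sqrt_le_left (by norm_num)]; norm_num
  have h4 : (√2 - 1) ^ 2 ≤ (1 : ℝ) := by nlinarith
  have h5 : 0 < (√2 - 1) ^ 2 := by have : 0 < √2 - 1 := by linarith
                                   positivity
  rw [one_le_div (by positivity), Q, le_div_iff₀ h5]
  nlinarith

section Envelope

variable {n p : ℕ} (H : ℝ → ℝ → ℝ) (X : Matrix (Fin n) (Fin p) ℝ)

theorem logEnvelope_le_V {aMax ε α : ℝ} (hε : 0 < ε) (hε1 : ε ≤ 1)
    (h : 1 ≤ Real.log (D H X α / D H X aMax)) :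
    (1 + ε) * logEnvelope (D H X aMax) (D H X α) ≤ V H X aMax ε α := by
  unfold V logEnvelope
  set u := Real.log (D H X α / D H X aMax)
  have hQ := one_le_Q_div_sq hε hε1
  have h0 : 0 ≤ Real.log u := Real.log_nonneg h
  have h1 : Real.log u ≤ Real.log (Q / ε ^ 2 * u) := by
    apply Real.log_le_log (by linarith)
    nlinarith
  rw [← mul_assoc]
  gcongr
  nlinarith

theorem sqrt_log_le_V {aMax ε α : ℝ} (hε : 0 < ε) (hε1 : ε ≤ 1)
    (h : 1 ≤ Real.log (D H X α / D H X aMax)) :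
    √(2 * D H X α) * √(Real.log (D H X α / D H X aMax)) ≤ V H X aMax ε α := by
  refine le_trans ?_ (logEnvelope_le_V H X hε hε1 h)
  unfold logEnvelope
  have h0 := Real.log_nonneg h
  have h1 : √(2 * D H X α) * √(Real.log (D H X α / D H X aMax)) ≤
      √(2 * D H X α) * √(Real.log (D H X α / D H X aMax) +
        2 * Real.log (Real.log (D H X α / D H X aMax))) := by
    gcongr
    linarith
  refine h1.trans (le_mul_of_one_le_left (by positivity) (by linarith))

/-- A crude bound from `log x ≤ x`; it serves to deduce smallness of `V/n` from that of `D/n`. -/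
theorem V_le_mul_D {aMax ε α : ℝ} (hε : 0 < ε) (hε1 : ε ≤ 1) (hD : 1 ≤ D H X aMax)
    (h : D H X aMax ≤ D H X α) : V H X aMax ε α ≤ 4 * (1 + 4 * (Q / ε ^ 2)) * D H X α := by
  have hQ := one_le_Q_div_sq hε hε1
  unfold V
  set u := Real.log (D H X α / D H X aMax)
  have hD0 : 0 < D H X aMax := by linarith
  have hDα : 0 < D H X α := by linarith
  have hu : u ≤ D H X α := by
    refine (Real.log_le_self (by positivity)).trans ?_
    rw [div_le_iff₀ hD0]
    nlinarith
  have hu0 : 0 ≤ u := Real.log_nonneg (by rwa [one_le_div hD0])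
  have hl : Real.log (Q / ε ^ 2 * u) ≤ Q / ε ^ 2 * D H X α :=
    (Real.log_le_self (by positivity)).trans (by gcongr)
  set m := 1 + 4 * (Q / ε ^ 2) with hm
  have h1 : u + 2 * (1 + ε) * Real.log (Q / ε ^ 2 * u) ≤ m * D H X α := by
    have : 2 * (1 + ε) * Real.log (Q / ε ^ 2 * u) ≤ 4 * (Q / ε ^ 2 * D H X α) := by
      have h0 : 0 ≤ Q / ε ^ 2 * D H X α := by positivity
      calc _ ≤ 2 * (1 + ε) * (Q / ε ^ 2 * D H X α) := by gcongr
        _ ≤ _ := by gcongr; linarith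
    rw [hm]; linarith
  have hm1 : 1 ≤ m := by linarith
  have h2 : √(2 * D H X α) * √(u + 2 * (1 + ε) * Real.log (Q / ε ^ 2 * u)) ≤
      2 * m * D H X α := by
    rw [← Real.sqrt_mul (by positivity), Real.sqrt_le_left (by positivity)]
    calc 2 * D H X α * (u + 2 * (1 + ε) * Real.log (Q / ε ^ 2 * u)) ≤
          2 * D H X α * (m * D H X α) := by gcongr
      _ = 2 * m * D H X α ^ 2 := by ring
      _ ≤ (2 * m) ^ 2 * D H X α ^ 2 := by gcongr; nlinarith
      _ = _ := by ring
  have h3 : 0 ≤ √(2 * D H X α) * √(u + 2 * (1 + ε) * Real.log (Q / ε ^ 2 * u)) := by positivity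
  rw [mul_assoc]
  nlinarith

theorem q_bounds {α K : ℝ} (hn : 0 < n) (hS : 0 ≤ ∑ k, G H α (eigVal X k))
    (hK : ∑ k, G H α (eigVal X k) ≤ K * D H X α) (hKn : 2 * (K * (D H X α / n)) ≤ 1) :
    1 - (∑ k, G H α (eigVal X k)) / n ≠ 0 ∧ 0 ≤ q H X α ∧ q H X α ≤ 2 * (K * (D H X α / n)) := by
  have hn0 : (0 : ℝ) < n := by exact_mod_cast hn
  set x := (∑ k, G H α (eigVal X k)) / n with hx
  have hx0 : 0 ≤ x := by positivity
  have hxK : x ≤ K * (D H X α / n) := by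
    rw [hx, div_le_iff₀ hn0]
    have : K * (D H X α / n) * n = K * D H X α := by field_simp
    linarith
  have hx1 : 0 < 1 - x := by linarith
  have hq : q H X α = x / (1 - x) := by unfold q; rw [← hx]; field_simp; ring
  refine ⟨hx1.ne', ?_, ?_⟩
  · rw [hq]; positivity
  · rw [hq, div_le_iff₀ hx1]
    nlinarith

end Envelope

/-- With a relative slack `δ` proportional to `ε - γ - γ ε`, the envelope with factor `1 + κ` is
still dominated by the one with factor `1 + ε`. -/
theorem envelope_balance {ε γ : ℝ} (hε : 0 < ε) (hε1 : ε ≤ 1) (hγ : 0 < γ)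
    (hτ : 0 < ε - γ - γ * ε) :
    ((1 + (ε - γ - γ * ε) / 16) * ((1 + (ε - γ - γ * ε) / 4) / (1 + ε)) +
      (ε - γ - γ * ε) / 16) * (1 + (ε - γ - γ * ε) / 16 + γ) ≤ 1 - (ε - γ - γ * ε) / 16 := by
  set τ := ε - γ - γ * ε with hτd
  have hγ2 : γ ≤ 1 / 2 := by nlinarith
  have hετ : γ + τ ≤ ε := by nlinarith
  have hτ1 : τ ≤ 1 := by nlinarith
  have hγτ : 0 < γ * τ := mul_pos hγ hτ
  -- Since `ε ≥ γ + τ`, the right side is at least `1 + γ + 7τ/8`. The left side is at most `1 + γ +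
  -- 33τ/64` plus second-order terms, which `γ ≤ 1/2` and `τ ≤ 1` keep below the difference.
  have key : ((1 + τ / 16) * (1 + τ / 4) + τ / 16 * (1 + ε)) * (1 + τ / 16 + γ) ≤
      (1 - τ / 16) * (1 + ε) := by
    have h1 : (1 + τ / 16) * (1 + τ / 4) ≤ 1 + 21 / 64 * τ := by nlinarith
    have h2 : τ / 16 * (1 + ε) ≤ τ / 8 := by nlinarith
    have h3 : ((1 + τ / 16) * (1 + τ / 4) + τ / 16 * (1 + ε)) * (1 + τ / 16 + γ) ≤
        (1 + 29 / 64 * τ) * (1 + τ / 16 + γ) :=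
      mul_le_mul_of_nonneg_right (by linarith) (by positivity)
    nlinarith
  have h1ε : 0 < 1 + ε := by linarith
  have : ((1 + τ / 16) * ((1 + τ / 4) / (1 + ε)) + τ / 16) * (1 + τ / 16 + γ) =
      (((1 + τ / 16) * (1 + τ / 4) + τ / 16 * (1 + ε)) * (1 + τ / 16 + γ)) / (1 + ε) := by
    field_simp
  rw [this, div_le_iff₀ h1ε]
  exact key

theorem logTerm_nonneg (ρ : ℝ) (hρ : 0 < ρ) : 0 ≤ logTerm ρ := by
  unfold logTerm
  split_ifs with h
  · refine Real.rpow_nonneg (Real.log_nonneg ?_) _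
    rw [one_le_div hρ]; exact h.le
  · exact le_rfl

/-- The infimum of the risk need not be attained, so the bound is applied at an `α` within
`σ²√D(α_max)` of it. This costs the `1` in the constant `1 + 4C`; the `4` comes from `κ = τ/4`. -/
theorem uniform_oracle_bound : ∃ C : ℝ, 0 < C ∧
    ∀ (H : ℝ → ℝ → ℝ) (p : ℕ → ℕ) (X : ∀ n, Matrix (Fin n) (Fin (p n)) ℝ)
      (aMin aMax : ℕ → ℝ) (K : ℝ),
      IsOrderedRegularization H → (∀ n, p n ≤ n) → (∀ n, IsUnit ((X n)ᵀ * X n)) →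
      (∀ n, 0 < aMin n ∧ aMin n ≤ aMax n) →
      (∀ n, ∀ α ∈ Icc (aMin n) (aMax n),
        D H (X n) (aMax n) ≤ D H (X n) α ∧ D H (X n) α ≤ D H (X n) (aMin n)) →
      (∀ n, ∀ α > 0, ∑ k, G H α (eigVal (X n) k) ≤ K * ∑ k, G H α (eigVal (X n) k) ^ 2) →
      Tendsto (fun n : ℕ => D H (X n) (aMin n) / n) atTop (𝓝 0) →
      (∀ᶠ n in atTop, 5 ≤ D H (X n) (aMax n)) →
      ∀ ε γ : ℝ, 0 < ε → ε ≤ 1 → 0 < γ → 0 < ε - γ - γ * ε →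
        ∀ᶠ n in atTop, 5 ≤ D H (X n) (aMax n) ∧
          ∀ (σ : ℝ) (β : Fin (p n) → ℝ) (αHat : (Fin n → ℝ) → ℝ),
          0 < σ → IsSelector H (X n) (aMin n) (aMax n) ε αHat →
          expectedDeviation H (X n) αHat σ β ≤ ENNReal.ofReal
            ((oracleRisk H (X n) (aMin n) (aMax n) ε σ β +
              C * (σ ^ 2 * √(D H (X n) (aMax n))) / (ε - γ - γ * ε)) / γ) := by
  obtain ⟨C, hC, hmain⟩ := expectedDeviation_le_of_bounds
  refine ⟨1 + 4 * C, by positivity, ?_⟩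
  intro H p X aMin aMax K hH hp hX ha hD hK hlim h5 ε γ hε hε1 hγ hτ
  set τ := ε - γ - γ * ε with hτd
  have hγ2 : γ ≤ 1 / 2 := by nlinarith
  have hτ1 : τ ≤ 1 := by nlinarith
  set δ := τ / 16 with hδd
  have hδ : 0 < δ := by positivity
  -- `K` carries no sign assumption; the later divisions need a positive constant.
  set K' := |K| + 1 with hK'd
  have hK' : 0 < K' := by positivity
  set k := 2 * K' / δ with hkd
  have hk : 0 < k := by positivity
  have hQ := one_le_Q_div_sq hε hε1
  set c := 4 * (1 + 4 * (Q / ε ^ 2)) with hcd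
  have hc : 0 < c := by positivity
  -- `1/m` will bound `D/n`. The summands of `m` yield in turn `128 k²/m ≤ 1`, smallness of `V/n`
  -- and `q` relative to `δ`, and `1/m ≤ 1`.
  set m := 128 * k ^ 2 + (c + 2 * K') / δ + 1 with hmd
  have hm1 : 1 ≤ m := by have : 0 ≤ 128 * k ^ 2 + (c + 2 * K') / δ := by positivity
                         linarith
  have hm0 : 0 < m := by linarith
  have hdm : ∀ x, x ≤ m → x * (1 / m) ≤ 1 := fun x hx => by
    rw [mul_one_div, div_le_one hm0]; exact hx
  have hkm : 128 * k ^ 2 ≤ m := by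
    have : 0 ≤ (c + 2 * K') / δ := by positivity
    linarith
  have hcm : c / δ ≤ m ∧ 2 * K' / δ ≤ m := by
    have h1 : (c + 2 * K') / δ = c / δ + 2 * K' / δ := add_div _ _ _
    have h2 : 0 < c / δ := by positivity
    have h3 : 0 < 2 * K' / δ := by positivity
    have h4 : 0 ≤ 128 * k ^ 2 := by positivity
    constructor <;> linarith
  have hscale : ∀ x, x / δ ≤ m → x * (1 / m) ≤ δ := fun x hx => by
    rw [mul_one_div, div_le_iff₀ hm0]
    rw [div_le_iff₀ hδ] at hx
    linarith
  have hlarge : ∀ᶠ n : ℕ in atTop, 24576 * k + 24576 * c / δ ^ 3 ≤ n :=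
    tendsto_natCast_atTop_atTop.eventually_ge_atTop _
  filter_upwards [h5, hlim.eventually_le_const (show (0 : ℝ) < 1 / m by positivity), hlarge,
    eventually_gt_atTop 0] with n h5n hdn hln hn
  refine ⟨h5n, fun σ β αHat hσ hsel => ?_⟩
  have hn0 : (0 : ℝ) < n := by exact_mod_cast hn
  have hl : ∀ j, 0 ≤ eigVal (X n) j := fun j => (eigVal_pos (hX n) j).le
  have hpos : ∀ α ∈ Icc (aMin n) (aMax n), 0 < α := fun α hα => (ha n).1.trans_le hα.1
  have hDn : ∀ α ∈ Icc (aMin n) (aMax n), D H (X n) α / n ≤ 1 / m := fun α hα =>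
    (div_le_div_of_nonneg_right (hD n α hα).2 hn0.le).trans hdn
  have hDpos : ∀ α ∈ Icc (aMin n) (aMax n), 0 < D H (X n) α := fun α hα => by
    have := (hD n α hα).1; linarith
  have hqb : ∀ α ∈ Icc (aMin n) (aMax n), 1 - (∑ j, G H α (eigVal (X n) j)) / n ≠ 0 ∧
      0 ≤ q H (X n) α ∧ q H (X n) α ≤ 2 * (K' * (D H (X n) α / n)) ∧
      2 * (K' * (D H (X n) α / n)) ≤ δ := by
    intro α hα
    have h1 : 2 * (K' * (D H (X n) α / n)) ≤ δ := by
      calc 2 * (K' * (D H (X n) α / n)) = 2 * K' * (D H (X n) α / n) := by ring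
        _ ≤ 2 * K' * (1 / m) := mul_le_mul_of_nonneg_left (hDn α hα) (by positivity)
        _ ≤ δ := hscale _ hcm.2
    have h2 := q_bounds H (X n) (α := α) (K := K') hn
      (Finset.sum_nonneg fun j _ => (G_mem_Icc hH (hpos α hα) (hl j)).1)
      ((hK n α (hpos α hα)).trans (by
        change K * D H (X n) α ≤ _
        have := hDpos α hα
        gcongr
        linarith [le_abs_self K])) (by linarith)
    exact ⟨h2.1, h2.2.1, h2.2.2, h1⟩
  have hVc : ∀ α ∈ Icc (aMin n) (aMax n), V H (X n) (aMax n) ε α ≤ c * D H (X n) α :=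
    fun α hα => V_le_mul_D H (X n) hε hε1 (by linarith) (hD n α hα).1
  have hbound := hmain n (p n) (X n) H (aMin n) (aMax n) ε (1 / m) δ γ (τ / 4) k c σ β αHat hn
    (hp n) (hX n) hH (ha n).1 h5n (fun α hα => (hD n α hα).1)
    (fun α hα => (div_le_iff₀ hn0).1 (hDn α hα))
    (by rw [div_le_one hm0]; exact hm1) hk (by rw [← mul_assoc]; exact hdm _ hkm)
    (by have : 0 < 24576 * c / δ ^ 3 := by positivity
        linarith)
    (by have h1 : 24576 * c / δ ^ 3 ≤ n := by linarith
        rw [div_le_iff₀ (by positivity)] at h1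
        linarith)
    hc hδ (by linarith) hγ (by linarith) hε (by positivity) (by linarith)
    (envelope_balance hε hε1 hγ hτ) (fun α hα => (hqb α hα).1) (fun α hα => (hqb α hα).2.1)
    (fun α hα => (hqb α hα).2.2.1.trans (hqb α hα).2.2.2)
    (fun α hα => (hqb α hα).2.2.1.trans (le_of_eq (by rw [hkd]; field_simp)))
    (fun α hα => (hVc α hα).trans (by
      have h1 : c * (D H (X n) α / n) ≤ δ :=
        (mul_le_mul_of_nonneg_left (hDn α hα) hc.le).trans (hscale _ hcm.1)
      rw [← mul_div_assoc, div_le_iff₀ hn0] at h1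
      exact h1)) hVc
    (fun α _ h => sqrt_log_le_V H (X n) hε hε1 h)
    (fun α _ h => logEnvelope_le_V H (X n) hε hε1 (by linarith)) hσ hsel
  have hs0 : 0 < σ ^ 2 * √(D H (X n) (aMax n)) := by
    have : 0 < √(D H (X n) (aMax n)) := Real.sqrt_pos.2 (by linarith)
    positivity
  obtain ⟨_, ⟨α, hα, rfl⟩, hαr⟩ := exists_lt_of_csInf_lt
    (s := risk H (X n) (aMax n) ε σ β '' Icc (aMin n) (aMax n))
    ((nonempty_Icc.2 (ha n).2).image _)
    (lt_add_of_pos_right (oracleRisk H (X n) (aMin n) (aMax n) ε σ β) hs0)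
  refine (hbound α hα).trans (ENNReal.ofReal_le_ofReal ?_)
  refine div_le_div_of_nonneg_right ?_ hγ.le
  have h1 : C * (σ ^ 2 * √(D H (X n) (aMax n))) / (τ / 4) =
      4 * C * (σ ^ 2 * √(D H (X n) (aMax n))) / τ := by field_simp
  have h2 : σ ^ 2 * √(D H (X n) (aMax n)) ≤ σ ^ 2 * √(D H (X n) (aMax n)) / τ := by
    rw [le_div_iff₀ hτ]; nlinarith
  have h3 : (1 + 4 * C) * (σ ^ 2 * √(D H (X n) (aMax n))) / τ =
      σ ^ 2 * √(D H (X n) (aMax n)) / τ + 4 * C * (σ ^ 2 * √(D H (X n) (aMax n))) / τ := by ring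
  rw [h1, h3]
  linarith

theorem theorem2 :
    ∃ C : ℝ, 0 < C ∧
      ∀ (H : ℝ → ℝ → ℝ) (p : ℕ → ℕ) (X : ∀ n, Matrix (Fin n) (Fin (p n)) ℝ)
        (aMin aMax : ℕ → ℝ) (K : ℝ),
        IsOrderedRegularization H →
        (∀ n, p n ≤ n) →
        (∀ n, IsUnit ((X n)ᵀ * X n)) →
        (∀ n, 0 < aMin n ∧ aMin n ≤ aMax n) →
        (∀ n, ∀ α ∈ Icc (aMin n) (aMax n),
          D H (X n) (aMax n) ≤ D H (X n) α ∧ D H (X n) α ≤ D H (X n) (aMin n)) →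
        (∀ n, ∀ α > 0, ∑ k, G H α (eigVal (X n) k) ≤ K * ∑ k, G H α (eigVal (X n) k) ^ 2) →
        Tendsto (fun n : ℕ => D H (X n) (aMin n) / n) atTop (𝓝 0) →
        (∀ᶠ n in atTop, 5 ≤ D H (X n) (aMax n)) →
        ∀ ε γ : ℝ, 0 < ε → ε ≤ 1 → 0 < γ → γ < ε / (1 + ε) →
          ∃ N : ℕ, ∀ n ≥ N, ∀ (σ : ℝ) (β : Fin (p n) → ℝ) (αHat : (Fin n → ℝ) → ℝ),
            0 < σ → IsSelector H (X n) (aMin n) (aMax n) ε αHat →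
            (0 < oracleRisk H (X n) (aMin n) (aMax n) ε σ β →
              expectedDeviation H (X n) αHat σ β ≤ ENNReal.ofReal
                (oracleRisk H (X n) (aMin n) (aMax n) ε σ β / γ *
                  (1 + D H (X n) (aMax n) ^ (-(1 / 4) : ℝ) *
                        logTerm (rho H (X n) (aMin n) (aMax n) ε σ β)
                    + √(C * rho H (X n) (aMin n) (aMax n) ε σ β / (ε - γ - γ * ε))) ^ 2)) ∧
            (oracleRisk H (X n) (aMin n) (aMax n) ε σ β = 0 →
              expectedDeviation H (X n) αHat σ β ≤ ENNReal.ofReal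
                (C * (σ ^ 2 * √(D H (X n) (aMax n))) / (γ * (ε - γ - γ * ε)))) := by
  obtain ⟨C, hC, h⟩ := uniform_oracle_bound
  refine ⟨C, hC, ?_⟩
  intro H p X aMin aMax K hH hp hX ha hD hK hlim h5 ε γ hε hε1 hγ hγε
  have hτ : 0 < ε - γ - γ * ε := by
    rw [lt_div_iff₀ (by linarith)] at hγε
    linarith
  obtain ⟨N, hN⟩ := eventually_atTop.1 (h H p X aMin aMax K hH hp hX ha hD hK hlim h5 ε γ hε hε1 hγ hτ)
  refine ⟨N, fun n hn σ β αHat hσ hsel => ?_⟩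
  obtain ⟨h5n, hb⟩ := hN n hn
  have hbound := hb σ β αHat hσ hsel
  refine ⟨fun hr => hbound.trans (ENNReal.ofReal_le_ofReal ?_), fun hr => hbound.trans
    (ENNReal.ofReal_le_ofReal (le_of_eq ?_))⟩
  · set r := oracleRisk H (X n) (aMin n) (aMax n) ε σ β with hrd
    set s := σ ^ 2 * √(D H (X n) (aMax n)) with hsd
    have hs : 0 < s := mul_pos (by positivity) (Real.sqrt_pos.2 (by linarith))
    have hρ : rho H (X n) (aMin n) (aMax n) ε σ β = s / r := rfl
    rw [hρ]
    have hρ0 : 0 < s / r := div_pos hs hr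
    have ht : 0 ≤ D H (X n) (aMax n) ^ (-(1 / 4) : ℝ) * logTerm (s / r) :=
      mul_nonneg (Real.rpow_nonneg (by linarith) _) (logTerm_nonneg _ hρ0)
    set t := D H (X n) (aMax n) ^ (-(1 / 4) : ℝ) * logTerm (s / r)
    have hy0 : 0 ≤ √(C * (s / r) / (ε - γ - γ * ε)) := Real.sqrt_nonneg _
    have hy2 : √(C * (s / r) / (ε - γ - γ * ε)) ^ 2 = C * (s / r) / (ε - γ - γ * ε) :=
      Real.sq_sqrt (by positivity)
    set y := √(C * (s / r) / (ε - γ - γ * ε))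
    calc (r + C * s / (ε - γ - γ * ε)) / γ = r / γ * (1 + y ^ 2) := by
          rw [hy2]; field_simp
      -- The logarithmic term `t` is nonnegative, so `1 + y² ≤ (1 + t + y)²`.
      _ ≤ r / γ * (1 + t + y) ^ 2 := by
          gcongr
          nlinarith [mul_nonneg ht hy0]
  · rw [hr, zero_add, div_div, mul_comm γ (_ - _)]
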